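/- Let $5\le n\le 15$, let $\omega_n$ be the volume of the unit ball of $\mathbb{R}^n$, and put $$U_{ij}(x)=\frac{1}{2n\omega_n}\left[\frac{\delta_{ij}}{(n-2)|x|^{n-2}}+\frac{x_ix_j}{|x|^n}\right],\qquad P_j(x)=\frac{1}{n\omega_n}\frac{x_j}{|x|^n}.$$ Let $C_d^1(\mathbb{R}^n)$ be the closure of the space of smooth, divergence-free, compactly supported vector fields on $\mathbb{R}^n$ under the norm $$\|u\|_{C_d^1}=\big\|(1+|\cdot|)^{n-3}u\big\|_{L^\infty(\mathbb{R}^n)}+\big\|(1+|\cdot|)^{n-2}\nabla u\big\|_{L^\infty(\mathbb{R}^n)}.$$ Then there is an exponent $r\in(n/2,\infty)$, depending only on $n$, with the following property. For all real $D$ and $M$ there is a constant $C>0$, depending only on $n$, $r$, $D$ and $M$, such that for every vector field $f\in L^\infty(\mathbb{R}^n)$ with compact (essential) support, $\operatorname{diam}(\operatorname{supp} f)\le D$ and $\|f\|_{L^\infty(\mathbb{R}^n)}\le M$, and every $u\in C_d^1(\mathbb{R}^n)$ that satisfies (with summation over repeated indices) $$u_i(x)=\int_{\mathbb{R}^n}U_{ij}(x-y)\big(f_j(y)-u_k(y)\,\partial_ku_j(y)\big)\,dy\qquad(x\in\mathbb{R}^n,\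 1\le i\le n),$$ the functions $$p(x)=\int_{\mathbb{R}^n}P_j(x-y)\big(f_j(y)-u_k(y)\,\partial_ku_j(y)\big)\,dy,\qquad \theta=\frac{|u|^2}{2}+p,\qquad \theta_+=\max\{\theta,0\}$$ satisfy $\theta_+\in L^r(\mathbb{R}^n)$ and $$\|\theta_+\|_{L^r(\mathbb{R}^n)}\le C.$$ -/

import Mathlib

open MeasureTheory Topology
open scoped ENNReal ContDiff

noncomputable section

namespace StationaryNS

/-- The Euclidean space of dimension `n`. -/
abbrev E (n : ℕ) : Type := EuclideanSpace ℝ (Fin n)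

/-- The volume of the unit ball of dimension `n`. -/
def unitBallVolume (n : ℕ) : ℝ := volume.real (Metric.ball (0 : E n) 1)

/-- The velocity part `U_ij` of the fundamental solution of the stationary Stokes equations. -/
def stokesU (n : ℕ) (i j : Fin n) (x : E n) : ℝ :=
  1 / (2 * n * unitBallVolume n) *
    ((if i = j then 1 else 0) / (((n : ℝ) - 2) * ‖x‖ ^ ((n : ℝ) - 2)) + x i * x j / ‖x‖ ^ n)

/-- The pressure part `P_j` of the fundamental solution of the stationary Stokes equations. -/
def stokesP (n : ℕ) (j : Fin n) (x : E n) : ℝ :=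
  1 / (n * unitBallVolume n) * (x j / ‖x‖ ^ n)

/-- The divergence of a vector field. -/
def divergence {n : ℕ} (u : E n → E n) (x : E n) : ℝ :=
  ∑ i, (fderiv ℝ u x (EuclideanSpace.single i 1)) i

/-- Smooth, divergence-free and compactly supported vector fields. -/
def IsSolenoidalTest {n : ℕ} (φ : E n → E n) : Prop :=
  ContDiff ℝ ∞ φ ∧ HasCompactSupport φ ∧ ∀ x, divergence φ x = 0

/-- The weighted norm of `C_d^1`, with values in `[0, ∞]`. The gradient is measured by its operator
norm, which is equivalent to the Euclidean norm of the matrix of partial derivatives, so the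
closure below does not depend on this choice. -/
def cd1Norm {n : ℕ} (u : E n → E n) : ℝ≥0∞ :=
  eLpNorm (fun x => (1 + ‖x‖) ^ ((n : ℝ) - 3) * ‖u x‖) ∞ volume +
    eLpNorm (fun x => (1 + ‖x‖) ^ ((n : ℝ) - 2) * ‖fderiv ℝ u x‖) ∞ volume

/-- The space `C_d^1`: the closure of the solenoidal test fields under the weighted norm. The
limits in that norm are continuously differentiable vector fields. -/
def MemCd1 {n : ℕ} (u : E n → E n) : Prop :=
  ContDiff ℝ 1 u ∧
    ∀ ε : ℝ≥0∞, 0 < ε → ∃ φ : E n → E n, IsSolenoidalTest φ ∧ cd1Norm (u - φ) < ε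

/-- The support of `f` as an element of `L^∞`: the complement of the largest open set on which
`f` vanishes almost everywhere. -/
def essSupport {n : ℕ} (f : E n → E n) : Set (E n) :=
  {x | ¬ ∃ V ∈ 𝓝 x, ∀ᵐ y, y ∈ V → f y = 0}

/-- The vector field `f - (u · ∇) u`; the derivative of `u` at `y` applied to `u y` has the
components `∑ k, u_k(y) ∂_k u_j(y)`. -/
def source {n : ℕ} (f u : E n → E n) (y : E n) : E n :=
  f y - fderiv ℝ u y (u y)

/-- The integral equation
`u_i(x) = ∫ U_ij(x - y) (f_j(y) - u_k(y) ∂_k u_j(y)) dy`, with summation over `j` and `k`. -/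
def SolvesIntegralEquation {n : ℕ} (f u : E n → E n) : Prop :=
  ∀ (x : E n) (i : Fin n), u x i = ∫ y, ∑ j, stokesU n i j (x - y) * source f u y j

/-- The pressure `p(x) = ∫ P_j(x - y) (f_j(y) - u_k(y) ∂_k u_j(y)) dy`. -/
def pressure {n : ℕ} (f u : E n → E n) (x : E n) : ℝ :=
  ∫ y, ∑ j, stokesP n j (x - y) * source f u y j

/-- The total head pressure `θ = |u|² / 2 + p`. -/
def headPressure {n : ℕ} (f u : E n → E n) (x : E n) : ℝ :=
  ‖u x‖ ^ 2 / 2 + pressure f u x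

end StationaryNS

end

/-!
Write `F = f - (u · ∇)u`, so that `u` and `p` are the Stokes potentials of `F`. Since `F` decays like
`|x|⁻ⁿ`, the fields `u`, `∇u` and `p` decay like `|x|^(-(n - 9/4))`, which is square integrable, and
the equations `-Δu + ∇p = F`, `Δp = div F`, `div u = 0` hold in the weak sense. Mollification turns
them into exact equations for smooth decaying flows with a perturbed force, which converges to `f`
almost everywhere (`flowApprox_mollified`). Integral identities are proved for the smooth flows and
passed to the limit; the gradient of the limiting head pressure is never needed. There are three:

* the energy identity `∫ |∇u|² = ∫ u · f` (`FlowApprox.energy`);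
* the head pressure estimate: multiplying the equation of `θ = |u|²/2 + p` by `θ₊ ^ q` bounds
  `∫ θ₊ ^ (q - 1) |∇θ|²`, and hence by Sobolev's inequality the norm of `θ₊` in `Lʳ`,
  `r = (q + 1) n / (n - 2)`, by integrals of `|u| θ₊ ^ q` and `θ₊ ^ (q - 1)` over the support of the
  force (`exists_head_sobolev_limit`);
* a weighted estimate: testing the pressure equation with `|x - x₀| ^ (-(n - 41/10))` bounds
  `∫ |u|² |x - x₀| ^ (-(n - 21/10))` linearly by `θ₊` and `f` (`FlowApprox.weighted_estimate`). This
  uses `p = θ - |u|²/2 ≤ θ₊ - |u|²/2`, and `n - 41/10` lies below the threshold `n - 4` at which the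
  quadratic terms of the identity cease to have a favourable sign.

The energy identity bounds `∇u` in `L²`, and the head pressure estimate with `q = 5/4` then bounds `θ₊`
in an exponent that exceeds `n / 2` as long as `n ≤ 6` (`exists_energy_bounds`). For `n ≥ 7` let `A` be
the norm of `θ₊` in an exponent slightly above `n / 2`. The weighted estimate and Hölder's inequality
bound `|u| ^ (9/5)`, restricted to the support of the force and integrated against the kernel
`|x - y| ^ (2 - n)`, by `C (1 + A) ^ (9/10)`. Since `|u|` is dominated by the Riesz potential of order
one of `|∇u|`, Schur's test (`exists_weighted_riesz_le`) turns this into a bound for the integral of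
`|u| ^ (19/5)` over the support by the same quantity, and the head pressure estimate becomes
`A ≤ C (1 + A) ^ (9/38)`. This sublinear inequality bounds `A` (`exists_head_bound`). These exponents in
Hölder's inequality are admissible for `n ≤ 15` only.
-/

open Set Filter Metric

noncomputable section

namespace StationaryNS

/-! ### Riesz kernels and power weights -/

lemma lintegral_one_add_enorm_rpow_lt_top {n : ℕ} {b : ℝ} (hb : (n : ℝ) < b) :
    ∫⁻ y : E n, (1 + ‖y‖ₑ) ^ (-b) < ⊤ := by
  have h := finite_integral_one_add_norm (E := E n) (μ := volume) (r := b) (by simpa using hb)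
  refine lt_of_eq_of_lt (lintegral_congr fun y => ?_) h
  rw [← ENNReal.ofReal_rpow_of_pos (by positivity), ENNReal.ofReal_add zero_le_one (norm_nonneg _),
    ofReal_norm, ENNReal.ofReal_one]

lemma enorm_eq_ofReal_norm {n : ℕ} (y : E n) : ‖y‖ₑ = ENNReal.ofReal ‖y‖ :=
  (ofReal_norm y).symm

lemma lintegral_ball_enorm_rpow_lt_top {n : ℕ} (hn : 0 < n) {a : ℝ} (ha : a < n) :
    ∫⁻ y in ball (0 : E n) 1, ‖y‖ₑ ^ (-a) < ⊤ := by
  have : Nontrivial (E n) := by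
    have : Nonempty (Fin n) := ⟨⟨0, hn⟩⟩
    infer_instance
  have h : IntegrableOn (fun x : E n => ‖x‖ ^ (-a)) (ball (0 : E n) 1) volume := by
    refine (integrableOn_fun_norm_addHaar (E := E n) volume (f := fun r => r ^ (-a))).2 ?_
    have h1 : IntervalIntegrable (fun y : ℝ => y ^ ((n : ℝ) - 1 - a)) volume 0 1 :=
      intervalIntegral.intervalIntegrable_rpow' (by linarith)
    rw [intervalIntegrable_iff_integrableOn_Ioo_of_le zero_le_one] at h1
    refine h1.congr_fun (fun y hy => ?_) measurableSet_Ioo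
    have hy0 : 0 < y := hy.1
    simp only [smul_eq_mul, finrank_euclideanSpace, Fintype.card_fin]
    rw [← Real.rpow_natCast, ← Real.rpow_add hy0, Nat.cast_sub (by omega)]
    congr 1
    push_cast; ring
  have h2 := h.2
  refine lt_of_eq_of_lt (setLIntegral_congr_fun_ae measurableSet_ball ?_) h2
  have : ∀ᵐ y : E n, y ≠ 0 := by simp [ae_iff]
  filter_upwards [this] with y hy _
  have hy' : 0 < ‖y‖ := norm_pos_iff.2 hy
  rw [enorm_eq_ofReal_norm, ENNReal.ofReal_rpow_of_pos hy', Real.enorm_eq_ofReal (by positivity)]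

lemma rpow_mul_rpow_neg_le (X : ℝ≥0∞) {c a : ℝ} (ha : c < a) (hX : X ≠ ⊤) :
    X ^ c * X ^ (-a) ≤ X ^ (-(a - c)) := by
  rcases eq_or_ne X 0 with rfl | h0
  · rw [ENNReal.zero_rpow_of_neg (by linarith : -(a - c) < 0)]; exact le_top
  · rw [← ENNReal.rpow_add _ _ h0 hX]; exact le_of_eq (by ring_nf)

lemma enorm_rpow_neg_le {n : ℕ} {a : ℝ} (ha : 0 ≤ a) (z : E n) :
    ‖z‖ₑ ^ (-a) ≤ (ball (0 : E n) 1).indicator (fun z => ‖z‖ₑ ^ (-a)) z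
      + 2 ^ a * (1 + ‖z‖ₑ) ^ (-a) := by
  by_cases hz : z ∈ ball (0 : E n) 1
  · rw [indicator_of_mem hz]; exact le_self_add
  · rw [indicator_of_notMem hz, zero_add]
    have h1 : (1 : ℝ≥0∞) ≤ ‖z‖ₑ := by
      rw [enorm_eq_ofReal_norm, ← ENNReal.ofReal_one]
      exact ENNReal.ofReal_le_ofReal (by simpa using hz)
    have h2 : 1 + ‖z‖ₑ ≤ 2 * ‖z‖ₑ := by rw [two_mul]; gcongr
    have h3 : (1 + ‖z‖ₑ) ^ a ≤ 2 ^ a * ‖z‖ₑ ^ a := by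
      rw [← ENNReal.mul_rpow_of_nonneg _ _ ha]; exact ENNReal.rpow_le_rpow h2 ha
    rw [ENNReal.rpow_neg, ENNReal.rpow_neg]
    have hp : ‖z‖ₑ ^ a ≠ 0 := by
      simp only [ne_eq, ENNReal.rpow_eq_zero_iff, not_or, not_and]
      exact ⟨fun h => by simp [h] at h1, fun h => by simp at h⟩
    have hp' : ‖z‖ₑ ^ a ≠ ⊤ := ENNReal.rpow_ne_top_of_nonneg ha (by simp)
    have hq : (1 + ‖z‖ₑ) ^ a ≠ 0 := by
      simp [ENNReal.rpow_eq_zero_iff]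
    have hq' : (1 + ‖z‖ₑ) ^ a ≠ ⊤ := ENNReal.rpow_ne_top_of_nonneg ha (by simp)
    rw [ENNReal.inv_le_iff_le_mul (fun _ => hp) (fun h => absurd h hp')]
    calc 1 = (1 + ‖z‖ₑ) ^ a * ((1 + ‖z‖ₑ) ^ a)⁻¹ := (ENNReal.mul_inv_cancel hq hq').symm
      _ ≤ (2 ^ a * ‖z‖ₑ ^ a) * ((1 + ‖z‖ₑ) ^ a)⁻¹ := by gcongr
      _ = _ := by ring

lemma rpow_neg_le_rpow_neg {X Y : ℝ≥0∞} {b : ℝ} (hb : 0 ≤ b) (h : X ≤ Y) :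
    Y ^ (-b) ≤ X ^ (-b) := by
  rw [ENNReal.rpow_neg, ENNReal.rpow_neg]
  exact ENNReal.inv_le_inv.2 (ENNReal.rpow_le_rpow h hb)

lemma rpow_neg_mul_rpow_neg_le {X Y : ℝ≥0∞} {a b : ℝ} (ha : 0 ≤ a) (hb : 0 ≤ b)
    (hX : 1 ≤ X) (hY : 1 ≤ Y) (hX' : X ≠ ⊤) (hY' : Y ≠ ⊤) :
    X ^ (-a) * Y ^ (-b) ≤ X ^ (-(a + b)) + Y ^ (-(a + b)) := by
  have hX0 : X ≠ 0 := fun h => by simp [h] at hX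
  have hY0 : Y ≠ 0 := fun h => by simp [h] at hY
  rcases le_total X Y with h | h
  · refine le_trans ?_ le_self_add
    have : Y ^ (-b) ≤ X ^ (-b) := rpow_neg_le_rpow_neg (by assumption) h
    calc X ^ (-a) * Y ^ (-b) ≤ X ^ (-a) * X ^ (-b) := by gcongr
      _ = _ := by rw [← ENNReal.rpow_add _ _ hX0 hX']; ring_nf
  · refine le_trans ?_ le_add_self
    have : X ^ (-a) ≤ Y ^ (-a) := rpow_neg_le_rpow_neg (by assumption) h
    calc X ^ (-a) * Y ^ (-b) ≤ Y ^ (-a) * Y ^ (-b) := by gcongr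
      _ = _ := by rw [← ENNReal.rpow_add _ _ hY0 hY']; ring_nf

/-- A Riesz kernel integrated against a power weight is bounded uniformly in the pole as soon as
the total decay exceeds the dimension. -/
lemma lintegral_riesz_weight_le {n : ℕ} (hn : 0 < n) {a b : ℝ} (ha : 0 ≤ a) (han : a < n)
    (hb : 0 ≤ b) (hab : n < a + b) :
    ∃ C : ℝ≥0∞, C < ⊤ ∧ ∀ x : E n, ∫⁻ y, ‖x - y‖ₑ ^ (-a) * (1 + ‖y‖ₑ) ^ (-b) ≤ C := by
  set A := ∫⁻ y in ball (0 : E n) 1, ‖y‖ₑ ^ (-a)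
  set B := ∫⁻ y : E n, (1 + ‖y‖ₑ) ^ (-(a + b))
  have hA : A < ⊤ := lintegral_ball_enorm_rpow_lt_top hn han
  have hB : B < ⊤ := lintegral_one_add_enorm_rpow_lt_top hab
  refine ⟨A + 2 ^ a * (B + B), ?_, fun x => ?_⟩
  · refine ENNReal.add_lt_top.2 ⟨hA, ENNReal.mul_lt_top ?_ (ENNReal.add_lt_top.2 ⟨hB, hB⟩)⟩
    exact ENNReal.rpow_lt_top_of_nonneg ha (by simp)
  have hle : ∀ y : E n, ‖x - y‖ₑ ^ (-a) * (1 + ‖y‖ₑ) ^ (-b) ≤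
      (ball (0 : E n) 1).indicator (fun z => ‖z‖ₑ ^ (-a)) (x - y)
        + 2 ^ a * ((1 + ‖x - y‖ₑ) ^ (-(a + b)) + (1 + ‖y‖ₑ) ^ (-(a + b))) := by
    intro y
    have h1 : (1 + ‖y‖ₑ) ^ (-b) ≤ 1 := by
      have := rpow_neg_le_rpow_neg hb (le_self_add : (1 : ℝ≥0∞) ≤ 1 + ‖y‖ₑ)
      rwa [ENNReal.one_rpow] at this
    calc _ ≤ ((ball (0 : E n) 1).indicator (fun z => ‖z‖ₑ ^ (-a)) (x - y)
          + 2 ^ a * (1 + ‖x - y‖ₑ) ^ (-a)) * (1 + ‖y‖ₑ) ^ (-b) := by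
          gcongr; exact enorm_rpow_neg_le ha _
      _ = (ball (0 : E n) 1).indicator (fun z => ‖z‖ₑ ^ (-a)) (x - y) * (1 + ‖y‖ₑ) ^ (-b)
          + 2 ^ a * ((1 + ‖x - y‖ₑ) ^ (-a) * (1 + ‖y‖ₑ) ^ (-b)) := by ring
      _ ≤ (ball (0 : E n) 1).indicator (fun z => ‖z‖ₑ ^ (-a)) (x - y) * 1
          + 2 ^ a * ((1 + ‖x - y‖ₑ) ^ (-(a + b)) + (1 + ‖y‖ₑ) ^ (-(a + b))) := by
          gcongr
          exact rpow_neg_mul_rpow_neg_le ha hb le_self_add le_self_add (by simp) (by simp)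
      _ = _ := by rw [mul_one]
  have hm : Measurable fun z : E n => ‖z‖ₑ ^ (-a) := by fun_prop
  have hm1 : Measurable ((ball (0 : E n) 1).indicator fun z : E n => ‖z‖ₑ ^ (-a)) :=
    hm.indicator measurableSet_ball
  refine (lintegral_mono hle).trans (le_of_eq ?_)
  rw [lintegral_add_left (by fun_prop), lintegral_const_mul _ (by fun_prop),
    lintegral_add_left (by fun_prop), lintegral_sub_left_eq_self
      ((ball (0 : E n) 1).indicator fun z : E n => ‖z‖ₑ ^ (-a)) x,
    lintegral_sub_left_eq_self (fun z : E n => (1 + ‖z‖ₑ) ^ (-(a + b))) x,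
    lintegral_indicator measurableSet_ball]

lemma add_rpow_le_two_rpow_mul {X Y : ℝ≥0∞} {c : ℝ} (hc : 0 ≤ c) :
    (X + Y) ^ c ≤ 2 ^ c * (X ^ c + Y ^ c) := by
  rcases le_total X Y with h | h
  · calc (X + Y) ^ c ≤ (2 * Y) ^ c := by
          refine ENNReal.rpow_le_rpow ?_ hc
          rw [two_mul]; gcongr
      _ = 2 ^ c * Y ^ c := ENNReal.mul_rpow_of_nonneg _ _ hc
      _ ≤ _ := by gcongr; exact le_add_self
  · calc (X + Y) ^ c ≤ (2 * X) ^ c := by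
          refine ENNReal.rpow_le_rpow ?_ hc
          rw [two_mul]; gcongr
      _ = 2 ^ c * X ^ c := ENNReal.mul_rpow_of_nonneg _ _ hc
      _ ≤ _ := by gcongr; exact le_self_add

/-- The Riesz potential of a function that decays like `|y|⁻ⁿ` decays almost as fast as the
kernel. -/
lemma lintegral_riesz_weight_decay {n : ℕ} (hn : 0 < n) {a c : ℝ} (hc : 0 ≤ c) (hca : c < a)
    (han : a < n) :
    ∃ C : ℝ≥0∞, C < ⊤ ∧ ∀ x : E n, ∫⁻ y, ‖x - y‖ₑ ^ (-a) * (1 + ‖y‖ₑ) ^ (-(n : ℝ)) ≤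
      C * (1 + ‖x‖ₑ) ^ (-c) := by
  obtain ⟨C1, hC1, h1⟩ := lintegral_riesz_weight_le hn (a := a - c) (b := n) (by linarith)
    (by linarith) (by positivity) (by linarith)
  obtain ⟨C2, hC2, h2⟩ := lintegral_riesz_weight_le hn (a := a) (b := n - c) (by linarith)
    (by linarith) (by linarith) (by linarith)
  have h2c : (2 : ℝ≥0∞) ^ c < ⊤ := ENNReal.rpow_lt_top_of_nonneg hc (by simp)
  refine ⟨2 ^ c * (C1 + C2), ENNReal.mul_lt_top h2c (ENNReal.add_lt_top.2 ⟨hC1, hC2⟩),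
    fun x => ?_⟩
  have hx0 : (1 + ‖x‖ₑ) ^ c ≠ 0 := by simp [ENNReal.rpow_eq_zero_iff]
  have hx1 : (1 + ‖x‖ₑ) ^ c ≠ ⊤ := ENNReal.rpow_ne_top_of_nonneg hc (by simp)
  rw [ENNReal.rpow_neg, ← div_eq_mul_inv, ENNReal.le_div_iff_mul_le (Or.inl hx0) (Or.inl hx1),
    mul_comm, ← lintegral_const_mul _ (by fun_prop)]
  have hle : ∀ y : E n, (1 + ‖x‖ₑ) ^ c * (‖x - y‖ₑ ^ (-a) * (1 + ‖y‖ₑ) ^ (-(n : ℝ))) ≤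
      2 ^ c * (‖x - y‖ₑ ^ (-(a - c)) * (1 + ‖y‖ₑ) ^ (-(n : ℝ))
        + ‖x - y‖ₑ ^ (-a) * (1 + ‖y‖ₑ) ^ (-((n : ℝ) - c))) := by
    intro y
    have h3 : 1 + ‖x‖ₑ ≤ ‖x - y‖ₑ + (1 + ‖y‖ₑ) := by
      have : ‖x‖ₑ ≤ ‖x - y‖ₑ + ‖y‖ₑ := by simpa using enorm_add_le (x - y) y
      calc 1 + ‖x‖ₑ ≤ 1 + (‖x - y‖ₑ + ‖y‖ₑ) := by gcongr
        _ = _ := by ring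
    have h4 : (1 + ‖x‖ₑ) ^ c ≤ 2 ^ c * (‖x - y‖ₑ ^ c + (1 + ‖y‖ₑ) ^ c) :=
      (ENNReal.rpow_le_rpow h3 hc).trans (add_rpow_le_two_rpow_mul hc)
    calc _ ≤ 2 ^ c * (‖x - y‖ₑ ^ c + (1 + ‖y‖ₑ) ^ c) *
          (‖x - y‖ₑ ^ (-a) * (1 + ‖y‖ₑ) ^ (-(n : ℝ))) := by gcongr
      _ = 2 ^ c * ((‖x - y‖ₑ ^ c * ‖x - y‖ₑ ^ (-a)) * (1 + ‖y‖ₑ) ^ (-(n : ℝ))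
        + ‖x - y‖ₑ ^ (-a) * ((1 + ‖y‖ₑ) ^ c * (1 + ‖y‖ₑ) ^ (-(n : ℝ)))) := by ring
      _ ≤ _ := by
        gcongr
        · exact rpow_mul_rpow_neg_le _ hca (by simp)
        · exact rpow_mul_rpow_neg_le _ (by linarith) (by simp)
  refine (lintegral_mono hle).trans ?_
  rw [lintegral_const_mul _ (by fun_prop), lintegral_add_left (by fun_prop)]
  gcongr
  · exact h1 x
  · exact h2 x

/-! ### Functions with power decay -/

/-- `g` decays at least as fast as `(1 + |x|)⁻ᵝ`. -/
def Decay {n : ℕ} {G : Type*} [ENorm G] (β : ℝ) (g : E n → G) : Prop :=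
  ∃ C : ℝ≥0∞, C < ⊤ ∧ ∀ x, ‖g x‖ₑ ≤ C * (1 + ‖x‖ₑ) ^ (-β)

section Decay
variable {n : ℕ} {G : Type*} [NormedAddCommGroup G] {β γ : ℝ}

lemma one_add_enorm_rpow_mono (x : E n) (h : β ≤ γ) :
    (1 + ‖x‖ₑ) ^ (-γ) ≤ (1 + ‖x‖ₑ) ^ (-β) :=
  ENNReal.rpow_le_rpow_of_exponent_le le_self_add (by linarith)

lemma one_add_enorm_rpow_add (x : E n) (β γ : ℝ) :
    (1 + ‖x‖ₑ) ^ (-(β + γ)) = (1 + ‖x‖ₑ) ^ (-β) * (1 + ‖x‖ₑ) ^ (-γ) := by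
  rw [← ENNReal.rpow_add _ _ (by simp) (by simp)]
  congr 1; ring

lemma one_add_enorm_rpow_le_one (x : E n) (h : 0 ≤ β) : (1 + ‖x‖ₑ) ^ (-β) ≤ 1 := by
  have := one_add_enorm_rpow_mono x h
  rwa [neg_zero, ENNReal.rpow_zero] at this

lemma Decay.mono {g : E n → G} (hg : Decay γ g) (h : β ≤ γ) : Decay β g := by
  obtain ⟨C, hC, hg⟩ := hg
  exact ⟨C, hC, fun x => (hg x).trans (mul_le_mul' le_rfl (one_add_enorm_rpow_mono x h))⟩

lemma Decay.of_le {G' : Type*} [NormedAddCommGroup G'] {g : E n → G} {g' : E n → G'}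
    (hg : Decay β g) (h : ∀ x, ‖g' x‖ ≤ ‖g x‖) : Decay β g' := by
  obtain ⟨C, hC, hg⟩ := hg
  refine ⟨C, hC, fun x => le_trans ?_ (hg x)⟩
  rw [← ofReal_norm, ← ofReal_norm]
  exact ENNReal.ofReal_le_ofReal (h x)

lemma Decay.neg {g : E n → G} (hg : Decay β g) : Decay β (fun x => - g x) :=
  hg.of_le (by simp)

lemma Decay.add {f g : E n → G} (hf : Decay β f) (hg : Decay β g) :
    Decay β (fun x => f x + g x) := by
  obtain ⟨C, hC, hf⟩ := hf
  obtain ⟨D, hD, hg⟩ := hg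
  refine ⟨C + D, ENNReal.add_lt_top.2 ⟨hC, hD⟩, fun x => (enorm_add_le _ _).trans ?_⟩
  rw [add_mul]; exact add_le_add (hf x) (hg x)

lemma Decay.sub {f g : E n → G} (hf : Decay β f) (hg : Decay β g) :
    Decay β (fun x => f x - g x) := by
  simpa [sub_eq_add_neg] using hf.add hg.neg

lemma decay_zero : Decay β (fun _ : E n => (0 : G)) := ⟨0, by simp, by simp⟩

lemma Decay.sum {ι : Type*} {s : Finset ι} {f : ι → E n → G} (hf : ∀ i ∈ s, Decay β (f i)) :
    Decay β (fun x => ∑ i ∈ s, f i x) := by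
  classical
  induction s using Finset.induction_on with
  | empty => simpa using decay_zero
  | insert a s ha ih =>
    simp only [Finset.sum_insert ha]
    exact (hf a (by simp)).add (ih fun i hi => hf i (by simp [hi]))

lemma Decay.mul {f g : E n → ℝ} (hf : Decay β f) (hg : Decay γ g) :
    Decay (β + γ) (fun x => f x * g x) := by
  obtain ⟨C, hC, hf⟩ := hf
  obtain ⟨D, hD, hg⟩ := hg
  refine ⟨C * D, ENNReal.mul_lt_top hC hD, fun x => ?_⟩
  rw [enorm_mul, one_add_enorm_rpow_add]
  calc ‖f x‖ₑ * ‖g x‖ₑ ≤ (C * (1 + ‖x‖ₑ) ^ (-β)) * (D * (1 + ‖x‖ₑ) ^ (-γ)) := by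
        gcongr
        exacts [hf x, hg x]
    _ = _ := by ring

lemma Decay.const_mul {f : E n → ℝ} (hf : Decay β f) (c : ℝ) : Decay β (fun x => c * f x) := by
  obtain ⟨C, hC, hf⟩ := hf
  refine ⟨‖c‖ₑ * C, ENNReal.mul_lt_top (by simp) hC, fun x => ?_⟩
  rw [enorm_mul, mul_assoc]
  gcongr
  exact hf x

lemma Decay.bounded {g : E n → G} (hg : Decay β g) (h : 0 ≤ β) : ∃ C : ℝ, 0 ≤ C ∧ ∀ x, ‖g x‖ ≤ C := by
  obtain ⟨C, hC, hg⟩ := hg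
  refine ⟨C.toReal, by simp, fun x => ?_⟩
  rw [← toReal_enorm]
  refine ENNReal.toReal_mono hC.ne ((hg x).trans ?_)
  calc C * (1 + ‖x‖ₑ) ^ (-β) ≤ C * 1 := by gcongr; exact one_add_enorm_rpow_le_one x h
    _ = C := mul_one _

lemma decay_zero_of_bounded {g : E n → G} {C : ℝ} (h : ∀ x, ‖g x‖ ≤ C) : Decay 0 g := by
  refine ⟨ENNReal.ofReal C, by simp, fun x => ?_⟩
  rw [neg_zero, ENNReal.rpow_zero, mul_one, ← ofReal_norm]
  exact ENNReal.ofReal_le_ofReal (h x)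

lemma Decay.integrable {g : E n → G} (hg : Decay β g) (hm : AEStronglyMeasurable g volume)
    (h : (n : ℝ) < β) : Integrable g := by
  obtain ⟨C, hC, hg⟩ := hg
  refine ⟨hm, ?_⟩
  refine (lintegral_mono hg).trans_lt ?_
  rw [lintegral_const_mul _ (by fun_prop)]
  exact ENNReal.mul_lt_top hC (lintegral_one_add_enorm_rpow_lt_top h)

lemma HasCompactSupport.decay {g : E n → G} (hg : HasCompactSupport g) (hc : Continuous g)
    (hβ : 0 ≤ β) : Decay β g := by
  obtain ⟨M, hM⟩ := hc.bounded_above_of_compact_support hg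
  obtain ⟨R, hR⟩ := hg.isCompact.isBounded.subset_closedBall 0
  refine ⟨ENNReal.ofReal M * (1 + ENNReal.ofReal R) ^ β,
    ENNReal.mul_lt_top (by simp) (ENNReal.rpow_lt_top_of_nonneg hβ (by simp)), fun x => ?_⟩
  by_cases hx : x ∈ tsupport g
  · have h1 : ‖g x‖ₑ ≤ ENNReal.ofReal M := by
      rw [← ofReal_norm]; exact ENNReal.ofReal_le_ofReal (hM x)
    have h2 : ‖x‖ₑ ≤ ENNReal.ofReal R := by
      rw [← ofReal_norm]; exact ENNReal.ofReal_le_ofReal (by simpa using hR hx)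
    have h3 : (1 : ℝ≥0∞) ≤ (1 + ENNReal.ofReal R) ^ β * (1 + ‖x‖ₑ) ^ (-β) := by
      calc (1 : ℝ≥0∞) = (1 + ‖x‖ₑ) ^ β * (1 + ‖x‖ₑ) ^ (-β) := by
            rw [← ENNReal.rpow_add _ _ (by simp) (by simp)]; simp
        _ ≤ _ := by gcongr
    calc ‖g x‖ₑ ≤ ENNReal.ofReal M * 1 := by simpa using h1
      _ ≤ ENNReal.ofReal M * ((1 + ENNReal.ofReal R) ^ β * (1 + ‖x‖ₑ) ^ (-β)) := by gcongr
      _ = _ := by ring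
  · simp [image_eq_zero_of_notMem_tsupport hx]

lemma integrable_of_riesz_bound (hn : 0 < n) {a b : ℝ} (ha : 0 ≤ a) (han : a < n)
    (hb : 0 ≤ b) (hab : n < a + b) {g : E n → G} (hm : AEStronglyMeasurable g volume)
    {C : ℝ≥0∞} (hC : C < ⊤) (x : E n)
    (hg : ∀ y, ‖g y‖ₑ ≤ C * (‖x - y‖ₑ ^ (-a) * (1 + ‖y‖ₑ) ^ (-b))) : Integrable g := by
  obtain ⟨D, hD, h⟩ := lintegral_riesz_weight_le hn ha han hb hab
  refine ⟨hm, (lintegral_mono hg).trans_lt ?_⟩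
  rw [lintegral_const_mul _ (by fun_prop)]
  exact ENNReal.mul_lt_top hC ((h x).trans_lt hD)

end Decay

/-! ### Polar coordinates -/

lemma lintegral_volumeIoiPow (k : ℕ) {g : ℝ → ℝ≥0∞} (hg : Measurable g) :
    ∫⁻ r : Ioi (0 : ℝ), g r ∂(Measure.volumeIoiPow k) =
      ∫⁻ r in Ioi (0 : ℝ), ENNReal.ofReal (r ^ k) * g r := by
  rw [Measure.volumeIoiPow, lintegral_withDensity_eq_lintegral_mul _ (by fun_prop) (by fun_prop),
    ← lintegral_subtype_comap measurableSet_Ioi]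
  rfl

lemma integral_volumeIoiPow {F : Type*} [NormedAddCommGroup F] [NormedSpace ℝ F] (k : ℕ)
    (g : ℝ → F) :
    ∫ r : Ioi (0 : ℝ), g r ∂(Measure.volumeIoiPow k) = ∫ r in Ioi (0 : ℝ), r ^ k • g r := by
  simp only [Measure.volumeIoiPow, ENNReal.ofReal]
  rw [integral_withDensity_eq_integral_smul,
    integral_subtype_comap measurableSet_Ioi fun a ↦ Real.toNNReal (a ^ k) • g a,
    setIntegral_congr_fun measurableSet_Ioi fun x hx ↦ ?_]
  · rw [NNReal.smul_def, Real.coe_toNNReal _ (pow_nonneg hx.out.le _)]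
  · exact (measurable_subtype_coe.pow_const _).real_toNNReal

lemma lintegral_polar {n : ℕ} {f : E n → ℝ≥0∞} (hn : 0 < n) (hf : Measurable f) :
    ∫⁻ x, f x = ∫⁻ w : sphere (0 : E n) 1,
      (∫⁻ r in Ioi (0 : ℝ), ENNReal.ofReal (r ^ (n - 1)) * f (r • (w : E n)))
        ∂(volume : Measure (E n)).toSphere := by
  have : Nontrivial (E n) := by
    have : Nonempty (Fin n) := ⟨⟨0, hn⟩⟩
    infer_instance
  have hmp := (volume : Measure (E n)).measurePreserving_homeomorphUnitSphereProd
  have h1 : ∫⁻ x, f x = ∫⁻ x : ({0}ᶜ : Set (E n)), f x.1 ∂(volume.comap Subtype.val) := by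
    rw [lintegral_subtype_comap (measurableSet_singleton _).compl, restrict_compl_singleton]
  have h2 := hmp.lintegral_comp_emb (Homeomorph.measurableEmbedding _)
    (fun p => f ((p.2 : ℝ) • (p.1 : E n)))
  have h3 : ∀ x : ({0}ᶜ : Set (E n)), f (((homeomorphUnitSphereProd (E n) x).2 : ℝ) •
      ((homeomorphUnitSphereProd (E n) x).1 : E n)) = f x := by
    intro x
    have hx : ‖(x : E n)‖ ≠ 0 := norm_ne_zero_iff.2 x.2
    simp [smul_smul, hx]
  simp only [h3] at h2
  rw [h1, h2, lintegral_prod _ (by fun_prop)]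
  refine lintegral_congr fun w => ?_
  rw [lintegral_volumeIoiPow _ (g := fun r => f (r • (w : E n))) (by fun_prop)]
  simp

lemma integral_polar {n : ℕ} {f : E n → ℝ} (hn : 0 < n) (hf : Integrable f) :
    ∫ x, f x = ∫ w : sphere (0 : E n) 1, (∫ r in Ioi (0 : ℝ), r ^ (n - 1) * f (r • (w : E n)))
        ∂(volume : Measure (E n)).toSphere := by
  have : Nontrivial (E n) := by
    have : Nonempty (Fin n) := ⟨⟨0, hn⟩⟩
    infer_instance
  have hmp := (volume : Measure (E n)).measurePreserving_homeomorphUnitSphereProd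
  have h1 : ∫ x, f x = ∫ x : ({0}ᶜ : Set (E n)), f x.1 ∂(volume.comap Subtype.val) := by
    rw [integral_subtype_comap (measurableSet_singleton _).compl, restrict_compl_singleton]
  have h2 := hmp.integral_comp (Homeomorph.measurableEmbedding _)
    (fun p => f ((p.2 : ℝ) • (p.1 : E n)))
  have h4 := hmp.integrable_comp_emb (Homeomorph.measurableEmbedding _)
    (g := fun p => f ((p.2 : ℝ) • (p.1 : E n)))
  have h3 : ∀ x : ({0}ᶜ : Set (E n)), f (((homeomorphUnitSphereProd (E n) x).2 : ℝ) •
      ((homeomorphUnitSphereProd (E n) x).1 : E n)) = f x := by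
    intro x
    have hx : ‖(x : E n)‖ ≠ 0 := norm_ne_zero_iff.2 x.2
    simp [smul_smul, hx]
  simp only [Function.comp_def, h3] at h2 h4
  have h5 : Integrable (fun x : ({0}ᶜ : Set (E n)) => f x.1) (volume.comap Subtype.val) := by
    rw [← Function.comp_def f, ← integrableOn_iff_comap_subtypeVal (measurableSet_singleton _).compl]
    exact hf.integrableOn
  rw [h1, h2, integral_prod _ (h4.1 h5)]
  refine integral_congr_ae (Eventually.of_forall fun w => ?_)
  simp only
  rw [integral_volumeIoiPow _ (g := fun r => f (r • (w : E n)))]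
  simp

lemma hasDerivAt_comp_ray {n : ℕ} {F : Type*} [NormedAddCommGroup F] [NormedSpace ℝ F]
    {φ : E n → F} (hφ : ContDiff ℝ 1 φ) (x w : E n) (r : ℝ) :
    HasDerivAt (fun r : ℝ => φ (x + r • w)) (fderiv ℝ φ (x + r • w) w) r := by
  have h1 : HasDerivAt (fun r : ℝ => x + r • w) w r := by
    simpa using ((hasDerivAt_id r).smul_const w).const_add x
  exact ((hφ.differentiable one_ne_zero) _).hasFDerivAt.comp_hasDerivAt r h1

/-- The divergence of `x / |x|ⁿ` is `n ωₙ` times the Dirac mass at the origin. -/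
lemma integral_fderiv_radial {n : ℕ} (hn : 2 ≤ n) {φ : E n → ℝ} (hφ : ContDiff ℝ 1 φ)
    (hc : HasCompactSupport φ) :
    ∫ x, fderiv ℝ φ x x / ‖x‖ ^ n = - (n * unitBallVolume n) * φ 0 := by
  have hn0 : 0 < n := by omega
  have hcf : Continuous fun x => fderiv ℝ φ x := hφ.continuous_fderiv one_ne_zero
  obtain ⟨C, hC, hd⟩ := HasCompactSupport.decay (β := 2) (hc.fderiv (𝕜 := ℝ)) hcf (by norm_num)
  have hint : Integrable fun x => fderiv ℝ φ x x / ‖x‖ ^ n := by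
    refine integrable_of_riesz_bound hn0 (a := n - 1) (b := 2) ?_ (by linarith) (by norm_num)
      (by linarith) ?_ hC 0 fun y => ?_
    · have : (2 : ℝ) ≤ n := by exact_mod_cast hn
      linarith
    · exact ((hcf.clm_apply continuous_id).measurable.div
        (by fun_prop)).aestronglyMeasurable
    · rcases eq_or_ne y 0 with rfl | hy
      · simp
      · have hy' : 0 < ‖y‖ := norm_pos_iff.2 hy
        have h1 : ‖fderiv ℝ φ y y / ‖y‖ ^ n‖ ≤ ‖fderiv ℝ φ y‖ * ‖y‖ ^ (-((n : ℝ) - 1)) := by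
          rw [norm_div, norm_pow, norm_norm, neg_sub, Real.rpow_sub hy', Real.rpow_one,
            Real.rpow_natCast, ← mul_div_assoc]
          gcongr
          exact (fderiv ℝ φ y).le_opNorm y
        calc ‖fderiv ℝ φ y y / ‖y‖ ^ n‖ₑ ≤ ‖fderiv ℝ φ y‖ₑ * ‖y‖ₑ ^ (-((n : ℝ) - 1)) := by
              rw [← ofReal_norm, ← ofReal_norm, ← ofReal_norm, ENNReal.ofReal_rpow_of_pos hy',
                ← ENNReal.ofReal_mul (norm_nonneg _)]
              exact ENNReal.ofReal_le_ofReal h1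
          _ ≤ (C * (1 + ‖y‖ₑ) ^ (-(2 : ℝ))) * ‖y‖ₑ ^ (-((n : ℝ) - 1)) := by gcongr; exact hd y
          _ = _ := by rw [zero_sub, enorm_neg]; ring
  rw [integral_polar hn0 hint]
  have key : ∀ w : sphere (0 : E n) 1, ∫ r in Ioi (0 : ℝ),
      r ^ (n - 1) * (fderiv ℝ φ (r • (w : E n)) (r • (w : E n)) / ‖r • (w : E n)‖ ^ n) = - φ 0 := by
    intro w
    have hw : ‖(w : E n)‖ = 1 := by simp
    have hder : ∀ r : ℝ, HasDerivAt (fun r : ℝ => φ (r • (w : E n)))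
        (fderiv ℝ φ (r • (w : E n)) w) r := fun r => by
      simpa using hasDerivAt_comp_ray hφ 0 (w : E n) r
    have hcs : HasCompactSupport (fun r : ℝ => φ (r • (w : E n))) := by
      refine hc.comp_isClosedEmbedding (g := fun r : ℝ => r • (w : E n)) ?_
      exact isClosedEmbedding_smul_left (fun h => by simp [h] at hw)
    have hcd : ContDiff ℝ 1 (fun r : ℝ => φ (r • (w : E n))) := by fun_prop
    have h6 := hcs.integral_Ioi_deriv_eq hcd 0
    simp only [zero_smul] at h6
    rw [← h6]
    refine setIntegral_congr_fun measurableSet_Ioi fun r hr => ?_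
    have hr0 : 0 < r := hr
    simp only [(hder r).deriv, map_smul, smul_eq_mul, norm_smul, hw, mul_one, Real.norm_eq_abs,
      abs_of_pos hr0]
    obtain ⟨m, rfl⟩ : ∃ m, n = m + 1 := ⟨n - 1, by omega⟩
    simp only [Nat.add_sub_cancel]
    field_simp
    ring
  simp only [key]
  rw [integral_const, Measure.toSphere_real_apply_univ]
  simp [unitBallVolume]

/-! ### Partial derivatives -/

/-- The partial derivative `∂ᵢ g`. -/
def pd {n : ℕ} (i : Fin n) (g : E n → ℝ) (x : E n) : ℝ :=
  fderiv ℝ g x (EuclideanSpace.single i 1)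

/-- The Laplacian, as the sum of the second partial derivatives. -/
def lap {n : ℕ} (g : E n → ℝ) (x : E n) : ℝ := ∑ k, pd k (pd k g) x

section pd
variable {n : ℕ} {f g : E n → ℝ} {x : E n}

lemma sum_smul_single (v : E n) : ∑ i, v i • (EuclideanSpace.single i (1 : ℝ) : E n) = v := by
  ext j
  simp [Finset.sum_apply, Pi.single_apply]

lemma clm_apply_eq_sum {G : Type*} [NormedAddCommGroup G] [NormedSpace ℝ G] (L : E n →L[ℝ] G)
    (v : E n) : L v = ∑ i, v i • L (EuclideanSpace.single i 1) := by
  conv_lhs => rw [← sum_smul_single v]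
  simp

lemma fderiv_apply_eq_sum_pd (g : E n → ℝ) (x v : E n) :
    fderiv ℝ g x v = ∑ i, v i * pd i g x := by
  rw [clm_apply_eq_sum]; rfl

lemma _root_.HasFDerivAt.pd_eq {L : E n →L[ℝ] ℝ} (h : HasFDerivAt g L x) (i : Fin n) :
    pd i g x = L (EuclideanSpace.single i 1) := by
  rw [pd, h.fderiv]

lemma pd_add (hf : DifferentiableAt ℝ f x) (hg : DifferentiableAt ℝ g x) (i : Fin n) :
    pd i (fun x => f x + g x) x = pd i f x + pd i g x := by
  simp only [pd]; rw [fderiv_fun_add hf hg]; rfl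

lemma pd_sub (hf : DifferentiableAt ℝ f x) (hg : DifferentiableAt ℝ g x) (i : Fin n) :
    pd i (fun x => f x - g x) x = pd i f x - pd i g x := by
  simp only [pd]; rw [fderiv_fun_sub hf hg]; rfl

lemma pd_mul (hf : DifferentiableAt ℝ f x) (hg : DifferentiableAt ℝ g x) (i : Fin n) :
    pd i (fun x => f x * g x) x = pd i f x * g x + f x * pd i g x := by
  simp only [pd]; rw [fderiv_fun_mul hf hg]
  simp; ring

lemma pd_const_mul (hf : DifferentiableAt ℝ f x) (c : ℝ) (i : Fin n) :
    pd i (fun x => c * f x) x = c * pd i f x := by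
  simp only [pd]; rw [fderiv_const_mul hf]; rfl

lemma pd_sum {ι : Type*} {s : Finset ι} {f : ι → E n → ℝ}
    (hf : ∀ j ∈ s, DifferentiableAt ℝ (f j) x) (i : Fin n) :
    pd i (fun x => ∑ j ∈ s, f j x) x = ∑ j ∈ s, pd i (f j) x := by
  simp only [pd]; rw [fderiv_fun_sum hf]; simp

lemma pd_coord (i j : Fin n) (x : E n) : pd i (fun x : E n => x j) x = if i = j then 1 else 0 := by
  have h : HasFDerivAt (fun x : E n => x j) (EuclideanSpace.proj j : E n →L[ℝ] ℝ) x :=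
    (EuclideanSpace.proj j : E n →L[ℝ] ℝ).hasFDerivAt
  rw [h.pd_eq]
  simp [eq_comm]

lemma pd_comp_add_right (i : Fin n) (g : E n → ℝ) (y x : E n) :
    pd i (fun z => g (z + y)) x = pd i g (x + y) := by
  simp only [pd]; rw [fderiv_comp_add_right]

lemma contDiff_pd {m k : ℕ∞ω} (hg : ContDiff ℝ k g) (h : m + 1 ≤ k) (i : Fin n) :
    ContDiff ℝ m (pd i g) :=
  (hg.fderiv_right h).clm_apply contDiff_const

lemma contDiff_pd_infty (hg : ContDiff ℝ ∞ g) (i : Fin n) : ContDiff ℝ ∞ (pd i g) :=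
  contDiff_pd hg (by simp) i

lemma contDiff_lap_infty (hg : ContDiff ℝ ∞ g) : ContDiff ℝ ∞ (lap g) :=
  ContDiff.sum fun k _ => contDiff_pd_infty (contDiff_pd_infty hg k) k

lemma continuous_pd (hg : ContDiff ℝ 1 g) (i : Fin n) : Continuous (pd i g) :=
  (contDiff_pd (m := 0) hg (by simp) i).continuous

lemma hasCompactSupport_pd (hg : HasCompactSupport g) (i : Fin n) : HasCompactSupport (pd i g) :=
  (hg.fderiv (𝕜 := ℝ)).comp_left (g := fun L : E n →L[ℝ] ℝ => L (EuclideanSpace.single i 1)) rfl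

lemma hasCompactSupport_lap (hg : HasCompactSupport g) : HasCompactSupport (lap g) := by
  have : lap g = ∑ k, pd k (pd k g) := by ext x; simp [lap]
  rw [this]
  refine HasCompactSupport.of_support_subset_isCompact hg.isCompact ?_
  intro x hx
  by_contra hxt
  apply hx
  have h2 : ∀ k, pd k (pd k g) x = 0 := fun k => by
    have h3 : tsupport (pd k (pd k g)) ⊆ tsupport g := by
      refine ((tsupport_fderiv_apply_subset ℝ _).trans (tsupport_fderiv_apply_subset ℝ _))
    exact image_eq_zero_of_notMem_tsupport fun h => hxt (h3 h)
  simp [h2]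

lemma pd_comm (hg : ContDiff ℝ 2 g) (i j : Fin n) (x : E n) :
    pd i (pd j g) x = pd j (pd i g) x := by
  have hd : DifferentiableAt ℝ (fderiv ℝ g) x :=
    ((hg.fderiv_right (m := 1) (by norm_num)).differentiable one_ne_zero) x
  have h : ∀ i j, pd i (pd j g) x =
      fderiv ℝ (fderiv ℝ g) x (EuclideanSpace.single i 1) (EuclideanSpace.single j 1) := by
    intro i j
    have h1 : HasFDerivAt (pd j g) ((ContinuousLinearMap.apply ℝ ℝ
        (EuclideanSpace.single j (1 : ℝ) : E n)).comp (fderiv ℝ (fderiv ℝ g) x)) x :=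
      (ContinuousLinearMap.apply ℝ ℝ
        (EuclideanSpace.single j (1 : ℝ) : E n)).hasFDerivAt.comp x hd.hasFDerivAt
    rw [h1.pd_eq]; rfl
  rw [h, h]
  exact (hg.contDiffAt.isSymmSndFDerivAt (by simp)) _ _

lemma two_le_infty : (2 : ℕ∞ω) ≤ (∞ : ℕ∞ω) := WithTop.coe_le_coe.2 le_top

lemma pd_lap (hg : ContDiff ℝ ∞ g) (j : Fin n) (x : E n) : pd j (lap g) x = lap (pd j g) x := by
  have h1 : ∀ k, ContDiff ℝ ∞ (pd k (pd k g)) := fun k =>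
    contDiff_pd_infty (contDiff_pd_infty hg k) k
  unfold lap
  rw [pd_sum fun k _ => ((h1 k).differentiable (by simp)) x]
  refine Finset.sum_congr rfl fun k _ => ?_
  rw [pd_comm ((contDiff_pd_infty hg k).of_le two_le_infty)]
  congr 1
  ext y
  exact pd_comm (hg.of_le two_le_infty) _ _ _

lemma lap_comp_add_right (g : E n → ℝ) (y x : E n) :
    lap (fun z => g (z + y)) x = lap g (x + y) := by
  unfold lap
  refine Finset.sum_congr rfl fun k _ => ?_
  have : pd k (fun z => g (z + y)) = fun z => pd k g (z + y) := by
    ext z; exact pd_comp_add_right _ _ _ _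
  rw [this, pd_comp_add_right]

lemma lap_coord_mul (hg : ContDiff ℝ ∞ g) (i : Fin n) (x : E n) :
    lap (fun x : E n => x i * g x) x = x i * lap g x + 2 * pd i g x := by
  have hc : ∀ x : E n, DifferentiableAt ℝ (fun x : E n => x i) x := fun x =>
    (EuclideanSpace.proj i : E n →L[ℝ] ℝ).differentiableAt
  have hgd : Differentiable ℝ g := hg.differentiable (by simp)
  have h1 : ∀ k, pd k (fun x : E n => x i * g x) =
      fun x => (if k = i then 1 else 0) * g x + x i * pd k g x := by
    intro k; ext y
    rw [pd_mul (hc y) (hgd y), pd_coord]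
  have h2 : ∀ k, pd k (pd k (fun x : E n => x i * g x)) x =
      x i * pd k (pd k g) x + (if k = i then 2 * pd k g x else 0) := by
    intro k
    have hp : Differentiable ℝ (pd k g) := (contDiff_pd_infty hg k).differentiable (by simp)
    rw [h1, pd_add ((hgd x).const_mul _) ((hc x).fun_mul (hp x)), pd_const_mul (hgd x),
      pd_mul (hc x) (hp x), pd_coord]
    split_ifs <;> ring
  simp only [lap, h2, Finset.sum_add_distrib, ← Finset.mul_sum]
  simp

lemma integral_pd_mul (i : Fin n) (hf : Differentiable ℝ f) (hg : Differentiable ℝ g)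
    (h1 : Integrable fun x => pd i f x * g x) (h2 : Integrable fun x => f x * pd i g x)
    (h3 : Integrable fun x => f x * g x) :
    ∫ x, f x * pd i g x = - ∫ x, pd i f x * g x :=
  integral_mul_fderiv_eq_neg_fderiv_mul_of_integrable h1 h2 h3 (fun x _ => hf x) fun x _ => hg x

/-- The divergence theorem on the whole space. -/
lemma integral_sum_pd_eq_zero {Z : Fin n → E n → ℝ} (hd : ∀ i, Differentiable ℝ (Z i))
    (hZ : ∀ i, Integrable (Z i)) (hZ' : ∀ i, Integrable (pd i (Z i))) :
    ∫ x, ∑ i, pd i (Z i) x = 0 := by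
  rw [integral_finsetSum _ fun i _ => hZ' i]
  refine Finset.sum_eq_zero fun i _ => ?_
  have := integral_pd_mul i (f := fun _ => (1 : ℝ)) (differentiable_const _) (hd i)
    (by simp [pd]) (by simpa using hZ' i) (by simpa using hZ i)
  simpa [pd] using this

lemma sq_norm_add_pos {e : ℝ} (he : 0 < e) (x : E n) : 0 < ‖x‖ ^ 2 + e := by positivity

lemma pd_sq_norm_rpow {e : ℝ} (he : 0 < e) (m : ℝ) (x₀ : E n) (i : Fin n) (x : E n) :
    pd i (fun x : E n => (‖x - x₀‖ ^ 2 + e) ^ m) x =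
      2 * m * (x i - x₀ i) * (‖x - x₀‖ ^ 2 + e) ^ (m - 1) := by
  have h1 : HasFDerivAt (fun x : E n => ‖x - x₀‖ ^ 2 + e) (2 • (innerSL ℝ (x - x₀))) x := by
    have := ((hasFDerivAt_id x).sub_const x₀).norm_sq.add_const e
    simpa using this
  have h2 := h1.rpow_const (p := m) (Or.inl (sq_norm_add_pos he _).ne')
  rw [h2.pd_eq]
  simp [EuclideanSpace.inner_single_right]
  ring

lemma contDiff_sq_norm_rpow {e : ℝ} (he : 0 < e) (m : ℝ) (x₀ : E n) :
    ContDiff ℝ ∞ (fun x : E n => (‖x - x₀‖ ^ 2 + e) ^ m) := by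
  refine ContDiff.rpow_const_of_ne ?_ fun x => (sq_norm_add_pos he _).ne'
  exact ((contDiff_id.sub contDiff_const).norm_sq ℝ).add contDiff_const

end pd

/-! ### Weakly singular kernels -/

/-- A measurable kernel with a singularity of order at most `a`. -/
def KernelBound {n : ℕ} (a : ℝ) (k : E n → ℝ) : Prop :=
  Measurable k ∧ ∃ C : ℝ≥0∞, C < ⊤ ∧ ∀ x, ‖k x‖ₑ ≤ C * ‖x‖ₑ ^ (-a)

section Kernel
variable {n : ℕ} {a b : ℝ} {k : E n → ℝ}

lemma KernelBound.add {k' : E n → ℝ} (h : KernelBound a k) (h' : KernelBound a k') :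
    KernelBound a (fun x => k x + k' x) := by
  obtain ⟨hm, C, hC, h⟩ := h
  obtain ⟨hm', C', hC', h'⟩ := h'
  refine ⟨hm.add hm', C + C', ENNReal.add_lt_top.2 ⟨hC, hC'⟩, fun x => (enorm_add_le _ _).trans ?_⟩
  rw [add_mul]; exact add_le_add (h x) (h' x)

lemma KernelBound.const_mul (h : KernelBound a k) (c : ℝ) : KernelBound a (fun x => c * k x) := by
  obtain ⟨hm, C, hC, h⟩ := h
  refine ⟨hm.const_mul c, ‖c‖ₑ * C, ENNReal.mul_lt_top (by simp) hC, fun x => ?_⟩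
  rw [enorm_mul, mul_assoc]
  gcongr
  exact h x

lemma kernelBound_of_norm_le (hm : Measurable k) (ha : 0 < a)
    (h : ∀ x : E n, x ≠ 0 → |k x| ≤ ‖x‖ ^ (-a)) : KernelBound a k := by
  refine ⟨hm, 1, by simp, fun x => ?_⟩
  rw [one_mul]
  rcases eq_or_ne x 0 with rfl | hx
  · simp [ENNReal.zero_rpow_of_neg (by linarith : -a < 0)]
  · rw [← ofReal_norm, ← ofReal_norm, ENNReal.ofReal_rpow_of_pos (norm_pos_iff.2 hx)]
    exact ENNReal.ofReal_le_ofReal (h x hx)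

lemma KernelBound.integrable_mul (hk : KernelBound a k) (hn : 0 < n) (ha : 0 ≤ a) (han : a < n)
    (hb : 0 ≤ b) (hab : n < a + b) {g : E n → ℝ} (hg : Decay b g)
    (hm : AEStronglyMeasurable g volume) (x : E n) : Integrable fun y => k (x - y) * g y := by
  obtain ⟨hkm, C, hC, hk⟩ := hk
  obtain ⟨D, hD, hg⟩ := hg
  refine integrable_of_riesz_bound hn ha han hb hab ?_ (C := C * D) (ENNReal.mul_lt_top hC hD) x
    fun y => ?_
  · exact (hkm.comp (measurable_const.sub measurable_id)).aestronglyMeasurable.mul hm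
  · rw [enorm_mul]
    calc _ ≤ (C * ‖x - y‖ₑ ^ (-a)) * (D * (1 + ‖y‖ₑ) ^ (-b)) := by
          gcongr
          exacts [hk _, hg _]
      _ = _ := by ring

lemma KernelBound.comp_neg (hk : KernelBound a k) : KernelBound a (fun x => k (-x)) := by
  obtain ⟨hkm, C, hC, hk⟩ := hk
  exact ⟨hkm.comp measurable_neg, C, hC, fun x => by simpa using hk (-x)⟩

lemma KernelBound.integrable_mul' (hk : KernelBound a k) (hn : 0 < n) (ha : 0 ≤ a) (han : a < n)
    (hb : 0 ≤ b) (hab : n < a + b) {g : E n → ℝ} (hg : Decay b g)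
    (hm : AEStronglyMeasurable g volume) : Integrable fun y => k y * g y := by
  simpa using hk.comp_neg.integrable_mul hn ha han hb hab hg hm 0

lemma KernelBound.integrable_mul_compact (hk : KernelBound a k) (hn : 0 < n) (ha : 0 ≤ a)
    (han : a < n) {g : E n → ℝ} (hg : HasCompactSupport g) (hc : Continuous g) :
    Integrable fun y => k y * g y :=
  hk.integrable_mul' hn ha han (b := n + 1) (by positivity) (by linarith)
    (HasCompactSupport.decay hg hc (by positivity)) hc.aestronglyMeasurable

lemma KernelBound.decay_potential (hk : KernelBound a k) (hn : 0 < n) {c : ℝ} (hc : 0 ≤ c)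
    (hca : c < a) (han : a < n) {g : E n → ℝ} (hg : Decay n g) :
    Decay c (fun x => ∫ y, k (x - y) * g y) := by
  obtain ⟨hkm, C, hC, hk⟩ := hk
  obtain ⟨D, hD, hg⟩ := hg
  obtain ⟨B, hB, h⟩ := lintegral_riesz_weight_decay hn hc hca han
  refine ⟨C * D * B, ENNReal.mul_lt_top (ENNReal.mul_lt_top hC hD) hB, fun x => ?_⟩
  calc ‖∫ y, k (x - y) * g y‖ₑ ≤ ∫⁻ y, ‖k (x - y) * g y‖ₑ := enorm_integral_le_lintegral_enorm _
    _ ≤ ∫⁻ y, C * D * (‖x - y‖ₑ ^ (-a) * (1 + ‖y‖ₑ) ^ (-(n : ℝ))) := by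
        refine lintegral_mono fun y => ?_
        rw [enorm_mul]
        calc _ ≤ (C * ‖x - y‖ₑ ^ (-a)) * (D * (1 + ‖y‖ₑ) ^ (-(n : ℝ))) := by
              gcongr
              exacts [hk _, hg _]
          _ = _ := by ring
    _ = C * D * ∫⁻ y, (‖x - y‖ₑ ^ (-a) * (1 + ‖y‖ₑ) ^ (-(n : ℝ))) :=
        lintegral_const_mul _ (by fun_prop)
    _ ≤ C * D * (B * (1 + ‖x‖ₑ) ^ (-c)) := by gcongr; exact h x
    _ = _ := by ring

lemma KernelBound.stronglyMeasurable_potential (hk : KernelBound a k) {g : E n → ℝ}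
    (hm : Measurable g) : StronglyMeasurable (fun x => ∫ y, k (x - y) * g y) := by
  have : Measurable (Function.uncurry fun x y : E n => k (x - y) * g y) :=
    (hk.1.comp (measurable_fst.sub measurable_snd)).mul (hm.comp measurable_snd)
  exact this.stronglyMeasurable.integral_prod_right

/-- Fubini's theorem for a potential tested against a compactly supported function. -/
lemma KernelBound.integral_potential_mul (hk : KernelBound a k) (hn : 0 < n) (ha : 0 ≤ a)
    (han : a < n) (hb : 0 ≤ b) (hab : n < a + b) {g : E n → ℝ} (hg : Decay b g)
    (hm : Measurable g) {φ : E n → ℝ} (hφ : HasCompactSupport φ) (hc : Continuous φ) :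
    ∫ x, (∫ y, k (x - y) * g y) * φ x = ∫ y, (∫ z, k z * φ (z + y)) * g y := by
  have hmeas : Measurable (Function.uncurry fun x y : E n => k (x - y) * g y * φ x) :=
    ((hk.1.comp (measurable_fst.sub measurable_snd)).mul (hm.comp measurable_snd)).mul
      (hc.measurable.comp measurable_fst)
  have hint : Integrable (Function.uncurry fun x y : E n => k (x - y) * g y * φ x)
      (volume.prod volume) := by
    refine ⟨hmeas.aestronglyMeasurable, ?_⟩
    obtain ⟨hkm, C, hC, hk⟩ := hk
    obtain ⟨D, hD, hg⟩ := hg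
    obtain ⟨B, hB, h⟩ := lintegral_riesz_weight_le hn ha han hb hab
    have hle : ∀ x, ∫⁻ y, ‖k (x - y) * g y * φ x‖ₑ ≤ C * D * B * ‖φ x‖ₑ := by
      intro x
      calc _ ≤ ∫⁻ y, (C * D * ‖φ x‖ₑ) * (‖x - y‖ₑ ^ (-a) * (1 + ‖y‖ₑ) ^ (-b)) := by
            refine lintegral_mono fun y => ?_
            rw [enorm_mul, enorm_mul]
            calc _ ≤ (C * ‖x - y‖ₑ ^ (-a)) * (D * (1 + ‖y‖ₑ) ^ (-b)) * ‖φ x‖ₑ := by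
                  gcongr
                  exacts [hk _, hg _]
              _ = _ := by ring
        _ = (C * D * ‖φ x‖ₑ) * ∫⁻ y, (‖x - y‖ₑ ^ (-a) * (1 + ‖y‖ₑ) ^ (-b)) :=
            lintegral_const_mul _ (by fun_prop)
        _ ≤ (C * D * ‖φ x‖ₑ) * B := by gcongr; exact h x
        _ = _ := by ring
    rw [HasFiniteIntegral, lintegral_prod _ hmeas.enorm.aemeasurable]
    refine (lintegral_mono hle).trans_lt ?_
    rw [lintegral_const_mul _ hc.measurable.enorm]
    exact ENNReal.mul_lt_top (ENNReal.mul_lt_top (ENNReal.mul_lt_top hC hD) hB)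
      (hc.integrable_of_hasCompactSupport hφ).2
  calc ∫ x, (∫ y, k (x - y) * g y) * φ x = ∫ x, ∫ y, k (x - y) * g y * φ x := by
        simp_rw [integral_mul_const]
    _ = ∫ y, ∫ x, k (x - y) * g y * φ x := integral_integral_swap hint
    _ = ∫ y, (∫ z, k z * φ (z + y)) * g y := by
        refine integral_congr_ae (Eventually.of_forall fun y => ?_)
        simp only
        rw [← integral_mul_const, ← integral_add_right_eq_self _ y]
        refine integral_congr_ae (Eventually.of_forall fun x => ?_)
        simp only [add_sub_cancel_right]
        ring

end Kernel

/-! ### The Stokes kernels -/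

/-- The kernel `|x|^(2-n)`. -/
def newtonKernel {n : ℕ} (x : E n) : ℝ := ‖x‖ ^ (-((n : ℝ) - 2))

/-- The kernel `xⱼ / |x|ⁿ`. -/
def radialKernel {n : ℕ} (j : Fin n) (x : E n) : ℝ := x j / ‖x‖ ^ n

section Stokes
variable {n : ℕ}

lemma unitBallVolume_pos (n : ℕ) : 0 < unitBallVolume n :=
  ENNReal.toReal_pos (measure_ball_pos _ _ one_pos).ne' measure_ball_lt_top.ne

lemma abs_apply_le (x : E n) (i : Fin n) : |x i| ≤ ‖x‖ := by
  simpa using PiLp.norm_apply_le x i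

lemma kernelBound_newton (hn : 3 ≤ n) : KernelBound ((n : ℝ) - 2) (newtonKernel (n := n)) := by
  have : (3 : ℝ) ≤ n := by exact_mod_cast hn
  refine kernelBound_of_norm_le ?_ (by linarith) fun x hx => ?_
  · unfold newtonKernel; fun_prop
  · rw [newtonKernel, abs_of_nonneg (by positivity)]

lemma kernelBound_radial (hn : 3 ≤ n) (j : Fin n) :
    KernelBound ((n : ℝ) - 1) (radialKernel j) := by
  have : (3 : ℝ) ≤ n := by exact_mod_cast hn
  refine kernelBound_of_norm_le ?_ (by linarith) fun x hx => ?_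
  · unfold radialKernel; fun_prop
  · have hx' : 0 < ‖x‖ := norm_pos_iff.2 hx
    rw [radialKernel, abs_div, abs_of_pos (by positivity : 0 < ‖x‖ ^ n), neg_sub,
      Real.rpow_sub hx', Real.rpow_one, Real.rpow_natCast]
    gcongr
    exact abs_apply_le x j

lemma kernelBound_coord_mul_radial (hn : 3 ≤ n) (i j : Fin n) :
    KernelBound ((n : ℝ) - 2) (fun x => x i * radialKernel j x) := by
  have : (3 : ℝ) ≤ n := by exact_mod_cast hn
  refine kernelBound_of_norm_le ?_ (by linarith) fun x hx => ?_
  · unfold radialKernel; fun_prop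
  · have hx' : 0 < ‖x‖ := norm_pos_iff.2 hx
    rw [radialKernel, abs_mul, abs_div, abs_of_pos (by positivity : 0 < ‖x‖ ^ n), neg_sub,
      Real.rpow_sub hx', Real.rpow_two, Real.rpow_natCast, ← mul_div_assoc, sq]
    gcongr
    exacts [abs_apply_le x i, abs_apply_le x j]

lemma stokesU_eq (i j : Fin n) : stokesU n i j = fun x =>
    1 / (2 * n * unitBallVolume n) * ((if i = j then 1 else 0) / ((n : ℝ) - 2)) * newtonKernel x
      + 1 / (2 * n * unitBallVolume n) * (x i * radialKernel j x) := by
  ext x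
  rw [stokesU, newtonKernel, radialKernel, Real.rpow_neg (norm_nonneg _)]
  rw [div_mul_eq_div_div (if i = j then (1 : ℝ) else 0), div_eq_mul_inv _ (‖x‖ ^ ((n : ℝ) - 2))]
  ring

lemma stokesP_eq (j : Fin n) : stokesP n j = fun x =>
    1 / (n * unitBallVolume n) * radialKernel j x := rfl

lemma kernelBound_stokesU (hn : 3 ≤ n) (i j : Fin n) :
    KernelBound ((n : ℝ) - 2) (stokesU n i j) := by
  rw [stokesU_eq]
  exact ((kernelBound_newton hn).const_mul _).add ((kernelBound_coord_mul_radial hn i j).const_mul _)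

lemma kernelBound_stokesP (hn : 3 ≤ n) (j : Fin n) :
    KernelBound ((n : ℝ) - 1) (stokesP n j) := by
  rw [stokesP_eq]
  exact (kernelBound_radial hn j).const_mul _

lemma tendsto_sq_add_rpow {x : E n} (hx : x ≠ 0) (m : ℝ) :
    Tendsto (fun k : ℕ => (‖x - 0‖ ^ 2 + 1 / ((k : ℝ) + 1)) ^ m) atTop (𝓝 (‖x‖ ^ (2 * m))) := by
  have hx' : 0 < ‖x‖ := norm_pos_iff.2 hx
  have h1 : Tendsto (fun k : ℕ => ‖x - 0‖ ^ 2 + 1 / ((k : ℝ) + 1)) atTop (𝓝 (‖x‖ ^ 2 + 0)) := by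
    rw [sub_zero]
    exact tendsto_const_nhds.add tendsto_one_div_add_atTop_nhds_zero_nat
  have h2 := h1.rpow_const (p := m) (Or.inl (by positivity))
  rwa [add_zero, ← Real.rpow_two ‖x‖, ← Real.rpow_mul hx'.le] at h2

lemma sq_add_rpow_le {x : E n} (hx : x ≠ 0) {m e : ℝ} (hm : m ≤ 0) (he : 0 < e) :
    (‖x - 0‖ ^ 2 + e) ^ m ≤ ‖x‖ ^ (2 * m) := by
  have hx' : 0 < ‖x‖ := norm_pos_iff.2 hx
  rw [sub_zero, Real.rpow_mul hx'.le, Real.rpow_two]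
  exact Real.rpow_le_rpow_of_nonpos (by positivity) (by linarith) hm

lemma ae_ne_zero (hn : 0 < n) : ∀ᵐ x : E n, x ≠ 0 := by
  have : Nonempty (Fin n) := ⟨⟨0, hn⟩⟩
  simp [ae_iff]

/-- Integration by parts for the Newtonian kernel, whose gradient is `-(n - 2) x / |x|ⁿ`. -/
lemma integral_newton_mul_pd (hn : 3 ≤ n) {φ : E n → ℝ} (hφ : ContDiff ℝ 1 φ)
    (hc : HasCompactSupport φ) (j : Fin n) :
    ∫ x, newtonKernel x * pd j φ x = ((n : ℝ) - 2) * ∫ x, radialKernel j x * φ x := by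
  have hn3 : (3 : ℝ) ≤ n := by exact_mod_cast hn
  have hn0 : 0 < n := by omega
  set m : ℝ := -((n : ℝ) - 2) / 2 with hm
  have hcp := hasCompactSupport_pd hc j
  have hpc := continuous_pd hφ j
  have hreg : ∀ k : ℕ, ∫ x : E n, (‖x - 0‖ ^ 2 + 1 / ((k : ℝ) + 1)) ^ m * pd j φ x =
      ∫ x : E n, ((n : ℝ) - 2) * (x j * (‖x - 0‖ ^ 2 + 1 / ((k : ℝ) + 1)) ^ (m - 1) * φ x) := by
    intro k
    have he : (0 : ℝ) < 1 / ((k : ℝ) + 1) := by positivity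
    have hC := contDiff_sq_norm_rpow he m (0 : E n)
    have hpd : ∀ x : E n, pd j (fun x : E n => (‖x - 0‖ ^ 2 + 1 / ((k : ℝ) + 1)) ^ m) x =
        2 * m * (x j - (0 : E n) j) * (‖x - 0‖ ^ 2 + 1 / ((k : ℝ) + 1)) ^ (m - 1) :=
      pd_sq_norm_rpow he m 0 j
    rw [integral_pd_mul j (hC.differentiable (by simp)) (hφ.differentiable one_ne_zero), ← integral_neg]
    · refine integral_congr_ae (Eventually.of_forall fun x => ?_)
      simp only [hpd]
      simp only [hm, PiLp.zero_apply]
      ring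
    · exact ((contDiff_pd_infty hC j).continuous.mul hφ.continuous).integrable_of_hasCompactSupport
        hc.mul_left
    · exact (hC.continuous.mul hpc).integrable_of_hasCompactSupport hcp.mul_left
    · exact (hC.continuous.mul hφ.continuous).integrable_of_hasCompactSupport hc.mul_left
  have hL : Tendsto (fun k : ℕ => ∫ x : E n, (‖x - 0‖ ^ 2 + 1 / ((k : ℝ) + 1)) ^ m * pd j φ x)
      atTop (𝓝 (∫ x, newtonKernel x * pd j φ x)) := by
    refine tendsto_integral_of_dominated_convergence (fun x => |newtonKernel x * pd j φ x|)
      (fun k => ?_) ?_ (fun k => ?_) ?_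
    · exact ((contDiff_sq_norm_rpow (by positivity) m (0 : E n)).continuous.mul
        hpc).aestronglyMeasurable
    · exact ((kernelBound_newton hn).integrable_mul_compact hn0 (by linarith) (by linarith)
        hcp hpc).abs
    · filter_upwards [ae_ne_zero hn0] with x hx
      rw [norm_mul, abs_mul, Real.norm_eq_abs, Real.norm_eq_abs]
      rw [abs_of_nonneg (by positivity : 0 ≤ (‖x - 0‖ ^ 2 + 1 / ((k : ℝ) + 1)) ^ m), newtonKernel,
        abs_of_nonneg (by positivity : 0 ≤ ‖x‖ ^ (-((n : ℝ) - 2)))]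
      refine mul_le_mul_of_nonneg_right ?_ (abs_nonneg _)
      refine (sq_add_rpow_le hx (by rw [hm]; linarith) (by positivity)).trans (le_of_eq ?_)
      congr 1; rw [hm]; ring
    · filter_upwards [ae_ne_zero hn0] with x hx
      refine Tendsto.mul_const _ ?_
      have := tendsto_sq_add_rpow hx m
      rwa [show 2 * m = -((n : ℝ) - 2) by rw [hm]; ring] at this
  have hR : Tendsto (fun k : ℕ => ∫ x : E n,
      ((n : ℝ) - 2) * (x j * (‖x - 0‖ ^ 2 + 1 / ((k : ℝ) + 1)) ^ (m - 1) * φ x))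
      atTop (𝓝 (∫ x, ((n : ℝ) - 2) * (radialKernel j x * φ x))) := by
    have hpow : ∀ x : E n, x ≠ 0 → ‖x‖ ^ (2 * (m - 1)) = (‖x‖ ^ n)⁻¹ := by
      intro x hx
      rw [show 2 * (m - 1) = -(n : ℝ) by rw [hm]; ring, Real.rpow_neg (norm_nonneg _),
        Real.rpow_natCast]
    refine tendsto_integral_of_dominated_convergence
      (fun x => |((n : ℝ) - 2) * (radialKernel j x * φ x)|) (fun k => ?_) ?_ (fun k => ?_) ?_
    · have h1 := (contDiff_sq_norm_rpow (n := n) (e := 1 / ((k : ℝ) + 1)) (by positivity) (m - 1)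
        0).continuous
      have h2 := hφ.continuous
      exact Continuous.aestronglyMeasurable (by fun_prop)
    · exact (((kernelBound_radial hn j).integrable_mul_compact hn0 (by linarith) (by linarith)
        hc hφ.continuous).const_mul _).abs
    · filter_upwards [ae_ne_zero hn0] with x hx
      rw [norm_mul, norm_mul, norm_mul, abs_mul, abs_mul, radialKernel, abs_div, div_eq_mul_inv,
        Real.norm_eq_abs, Real.norm_eq_abs, Real.norm_eq_abs, Real.norm_eq_abs, ← div_eq_mul_inv,
        div_eq_mul_inv |x j|]
      rw [abs_of_nonneg (by positivity : 0 ≤ (‖x - 0‖ ^ 2 + 1 / ((k : ℝ) + 1)) ^ (m - 1)),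
        abs_of_nonneg (by positivity : 0 ≤ ‖x‖ ^ n), ← hpow x hx]
      refine mul_le_mul_of_nonneg_left (mul_le_mul_of_nonneg_right
        (mul_le_mul_of_nonneg_left ?_ (abs_nonneg _)) (abs_nonneg _)) (abs_nonneg _)
      exact sq_add_rpow_le hx (by rw [hm]; linarith) (by positivity)
    · filter_upwards [ae_ne_zero hn0] with x hx
      refine Tendsto.const_mul _ (Tendsto.mul_const _ ?_)
      rw [radialKernel, div_eq_mul_inv, ← hpow x hx]
      exact (tendsto_sq_add_rpow hx (m - 1)).const_mul _
  simp only [hreg] at hL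
  rw [tendsto_nhds_unique hL hR, integral_const_mul]

/-- `|x|^(2-n)` is a multiple of the fundamental solution of the Laplacian. -/
lemma integral_newton_mul_lap (hn : 3 ≤ n) {φ : E n → ℝ} (hφ : ContDiff ℝ ∞ φ)
    (hc : HasCompactSupport φ) :
    ∫ x, newtonKernel x * lap φ x = -((n : ℝ) - 2) * (n * unitBallVolume n) * φ 0 := by
  have hn3 : (3 : ℝ) ≤ n := by exact_mod_cast hn
  have hn0 : 0 < n := by omega
  have h1 : ∀ k, ContDiff ℝ ∞ (pd k φ) := contDiff_pd_infty hφ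
  have h2 : ∀ k, HasCompactSupport (pd k φ) := hasCompactSupport_pd hc
  simp only [lap, Finset.mul_sum]
  rw [integral_finsetSum]
  · simp_rw [fun k => integral_newton_mul_pd hn ((h1 k).of_le (by simp)) (h2 k) k]
    rw [← Finset.mul_sum, ← integral_finsetSum]
    · have := integral_fderiv_radial (by omega) (hφ.of_le (by simp) : ContDiff ℝ 1 φ) hc
      rw [show (fun x => ∑ k, radialKernel k x * pd k φ x) =
        fun x : E n => fderiv ℝ φ x x / ‖x‖ ^ n from ?_, this]
      · ring
      · ext x
        rw [fderiv_apply_eq_sum_pd, Finset.sum_div]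
        refine Finset.sum_congr rfl fun k _ => ?_
        rw [radialKernel]; ring
    · exact fun k _ => (kernelBound_radial hn k).integrable_mul_compact hn0 (by linarith)
        (by linarith) (h2 k) (h1 k).continuous
  · exact fun k _ => (kernelBound_newton hn).integrable_mul_compact hn0 (by linarith)
        (by linarith) (hasCompactSupport_pd (h2 k) k) (contDiff_pd_infty (h1 k) k).continuous

lemma integral_radial_mul_lap (hn : 3 ≤ n) {φ : E n → ℝ} (hφ : ContDiff ℝ ∞ φ)
    (hc : HasCompactSupport φ) (j : Fin n) :
    ∫ x, radialKernel j x * lap φ x = -(n * unitBallVolume n) * pd j φ 0 := by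
  have hn3 : (3 : ℝ) ≤ n := by exact_mod_cast hn
  have h := integral_newton_mul_pd hn ((contDiff_lap_infty hφ).of_le (by simp))
    (hasCompactSupport_lap hc) j
  simp_rw [pd_lap hφ] at h
  rw [integral_newton_mul_lap hn (contDiff_pd_infty hφ j) (hasCompactSupport_pd hc j)] at h
  have h3 : (n : ℝ) - 2 ≠ 0 := by linarith
  apply mul_left_cancel₀ h3
  rw [← h]; ring

lemma integral_stokesP_mul_lap (hn : 3 ≤ n) {φ : E n → ℝ} (hφ : ContDiff ℝ ∞ φ)
    (hc : HasCompactSupport φ) (j : Fin n) :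
    ∫ x, stokesP n j x * lap φ x = - pd j φ 0 := by
  have hω := unitBallVolume_pos n
  have hn3 : (3 : ℝ) ≤ n := by exact_mod_cast hn
  simp only [stokesP_eq, mul_assoc]
  rw [integral_const_mul, integral_radial_mul_lap hn hφ hc]
  field_simp

/-- `-Δ U_ij + ∂ᵢ P_j = δ_ij δ₀`, tested against `φ`. -/
lemma integral_stokesU_mul_lap (hn : 3 ≤ n) {φ : E n → ℝ} (hφ : ContDiff ℝ ∞ φ)
    (hc : HasCompactSupport φ) (i j : Fin n) :
    (∫ x, stokesU n i j x * lap φ x) + ∫ x, stokesP n j x * pd i φ x =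
      - (if i = j then 1 else 0) * φ 0 := by
  have hω := unitBallVolume_pos n
  have hn3 : (3 : ℝ) ≤ n := by exact_mod_cast hn
  have hn0 : 0 < n := by omega
  have hL := contDiff_lap_infty hφ
  have hLc := hasCompactSupport_lap hc
  have hP := contDiff_pd_infty hφ i
  have hPc := hasCompactSupport_pd hc i
  have hxφ : ContDiff ℝ ∞ (fun x : E n => x i * φ x) := by fun_prop
  have h1 := integral_radial_mul_lap hn hxφ hc.mul_left j
  have h2 : pd j (fun x : E n => x i * φ x) 0 = (if i = j then 1 else 0) * φ 0 := by
    have hd : DifferentiableAt ℝ (fun x : E n => x i) 0 :=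
      (EuclideanSpace.proj i : E n →L[ℝ] ℝ).differentiableAt
    rw [pd_mul hd (hφ.differentiable (by simp) 0), pd_coord]
    simp [eq_comm]
  rw [h2] at h1
  simp_rw [lap_coord_mul hφ] at h1
  have hi1 : Integrable fun x => x i * radialKernel j x * lap φ x :=
    (kernelBound_coord_mul_radial hn i j).integrable_mul_compact hn0 (by linarith) (by linarith)
      hLc hL.continuous
  have hi2 : Integrable fun x => radialKernel j x * pd i φ x :=
    (kernelBound_radial hn j).integrable_mul_compact hn0 (by linarith) (by linarith)
      hPc hP.continuous
  have hi3 : Integrable fun x => newtonKernel x * lap φ x :=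
    (kernelBound_newton hn).integrable_mul_compact hn0 (by linarith) (by linarith)
      hLc hL.continuous
  have h4 : (∫ x, x i * radialKernel j x * lap φ x) + 2 * ∫ x, radialKernel j x * pd i φ x =
      -(n * unitBallVolume n) * ((if i = j then 1 else 0) * φ 0) := by
    rw [← h1, ← integral_const_mul, ← integral_add hi1 (hi2.const_mul 2)]
    refine integral_congr_ae (Eventually.of_forall fun x => ?_)
    simp only; ring
  have h5 := integral_newton_mul_lap hn hφ hc
  have h6 : ∫ x, stokesU n i j x * lap φ x =
      1 / (2 * n * unitBallVolume n) * ((if i = j then 1 else 0) / ((n : ℝ) - 2)) *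
        (∫ x, newtonKernel x * lap φ x)
      + 1 / (2 * n * unitBallVolume n) * ∫ x, x i * radialKernel j x * lap φ x := by
    rw [← integral_const_mul, ← integral_const_mul, ← integral_add (hi3.const_mul _)
      (hi1.const_mul _), stokesU_eq]
    refine integral_congr_ae (Eventually.of_forall fun x => ?_)
    simp only; ring
  have h7 : ∫ x, stokesP n j x * pd i φ x =
      1 / (n * unitBallVolume n) * ∫ x, radialKernel j x * pd i φ x := by
    simp only [stokesP_eq, mul_assoc]
    rw [integral_const_mul]
  rw [h6, h7, h5, eq_sub_of_add_eq h4]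
  have h8 : (n : ℝ) - 2 ≠ 0 := by linarith
  field_simp
  ring

end Stokes

/-! ### Distributional equations -/

section Weak
variable {n : ℕ} {F : Fin n → E n → ℝ}

/-- The potential `∑ⱼ kⱼ * Fⱼ` is integrated term by term. -/
lemma integral_sum_kernel_mul {a : ℝ} {k : Fin n → E n → ℝ} (hk : ∀ j, KernelBound a (k j))
    (hn : 0 < n) (ha : 0 < a) (han : a < n) (hF : ∀ j, Decay n (F j))
    (hFm : ∀ j, Measurable (F j)) (x : E n) :
    ∫ y, ∑ j, k j (x - y) * F j y = ∑ j, ∫ y, k j (x - y) * F j y :=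
  integral_finsetSum _ fun j _ => (hk j).integrable_mul hn ha.le han (Nat.cast_nonneg n)
    (by linarith) (hF j) (hFm j).aestronglyMeasurable x

lemma integral_sum_potential_mul {a : ℝ} {k : Fin n → E n → ℝ} (hk : ∀ j, KernelBound a (k j))
    (hn : 0 < n) (ha : 0 < a) (han : a < n) (hF : ∀ j, Decay n (F j))
    (hFm : ∀ j, Measurable (F j)) {φ : E n → ℝ} (hφ : HasCompactSupport φ) (hc : Continuous φ) :
    ∫ x, (∫ y, ∑ j, k j (x - y) * F j y) * φ x =
      ∑ j, ∫ y, (∫ z, k j z * φ (z + y)) * F j y := by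
  simp_rw [integral_sum_kernel_mul hk hn ha han hF hFm, Finset.sum_mul]
  rw [integral_finsetSum]
  · exact Finset.sum_congr rfl fun j _ => (hk j).integral_potential_mul hn ha.le han
      (Nat.cast_nonneg n) (by linarith) (hF j) (hFm j) hφ hc
  · intro j _
    have h1 := (hk j).decay_potential hn le_rfl ha han (hF j)
    have h2 : Decay ((n : ℝ) + 1) φ := HasCompactSupport.decay hφ hc (by positivity)
    exact (h1.mul h2).integrable (((hk j).stronglyMeasurable_potential
      (hFm j)).aestronglyMeasurable.mul hc.aestronglyMeasurable) (by linarith)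

lemma integrable_potential_term {a : ℝ} {k : E n → ℝ} (hk : KernelBound a k) (hn : 0 < n)
    (ha : 0 < a) (han : a < n) {g : E n → ℝ} (hg : Decay n g) (hm : Measurable g)
    {φ : E n → ℝ} (hφ : HasCompactSupport φ) (hc : Continuous φ) :
    Integrable fun y => (∫ z, k z * φ (z + y)) * g y := by
  have h0 : ∀ y, ∫ z, k z * φ (z + y) = ∫ z, k (-(y - z)) * φ z := fun y => by
    rw [← integral_add_right_eq_self (fun z => k (-(y - z)) * φ z) y]
    refine integral_congr_ae (Eventually.of_forall fun z => ?_)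
    simp
  simp_rw [h0]
  have hd : Decay n φ := HasCompactSupport.decay hφ hc (by positivity)
  have h1 := hk.comp_neg.decay_potential hn (c := a / 2) (by linarith) (by linarith) han hd
  exact (h1.mul hg).integrable ((hk.comp_neg.stronglyMeasurable_potential
    hc.measurable).aestronglyMeasurable.mul hm.aestronglyMeasurable) (by linarith)

lemma hasCompactSupport_comp_add {φ : E n → ℝ} (hφ : HasCompactSupport φ) (y : E n) :
    HasCompactSupport fun z => φ (z + y) :=
  hφ.comp_homeomorph (Homeomorph.addRight y)

/-- The momentum equation `-Δu + ∇p = F` in the sense of distributions. -/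
lemma weak_momentum (hn : 3 ≤ n) (hF : ∀ j, Decay n (F j)) (hFm : ∀ j, Measurable (F j))
    {φ : E n → ℝ} (hφ : ContDiff ℝ ∞ φ) (hc : HasCompactSupport φ) (i : Fin n) :
    (∫ x, (∫ y, ∑ j, stokesU n i j (x - y) * F j y) * lap φ x) +
      ∫ x, (∫ y, ∑ j, stokesP n j (x - y) * F j y) * pd i φ x = - ∫ y, F i y * φ y := by
  have hn3 : (3 : ℝ) ≤ n := by exact_mod_cast hn
  have hn0 : 0 < n := by omega
  have hL := contDiff_lap_infty hφ
  have hLc := hasCompactSupport_lap hc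
  have hP := contDiff_pd_infty hφ i
  have hPc := hasCompactSupport_pd hc i
  rw [integral_sum_potential_mul (fun j => kernelBound_stokesU hn i j) hn0 (by linarith)
    (by linarith) hF hFm hLc hL.continuous, integral_sum_potential_mul
    (fun j => kernelBound_stokesP hn j) hn0 (by linarith) (by linarith) hF hFm hPc hP.continuous,
    ← Finset.sum_add_distrib]
  have key : ∀ j, (∫ y, (∫ z, stokesU n i j z * lap φ (z + y)) * F j y) +
      ∫ y, (∫ z, stokesP n j z * pd i φ (z + y)) * F j y =
      if i = j then - ∫ y, F i y * φ y else 0 := by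
    intro j
    rw [← integral_add (integrable_potential_term (kernelBound_stokesU hn i j) hn0 (by linarith)
      (by linarith) (hF j) (hFm j) hLc hL.continuous) (integrable_potential_term
      (kernelBound_stokesP hn j) hn0 (by linarith) (by linarith) (hF j) (hFm j) hPc hP.continuous)]
    have h1 : ∀ y, (∫ z, stokesU n i j z * lap φ (z + y)) * F j y +
        (∫ z, stokesP n j z * pd i φ (z + y)) * F j y =
        - (if i = j then 1 else 0) * φ y * F j y := by
      intro y
      have h2 := integral_stokesU_mul_lap hn (φ := fun z => φ (z + y)) (by fun_prop)
        (hasCompactSupport_comp_add hc y) i j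
      simp only [lap_comp_add_right, pd_comp_add_right, zero_add] at h2
      rw [← add_mul, h2]
    simp_rw [h1]
    split_ifs with hij
    · subst hij
      rw [← integral_neg]
      refine integral_congr_ae (Eventually.of_forall fun y => ?_)
      simp only; ring
    · simp
  simp_rw [key]
  simp

/-- The pressure equation `Δp = div F` in the sense of distributions. -/
lemma weak_pressure (hn : 3 ≤ n) (hF : ∀ j, Decay n (F j)) (hFm : ∀ j, Measurable (F j))
    {φ : E n → ℝ} (hφ : ContDiff ℝ ∞ φ) (hc : HasCompactSupport φ) :
    ∫ x, (∫ y, ∑ j, stokesP n j (x - y) * F j y) * lap φ x = - ∑ j, ∫ y, F j y * pd j φ y := by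
  have hn3 : (3 : ℝ) ≤ n := by exact_mod_cast hn
  have hn0 : 0 < n := by omega
  have hL := contDiff_lap_infty hφ
  have hLc := hasCompactSupport_lap hc
  rw [integral_sum_potential_mul (fun j => kernelBound_stokesP hn j) hn0 (by linarith)
    (by linarith) hF hFm hLc hL.continuous, ← Finset.sum_neg_distrib]
  refine Finset.sum_congr rfl fun j _ => ?_
  rw [← integral_neg]
  refine integral_congr_ae (Eventually.of_forall fun y => ?_)
  have h2 := integral_stokesP_mul_lap hn (φ := fun z => φ (z + y)) (by fun_prop)
    (hasCompactSupport_comp_add hc y) j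
  simp only [lap_comp_add_right, pd_comp_add_right, zero_add] at h2
  simp only [h2]; ring

end Weak

/-! ### Mollification -/

/-- The convolution `φ * g`. -/
def conv {n : ℕ} (φ g : E n → ℝ) (x : E n) : ℝ := ∫ y, φ (x - y) * g y

section Conv
variable {n : ℕ} {φ g : E n → ℝ}

lemma conv_eq_convolution (φ g : E n → ℝ) :
    conv φ g = convolution g φ (ContinuousLinearMap.mul ℝ ℝ) volume := by
  ext x
  simp only [conv, convolution_def, ContinuousLinearMap.mul_apply']
  exact integral_congr_ae (Eventually.of_forall fun y => mul_comm _ _)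

lemma Decay.locallyIntegrable {β : ℝ} (hβ : 0 ≤ β) (hg : Decay β g) (hm : Measurable g) :
    LocallyIntegrable g volume := by
  obtain ⟨C, -, hC⟩ := hg.bounded hβ
  exact (locallyIntegrable_const C).mono hm.aestronglyMeasurable
    (Eventually.of_forall fun x => (hC x).trans (le_abs_self C))

lemma contDiff_conv (hφ : ContDiff ℝ ∞ φ) (hc : HasCompactSupport φ)
    (hg : LocallyIntegrable g volume) : ContDiff ℝ ∞ (conv φ g) := by
  rw [conv_eq_convolution]
  exact hc.contDiff_convolution_right _ hg hφ

lemma pd_conv (hφ : ContDiff ℝ 1 φ) (hc : HasCompactSupport φ)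
    (hg : LocallyIntegrable g volume) (i : Fin n) :
    pd i (conv φ g) = conv (pd i φ) g := by
  ext x
  have h := hc.hasFDerivAt_convolution_right (ContinuousLinearMap.mul ℝ ℝ) hg hφ x
  rw [← conv_eq_convolution] at h
  rw [h.pd_eq, convolution_precompR_apply _ hg (hc.fderiv ℝ) (hφ.continuous_fderiv one_ne_zero),
    conv_eq_convolution]
  rfl

lemma conv_sum {ι : Type*} {s : Finset ι} {g : ι → E n → ℝ} (hφ : Continuous φ)
    (hc : HasCompactSupport φ) (hg : ∀ j ∈ s, LocallyIntegrable (g j) volume) (x : E n) :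
    conv φ (fun y => ∑ j ∈ s, g j y) x = ∑ j ∈ s, conv φ (g j) x := by
  simp only [conv, Finset.mul_sum]
  refine integral_finsetSum _ fun j hj => ?_
  have h1 : HasCompactSupport fun y => φ (x - y) := hc.comp_homeomorph (Homeomorph.subLeft x)
  have h2 : Continuous fun y => φ (x - y) := by fun_prop
  simpa [mul_comm] using (hg j hj).integrable_smul_left_of_hasCompactSupport h2 h1

lemma pd_comp_sub_left (hφ : Differentiable ℝ φ) (i : Fin n) (x y : E n) :
    pd i (fun y => φ (x - y)) y = - pd i φ (x - y) := by
  have hd : HasFDerivAt (fun y => x - y) (-ContinuousLinearMap.id ℝ (E n)) y :=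
    (hasFDerivAt_id y).const_sub x
  have h : HasFDerivAt (fun y => φ (x - y)) _ y := (hφ (x - y)).hasFDerivAt.comp y hd
  rw [h.pd_eq]
  simp [pd]

lemma lap_comp_sub_left (hφ : ContDiff ℝ ∞ φ) (x y : E n) :
    lap (fun y => φ (x - y)) y = lap φ (x - y) := by
  unfold lap
  refine Finset.sum_congr rfl fun k _ => ?_
  have h1 : pd k (fun y => φ (x - y)) = fun y => -1 * pd k φ (x - y) := by
    ext z; rw [pd_comp_sub_left (hφ.differentiable (by simp))]; ring
  have h2 := (contDiff_pd_infty hφ k).differentiable (by simp)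
  have h3 : Differentiable ℝ fun y => pd k φ (x - y) := by fun_prop
  rw [h1, pd_const_mul (h3 y), pd_comp_sub_left h2]
  ring

lemma conv_pd_right (hφ : ContDiff ℝ 1 φ) (hc : HasCompactSupport φ) (hg : ContDiff ℝ 1 g)
    (i : Fin n) : conv φ (pd i g) = pd i (conv φ g) := by
  rw [pd_conv hφ hc hg.continuous.locallyIntegrable]
  ext x
  have h1 : HasCompactSupport fun y => φ (x - y) := hc.comp_homeomorph (Homeomorph.subLeft x)
  have h2 : ContDiff ℝ 1 fun y => φ (x - y) := by fun_prop
  have h3 := fun y => pd_comp_sub_left (hφ.differentiable one_ne_zero) i x y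
  have hpc := hasCompactSupport_pd h1 i
  have hpcc := continuous_pd h2 i
  rw [conv, conv, integral_pd_mul i (h2.differentiable one_ne_zero) (hg.differentiable one_ne_zero),
    ← integral_neg]
  · refine integral_congr_ae (Eventually.of_forall fun y => ?_)
    simp only [h3]; ring
  · exact (hpcc.mul hg.continuous).integrable_of_hasCompactSupport hpc.mul_right
  · exact (h2.continuous.mul (continuous_pd hg i)).integrable_of_hasCompactSupport h1.mul_right
  · exact (h2.continuous.mul hg.continuous).integrable_of_hasCompactSupport h1.mul_right

lemma enorm_conv_le {b : ℝ} (hb : 0 ≤ b) (hφ : Continuous φ) (hs : ∀ z, 1 < ‖z‖ → φ z = 0) {C : ℝ≥0∞}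
    (hg : ∀ y, ‖g y‖ₑ ≤ C * (1 + ‖y‖ₑ) ^ (-b)) (x : E n) :
    ‖conv φ g x‖ₑ ≤ (∫⁻ z, ‖φ z‖ₑ) * (C * 2 ^ b) * (1 + ‖x‖ₑ) ^ (-b) := by
  have h1 : ∀ y, ‖φ (x - y) * g y‖ₑ ≤ ‖φ (x - y)‖ₑ * (C * 2 ^ b * (1 + ‖x‖ₑ) ^ (-b)) := by
    intro y
    rw [enorm_mul]
    rcases lt_or_ge 1 ‖x - y‖ with h | h
    · simp [hs _ h]
    · gcongr
      refine (hg y).trans ?_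
      rw [mul_assoc]
      gcongr
      have h2 : 1 + ‖x‖ₑ ≤ 2 * (1 + ‖y‖ₑ) := by
        have h3 : ‖x‖ₑ ≤ ‖x - y‖ₑ + ‖y‖ₑ := by simpa using enorm_add_le (x - y) y
        have h4 : ‖x - y‖ₑ ≤ 1 := by
          rw [← ofReal_norm, ← ENNReal.ofReal_one]; exact ENNReal.ofReal_le_ofReal h
        calc 1 + ‖x‖ₑ ≤ 1 + (1 + ‖y‖ₑ) := by gcongr; exact h3.trans (by gcongr)
          _ ≤ (1 + ‖y‖ₑ) + (1 + ‖y‖ₑ) := by gcongr; exact le_self_add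
          _ = _ := by ring
      calc (1 + ‖y‖ₑ) ^ (-b) = 2 ^ b * (2 * (1 + ‖y‖ₑ)) ^ (-b) := by
            rw [ENNReal.mul_rpow_of_ne_top (by simp) (by simp), ← mul_assoc,
              ← ENNReal.rpow_add _ _ (by simp) (by simp)]
            simp
        _ ≤ _ := mul_le_mul' le_rfl (rpow_neg_le_rpow_neg hb h2)
  calc ‖conv φ g x‖ₑ ≤ ∫⁻ y, ‖φ (x - y) * g y‖ₑ := enorm_integral_le_lintegral_enorm _
    _ ≤ ∫⁻ y, ‖φ (x - y)‖ₑ * (C * 2 ^ b * (1 + ‖x‖ₑ) ^ (-b)) := lintegral_mono h1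
    _ = (∫⁻ y, ‖φ (x - y)‖ₑ) * (C * 2 ^ b * (1 + ‖x‖ₑ) ^ (-b)) := by
        rw [lintegral_mul_const]
        have : Continuous fun y => φ (x - y) := by fun_prop
        exact this.measurable.enorm
    _ = _ := by rw [lintegral_sub_left_eq_self (fun z => ‖φ z‖ₑ) x]; ring

lemma Decay.conv {b : ℝ} (hb : 0 ≤ b) (hφ : Continuous φ) (hc : HasCompactSupport φ)
    (hs : ∀ z, 1 < ‖z‖ → φ z = 0) (hg : Decay b g) : Decay b (conv φ g) := by
  obtain ⟨C, hC, hg⟩ := hg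
  refine ⟨_, ?_, enorm_conv_le hb hφ hs hg⟩
  exact ENNReal.mul_lt_top (hφ.integrable_of_hasCompactSupport hc).2
    (ENNReal.mul_lt_top hC (ENNReal.rpow_lt_top_of_nonneg hb (by simp)))

end Conv

/-- A sequence of smooth mollifiers with supports shrinking to the origin. -/
def mollifier (n k : ℕ) : ContDiffBump (0 : E n) where
  rIn := 1 / (2 * ((k : ℝ) + 1))
  rOut := 1 / ((k : ℝ) + 1)
  rIn_pos := by positivity
  rIn_lt_rOut := by
    have : (0 : ℝ) < (k : ℝ) + 1 := by positivity
    gcongr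
    linarith

/-- The normalized mollifiers. -/
def moll (n k : ℕ) : E n → ℝ := (mollifier n k).normed volume

section Moll
variable {n : ℕ}

lemma contDiff_moll (k : ℕ) : ContDiff ℝ ∞ (moll n k) := (mollifier n k).contDiff_normed (n := ⊤)

lemma hasCompactSupport_moll (k : ℕ) : HasCompactSupport (moll n k) :=
  (mollifier n k).hasCompactSupport_normed

lemma moll_nonneg (k : ℕ) (x : E n) : 0 ≤ moll n k x := (mollifier n k).nonneg_normed x

lemma integral_moll (k : ℕ) : ∫ x, moll n k x = 1 := (mollifier n k).integral_normed

lemma moll_eq_zero {k : ℕ} {z : E n} (h : 1 / ((k : ℝ) + 1) < ‖z‖) : moll n k z = 0 := by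
  have : z ∉ Function.support (moll n k) := by
    rw [moll, ContDiffBump.support_normed_eq, mem_ball_zero_iff, not_lt]
    exact h.le
  simpa using this

lemma one_div_succ_le_one (k : ℕ) : 1 / ((k : ℝ) + 1) ≤ 1 := by
  rw [div_le_one (by positivity)]; linarith [(Nat.cast_nonneg k : (0 : ℝ) ≤ k)]

lemma moll_eq_zero_of_one_lt {k : ℕ} {z : E n} (h : 1 < ‖z‖) : moll n k z = 0 :=
  moll_eq_zero ((one_div_succ_le_one k).trans_lt h)

lemma pd_eq_zero_of_one_lt {φ : E n → ℝ} (hφ : ∀ z, 1 < ‖z‖ → φ z = 0) (i : Fin n) (z : E n)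
    (hz : 1 < ‖z‖) : pd i φ z = 0 := by
  have : φ =ᶠ[𝓝 z] fun _ => 0 := by
    filter_upwards [(isOpen_lt continuous_const continuous_norm).mem_nhds hz] with y hy
    exact hφ y hy
  rw [pd, this.fderiv_eq]
  simp

lemma lintegral_moll (k : ℕ) : ∫⁻ x, ‖moll n k x‖ₑ = 1 := by
  have h := ofReal_integral_eq_lintegral_ofReal (μ := volume) (f := moll n k)
    (mollifier n k).integrable_normed (Eventually.of_forall (moll_nonneg k))
  rw [integral_moll, ENNReal.ofReal_one] at h
  rw [h]
  exact lintegral_congr fun x => Real.enorm_eq_ofReal (moll_nonneg k x)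

lemma tendsto_conv_moll {g : E n → ℝ} (hg : Continuous g) (x : E n) :
    Tendsto (fun k => conv (moll n k) g x) atTop (𝓝 (g x)) := by
  have h := ContDiffBump.convolution_tendsto_right_of_continuous (μ := volume)
    (φ := mollifier n) (l := atTop) (tendsto_one_div_add_atTop_nhds_zero_nat) hg x
  refine h.congr fun k => ?_
  rw [convolution_lsmul_swap]
  rfl

end Moll

/-! ### Smooth stationary flows -/

/-- A smooth solution of `-Δv + (v · ∇)v + ∇p = h`, `div v = 0`, all of whose relevant derivatives
decay like `(1 + |x|)⁻ᵝ`. The equation for the Laplacian of the pressure is part of the data. -/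
structure IsFlow {n : ℕ} (β : ℝ) (v : Fin n → E n → ℝ) (p : E n → ℝ) (h : Fin n → E n → ℝ) :
    Prop where
  smooth_v : ∀ i, ContDiff ℝ ∞ (v i)
  smooth_p : ContDiff ℝ ∞ p
  smooth_h : ∀ i, ContDiff ℝ ∞ (h i)
  momentum : ∀ i x, -lap (v i) x + ∑ k, v k x * pd k (v i) x + pd i p x = h i x
  div_free : ∀ x, ∑ i, pd i (v i) x = 0
  pressure : ∀ x, lap p x = ∑ i, pd i (fun x => h i x - ∑ k, v k x * pd k (v i) x) x
  decay_v : ∀ i, Decay β (v i)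
  decay_dv : ∀ i k, Decay β (pd k (v i))
  decay_ddv : ∀ i k l, Decay β (pd l (pd k (v i)))
  decay_p : Decay β p
  decay_dp : ∀ k, Decay β (pd k p)
  decay_ddp : ∀ k l, Decay β (pd l (pd k p))
  decay_h : ∀ i, Decay β (h i)
  decay_dh : ∀ i k, Decay β (pd k (h i))

section Mollified
variable {n : ℕ} {F : Fin n → E n → ℝ} {u : Fin n → E n → ℝ} {p : E n → ℝ}

lemma lap_conv {φ g : E n → ℝ} (hφ : ContDiff ℝ ∞ φ) (hc : HasCompactSupport φ)
    (hg : LocallyIntegrable g volume) (x : E n) : lap (conv φ g) x = conv (lap φ) g x := by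
  have h1 : ∀ k, pd k (pd k (conv φ g)) = conv (pd k (pd k φ)) g := fun k => by
    rw [pd_conv (hφ.of_le (by simp)) hc hg, pd_conv ((contDiff_pd_infty hφ k).of_le (by simp))
      (hasCompactSupport_pd hc k) hg]
  simp only [lap, h1]
  simp only [conv, lap, Finset.sum_mul]
  rw [integral_finsetSum]
  intro k _
  have h2 : HasCompactSupport fun y => pd k (pd k φ) (x - y) :=
    (hasCompactSupport_pd (hasCompactSupport_pd hc k) k).comp_homeomorph (Homeomorph.subLeft x)
  have h3 : Continuous fun y => pd k (pd k φ) (x - y) :=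
    (contDiff_pd_infty (contDiff_pd_infty hφ k) k).continuous.comp (continuous_const.sub continuous_id)
  simpa [mul_comm] using hg.integrable_smul_left_of_hasCompactSupport h3 h2

/-- Mollifying a solution of the integral equation yields a smooth flow, whose force contains the
commutator of the mollification with the quadratic term. -/
lemma isFlow_mollified (hn : 5 ≤ n) {β : ℝ} (hβ0 : 0 ≤ β) (hβ : β ≤ n) (hF : ∀ j, Decay n (F j))
    (hFm : ∀ j, Measurable (F j))
    (hu : ∀ i x, u i x = ∫ y, ∑ j, stokesU n i j (x - y) * F j y)
    (hp : ∀ x, p x = ∫ y, ∑ j, stokesP n j (x - y) * F j y)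
    (hu1 : ∀ i, ContDiff ℝ 1 (u i)) (hdiv : ∀ x, ∑ i, pd i (u i) x = 0)
    (hud : ∀ i, Decay β (u i)) (hpd : Decay β p) (hpm : Measurable p) (k : ℕ) :
    IsFlow β (fun i => conv (moll n k) (u i)) (conv (moll n k) p)
      (fun i x => conv (moll n k) (F i) x +
        ∑ l, conv (moll n k) (u l) x * pd l (conv (moll n k) (u i)) x) := by
  have hn3 : 3 ≤ n := by omega
  have hρ : ContDiff ℝ ∞ (moll n k) := contDiff_moll k
  have hρ1 : ContDiff ℝ 1 (moll n k) := hρ.of_le (by simp)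
  have hρc := hasCompactSupport_moll (n := n) k
  have hs0 : ∀ z : E n, 1 < ‖z‖ → moll n k z = 0 := fun z hz => moll_eq_zero_of_one_lt hz
  have hs1 := fun i => pd_eq_zero_of_one_lt hs0 i
  have hs2 := fun i j => pd_eq_zero_of_one_lt (hs1 i) j
  have hρd := contDiff_pd_infty hρ
  have hρdc := hasCompactSupport_pd hρc
  have hρdd := fun i j => contDiff_pd_infty (hρd i) j
  have hρddc := fun i j => hasCompactSupport_pd (hρdc i) j
  have hul : ∀ i, LocallyIntegrable (u i) volume := fun i => (hu1 i).continuous.locallyIntegrable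
  have hFl : ∀ i, LocallyIntegrable (F i) volume := fun i =>
    (hF i).locallyIntegrable (Nat.cast_nonneg n) (hFm i)
  have hpl : LocallyIntegrable p volume := hpd.locallyIntegrable hβ0 hpm
  have hFd : ∀ i, Decay β (F i) := fun i => (hF i).mono hβ
  have d1 : ∀ {g : E n → ℝ}, LocallyIntegrable g volume → ∀ i,
      pd i (conv (moll n k) g) = conv (pd i (moll n k)) g := fun hg i => pd_conv hρ1 hρc hg i
  have d2 : ∀ {g : E n → ℝ}, LocallyIntegrable g volume → ∀ i j,
      pd j (pd i (conv (moll n k) g)) = conv (pd j (pd i (moll n k))) g := fun hg i j => by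
    rw [d1 hg, pd_conv ((hρd i).of_le (by simp)) (hρdc i) hg]
  have e0 : ∀ {g : E n → ℝ}, Decay β g → Decay β (conv (moll n k) g) := fun hg =>
    hg.conv hβ0 hρ.continuous hρc hs0
  have e1 : ∀ {g : E n → ℝ}, Decay β g → LocallyIntegrable g volume → ∀ i,
      Decay β (pd i (conv (moll n k) g)) := fun hg hl i => by
    rw [d1 hl]; exact hg.conv hβ0 (hρd i).continuous (hρdc i) (hs1 i)
  have e2 : ∀ {g : E n → ℝ}, Decay β g → LocallyIntegrable g volume → ∀ i j,
      Decay β (pd j (pd i (conv (moll n k) g))) := fun hg hl i j => by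
    rw [d2 hl]; exact hg.conv hβ0 (hρdd i j).continuous (hρddc i j) (hs2 i j)
  have hsv : ∀ i, ContDiff ℝ ∞ (conv (moll n k) (u i)) := fun i => contDiff_conv hρ hρc (hul i)
  have hsF : ∀ i, ContDiff ℝ ∞ (conv (moll n k) (F i)) := fun i => contDiff_conv hρ hρc (hFl i)
  have hsQ : ∀ i, ContDiff ℝ ∞
      (fun x => ∑ l, conv (moll n k) (u l) x * pd l (conv (moll n k) (u i)) x) := fun i =>
    ContDiff.sum fun l _ => (hsv l).mul (contDiff_pd_infty (hsv i) l)
  have hQd : ∀ i, Decay β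
      (fun x => ∑ l, conv (moll n k) (u l) x * pd l (conv (moll n k) (u i)) x) := fun i =>
    Decay.sum fun l _ => ((e0 (hud l)).mul (e1 (hud i) (hul i) l)).mono (by linarith)
  have hdQ : ∀ i j x, pd j
      (fun x => ∑ l, conv (moll n k) (u l) x * pd l (conv (moll n k) (u i)) x) x =
      ∑ l, (pd j (conv (moll n k) (u l)) x * pd l (conv (moll n k) (u i)) x +
        conv (moll n k) (u l) x * pd j (pd l (conv (moll n k) (u i))) x) := by
    intro i j x
    have hd1 := fun l => (hsv l).differentiable (by simp) x
    have hd2 := fun l => (contDiff_pd_infty (hsv i) l).differentiable (by simp) x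
    rw [pd_sum fun l _ => (hd1 l).fun_mul (hd2 l)]
    exact Finset.sum_congr rfl fun l _ => pd_mul (hd1 l) (hd2 l) j
  have tsub : ∀ x, ContDiff ℝ ∞ (fun y => moll n k (x - y)) := fun x => by fun_prop
  have tsubc : ∀ x, HasCompactSupport (fun y => moll n k (x - y)) := fun x =>
    hρc.comp_homeomorph (Homeomorph.subLeft x)
  have hρD : Differentiable ℝ (moll n k) := hρ.differentiable (by simp)
  refine ⟨hsv, contDiff_conv hρ hρc hpl, fun i => (hsF i).add (hsQ i), ?_, ?_, ?_,
    fun i => e0 (hud i), fun i k => e1 (hud i) (hul i) k, fun i k l => e2 (hud i) (hul i) k l,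
    e0 hpd, e1 hpd hpl, e2 hpd hpl, fun i => (e0 (hFd i)).add (hQd i), ?_⟩
  · intro i x
    have hw := weak_momentum hn3 hF hFm (tsub x) (tsubc x) i
    simp_rw [← hu, ← hp, lap_comp_sub_left hρ, pd_comp_sub_left hρD] at hw
    rw [lap_conv hρ hρc (hul i), d1 hpl]
    have h1 : conv (lap (moll n k)) (u i) x = ∫ y, u i y * lap (moll n k) (x - y) :=
      integral_congr_ae (Eventually.of_forall fun y => mul_comm _ _)
    have h2 : conv (pd i (moll n k)) p x = - ∫ y, p y * -pd i (moll n k) (x - y) := by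
      rw [← integral_neg]
      refine integral_congr_ae (Eventually.of_forall fun y => ?_)
      simp only; ring
    have h3 : conv (moll n k) (F i) x = ∫ y, F i y * moll n k (x - y) :=
      integral_congr_ae (Eventually.of_forall fun y => mul_comm _ _)
    rw [h1, h2, h3]
    linarith
  · intro x
    have h1 : ∀ i, pd i (conv (moll n k) (u i)) x = conv (moll n k) (pd i (u i)) x := fun i => by
      rw [conv_pd_right hρ1 hρc (hu1 i)]
    simp only [h1]
    rw [← conv_sum hρ.continuous hρc fun i _ => (continuous_pd (hu1 i) i).locallyIntegrable]
    simp [hdiv, conv]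
  · intro x
    have hw := weak_pressure hn3 hF hFm (tsub x) (tsubc x)
    simp_rw [← hp, lap_comp_sub_left hρ, pd_comp_sub_left hρD] at hw
    simp only [add_sub_cancel_right]
    have h0 : ∀ i, pd i (fun x => conv (moll n k) (F i) x) x = conv (pd i (moll n k)) (F i) x :=
      fun i => congrFun (d1 (hFl i) i) x
    simp only [h0]
    have h1 : conv (lap (moll n k)) p x = ∫ y, p y * lap (moll n k) (x - y) :=
      integral_congr_ae (Eventually.of_forall fun y => mul_comm _ _)
    rw [lap_conv hρ hρc hpl, h1, hw, ← Finset.sum_neg_distrib]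
    refine Finset.sum_congr rfl fun i _ => ?_
    rw [← integral_neg]
    refine integral_congr_ae (Eventually.of_forall fun y => ?_)
    simp only; ring
  · intro i j
    have h1 : pd j (fun x => conv (moll n k) (F i) x +
        ∑ l, conv (moll n k) (u l) x * pd l (conv (moll n k) (u i)) x) = fun x =>
        pd j (conv (moll n k) (F i)) x +
        ∑ l, (pd j (conv (moll n k) (u l)) x * pd l (conv (moll n k) (u i)) x +
        conv (moll n k) (u l) x * pd j (pd l (conv (moll n k) (u i))) x) := by
      ext x
      rw [pd_add ((hsF i).differentiable (by simp) x) ((hsQ i).differentiable (by simp) x), hdQ]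
    rw [h1]
    refine (e1 (hFd i) (hFl i) j).add (Decay.sum fun l _ => Decay.add ?_ ?_)
    · exact ((e1 (hud l) (hul l) j).mul (e1 (hud i) (hul i) l)).mono (by linarith)
    · exact ((e0 (hud l)).mul (e2 (hud i) (hul i) l j)).mono (by linarith)

end Mollified

/-! ### Integral identities for smooth flows -/

/-- The total head pressure of a flow given in components. -/
def head {n : ℕ} (v : Fin n → E n → ℝ) (p : E n → ℝ) (x : E n) : ℝ :=
  (∑ i, v i x ^ 2) / 2 + p x

section Flow
variable {n : ℕ} {β : ℝ} {v : Fin n → E n → ℝ} {p : E n → ℝ} {h : Fin n → E n → ℝ}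

lemma Decay.mul_left_bdd {f g : E n → ℝ} {γ : ℝ} (hf : Decay β f) (hβ : 0 ≤ β) (hg : Decay γ g) :
    Decay γ (fun x => f x * g x) := by
  simpa using (hf.mono hβ).mul hg

lemma decay_of_abs_le {g : E n → ℝ} {C : ℝ} (hg : ∀ x, |g x| ≤ C * (1 + ‖x‖) ^ (-β)) :
    Decay β g := by
  refine ⟨ENNReal.ofReal C, by simp, fun x => ?_⟩
  rw [← ofReal_norm, ← ofReal_norm, ← ENNReal.ofReal_one, ← ENNReal.ofReal_add zero_le_one
    (norm_nonneg _), ENNReal.ofReal_rpow_of_pos (by positivity), ← ENNReal.ofReal_mul' (by positivity)]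
  exact ENNReal.ofReal_le_ofReal (hg x)

lemma hasDerivAt_posPart_rpow {q : ℝ} (hq : 1 < q) (t : ℝ) :
    HasDerivAt (fun t : ℝ => max t 0 ^ q) (q * max t 0 ^ (q - 1)) t := by
  rcases lt_trichotomy t 0 with ht | rfl | ht
  · have h1 : (fun t : ℝ => max t 0 ^ q) =ᶠ[𝓝 t] fun _ => 0 := by
      filter_upwards [eventually_lt_nhds ht] with s hs
      rw [max_eq_right hs.le, Real.zero_rpow (by linarith)]
    rw [max_eq_right ht.le, Real.zero_rpow (by linarith), mul_zero]
    exact (hasDerivAt_const t 0).congr_of_eventuallyEq h1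
  · rw [max_self, Real.zero_rpow (by linarith), mul_zero, hasDerivAt_iff_isLittleO_nhds_zero]
    have h2 : (fun s : ℝ => |s| ^ q) =o[𝓝 0] fun s => s := by
      have h3 := (Real.hasDerivAt_rpow_const (x := 0) (p := q) (Or.inr hq.le)).isLittleO
      have h4 : (fun s : ℝ => |s| ^ q) =O[𝓝 0] fun s : ℝ => |s| ^ q := Asymptotics.isBigO_refl _ _
      have h5 : Tendsto (fun s : ℝ => |s|) (𝓝 0) (𝓝 0) := by
        simpa using (continuous_abs (G := ℝ)).tendsto 0
      have h6 := h3.comp_tendsto h5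
      simp only [Function.comp_def, Real.zero_rpow (by linarith : q ≠ 0), sub_zero,
        Real.zero_rpow (by linarith : q - 1 ≠ 0), mul_zero, smul_zero] at h6
      exact h6.trans_isBigO (Asymptotics.isBigO_of_le _ fun s => by simp)
    refine Asymptotics.IsBigO.trans_isLittleO (Asymptotics.isBigO_of_le _ fun s => ?_) h2
    simp only [zero_add, max_self, Real.zero_rpow (by linarith : q ≠ 0), sub_zero, smul_eq_mul,
      mul_zero]
    rw [Real.norm_of_nonneg (by positivity), Real.norm_of_nonneg (by positivity)]
    exact Real.rpow_le_rpow (le_max_right _ _) (max_le (le_abs_self s) (abs_nonneg s)) (by linarith)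
  · have h1 : (fun t : ℝ => max t 0 ^ q) =ᶠ[𝓝 t] fun t => t ^ q := by
      filter_upwards [eventually_gt_nhds ht] with s hs
      rw [max_eq_left hs.le]
    rw [max_eq_left ht.le]
    exact (Real.hasDerivAt_rpow_const (Or.inl ht.ne')).congr_of_eventuallyEq h1

lemma contDiff_posPart_rpow {q : ℝ} (hq : 1 < q) : ContDiff ℝ 1 (fun t : ℝ => max t 0 ^ q) := by
  rw [contDiff_one_iff_deriv]
  refine ⟨fun t => (hasDerivAt_posPart_rpow hq t).differentiableAt, ?_⟩
  rw [funext fun t => (hasDerivAt_posPart_rpow hq t).deriv]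
  exact continuous_const.mul ((continuous_id.max continuous_const).rpow_const fun t =>
    Or.inr (by linarith))

lemma pd_posPart_rpow {q : ℝ} (hq : 1 < q) {g : E n → ℝ} (hg : Differentiable ℝ g) (k : Fin n)
    (x : E n) :
    pd k (fun x => max (g x) 0 ^ q) x = q * max (g x) 0 ^ (q - 1) * pd k g x := by
  have h := (hasDerivAt_posPart_rpow hq (g x)).comp_hasFDerivAt x (hg x).hasFDerivAt
  have h' : HasFDerivAt (fun x => max (g x) 0 ^ q) _ x := h
  rw [h'.pd_eq]
  simp [pd]

lemma Decay.posPart_rpow {g : E n → ℝ} (hg : Decay β g) (hβ : 0 ≤ β) {s : ℝ} (hs : 1 ≤ s) :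
    Decay β (fun x => max (g x) 0 ^ s) := by
  obtain ⟨C, hC, hb⟩ := hg.bounded hβ
  refine (hg.const_mul (C ^ (s - 1))).of_le fun x => ?_
  have h1 : max (g x) 0 ≤ |g x| := max_le (le_abs_self _) (abs_nonneg _)
  have h0 : 0 ≤ max (g x) 0 := le_max_right _ _
  rw [Real.norm_of_nonneg (by positivity), norm_mul, Real.norm_of_nonneg (by positivity),
    Real.norm_eq_abs]
  rcases h0.eq_or_lt with h2 | h2
  · rw [← h2, Real.zero_rpow (by linarith)]; positivity
  · calc max (g x) 0 ^ s = max (g x) 0 ^ (s - 1) * max (g x) 0 := by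
          rw [← Real.rpow_add_one h2.ne']; ring_nf
      _ ≤ C ^ (s - 1) * |g x| := by
          gcongr
          exact h1.trans (hb x)

lemma Decay.posPart_rpow_bdd {g : E n → ℝ} (hg : Decay β g) (hβ : 0 ≤ β) {s : ℝ} (hs : 0 ≤ s) :
    Decay 0 (fun x => max (g x) 0 ^ s) := by
  obtain ⟨C, hC, hb⟩ := hg.bounded hβ
  refine decay_zero_of_bounded (C := C ^ s) fun x => ?_
  have h0 : 0 ≤ max (g x) 0 := le_max_right _ _
  rw [Real.norm_of_nonneg (by positivity)]
  exact Real.rpow_le_rpow h0 ((max_le (le_abs_self _) (abs_nonneg _)).trans (hb x)) hs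

namespace IsFlow

lemma diff_v (H : IsFlow β v p h) (i : Fin n) : Differentiable ℝ (v i) :=
  (H.smooth_v i).differentiable (by simp)

lemma diff_dv (H : IsFlow β v p h) (i k : Fin n) : Differentiable ℝ (pd k (v i)) :=
  (contDiff_pd_infty (H.smooth_v i) k).differentiable (by simp)

lemma diff_p (H : IsFlow β v p h) : Differentiable ℝ p := H.smooth_p.differentiable (by simp)

lemma diff_dp (H : IsFlow β v p h) (k : Fin n) : Differentiable ℝ (pd k p) :=
  (contDiff_pd_infty H.smooth_p k).differentiable (by simp)

lemma diff_h (H : IsFlow β v p h) (i : Fin n) : Differentiable ℝ (h i) :=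
  (H.smooth_h i).differentiable (by simp)

lemma smooth_head (H : IsFlow β v p h) : ContDiff ℝ ∞ (head v p) :=
  ((ContDiff.sum fun i _ => (H.smooth_v i).pow 2).div_const 2).add H.smooth_p

lemma pd_head (H : IsFlow β v p h) (k : Fin n) :
    pd k (head v p) = fun x => (∑ i, v i x * pd k (v i) x) + pd k p x := by
  ext x
  have h1 : head v p = fun x => (∑ i, (1 / 2) * (v i x * v i x)) + p x := by
    ext y
    rw [head, Finset.sum_div]
    congr 1
    exact Finset.sum_congr rfl fun i _ => by ring
  have hv := fun i => H.diff_v i x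
  rw [h1, pd_add (DifferentiableAt.fun_sum fun i _ => ((hv i).fun_mul (hv i)).const_mul _)
    (H.diff_p x), pd_sum fun i _ => ((hv i).fun_mul (hv i)).const_mul _]
  congr 1
  refine Finset.sum_congr rfl fun i _ => ?_
  rw [pd_const_mul ((hv i).fun_mul (hv i)), pd_mul (hv i) (hv i)]
  ring

lemma pd_pd_head (H : IsFlow β v p h) (k l : Fin n) : pd l (pd k (head v p)) = fun x =>
    (∑ i, (pd l (v i) x * pd k (v i) x + v i x * pd l (pd k (v i)) x)) + pd l (pd k p) x := by
  ext x
  have hd := fun i => (H.diff_v i x).fun_mul (H.diff_dv i k x)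
  rw [H.pd_head, pd_add (DifferentiableAt.fun_sum fun i _ => hd i) (H.diff_dp k x),
    pd_sum fun i _ => hd i]
  congr 1
  exact Finset.sum_congr rfl fun i _ => pd_mul (H.diff_v i x) (H.diff_dv i k x) l

lemma decay_head (H : IsFlow β v p h) (hβ : 0 ≤ β) : Decay β (head v p) := by
  have h1 : head v p = fun x => (∑ i, (1 / 2) * (v i x * v i x)) + p x := by
    ext y
    rw [head, Finset.sum_div]
    congr 1
    exact Finset.sum_congr rfl fun i _ => by ring
  rw [h1]
  exact (Decay.sum fun i _ => ((H.decay_v i).mul_left_bdd hβ (H.decay_v i)).const_mul _).add H.decay_p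

lemma decay_pd_head (H : IsFlow β v p h) (hβ : 0 ≤ β) (k : Fin n) :
    Decay β (pd k (head v p)) := by
  rw [H.pd_head]
  exact (Decay.sum fun i _ => (H.decay_v i).mul_left_bdd hβ (H.decay_dv i k)).add (H.decay_dp k)

lemma decay_pd_pd_head (H : IsFlow β v p h) (hβ : 0 ≤ β) (k l : Fin n) :
    Decay β (pd l (pd k (head v p))) := by
  rw [H.pd_pd_head]
  exact (Decay.sum fun i _ => ((H.decay_dv i l).mul_left_bdd hβ (H.decay_dv i k)).add
    ((H.decay_v i).mul_left_bdd hβ (H.decay_ddv i k l))).add (H.decay_ddp k l)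

/-- The energy identity. -/
lemma energy (H : IsFlow β v p h) (hβ : n < 2 * β) :
    ∫ x, ∑ i, ∑ k, pd k (v i) x ^ 2 = ∫ x, ∑ i, v i x * h i x := by
  have hβ0 : 0 ≤ β := by have : (0 : ℝ) ≤ n := Nat.cast_nonneg n; linarith
  have hθ := H.smooth_head
  have hθd : Differentiable ℝ (head v p) := hθ.differentiable (by simp)
  set Z : Fin n → E n → ℝ := fun k x => v k x * head v p x - ∑ i, v i x * pd k (v i) x with hZ
  have hdZ : ∀ k x, pd k (Z k) x = pd k (v k) x * head v p x + v k x * pd k (head v p) x -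
      ∑ i, (pd k (v i) x * pd k (v i) x + v i x * pd k (pd k (v i)) x) := by
    intro k x
    have hd := fun i => (H.diff_v i x).fun_mul (H.diff_dv i k x)
    rw [hZ, pd_sub ((H.diff_v k x).fun_mul (hθd x)) (DifferentiableAt.fun_sum fun i _ => hd i),
      pd_mul (H.diff_v k x) (hθd x), pd_sum fun i _ => hd i]
    congr 1
    exact Finset.sum_congr rfl fun i _ => pd_mul (H.diff_v i x) (H.diff_dv i k x) k
  have hZd : ∀ k, Differentiable ℝ (Z k) := fun k =>
    ((H.diff_v k).fun_mul hθd).fun_sub (Differentiable.fun_sum fun i _ =>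
      (H.diff_v i).fun_mul (H.diff_dv i k))
  have hcont : ∀ k, Continuous (pd k (Z k)) := fun k => by
    rw [funext (hdZ k)]
    have := fun i => (H.smooth_v i).continuous
    have := fun i j => (contDiff_pd_infty (H.smooth_v i) j).continuous
    have := fun i j => (contDiff_pd_infty (contDiff_pd_infty (H.smooth_v i) j) j).continuous
    have := hθ.continuous
    have := (contDiff_pd_infty hθ k).continuous
    fun_prop
  have h2 : ∀ {f g : E n → ℝ}, Decay β f → Decay β g → Decay (β + β) (fun x => f x * g x) :=
    fun hf hg => hf.mul hg
  have hint : ∀ k, Integrable (Z k) := fun k =>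
    ((h2 (H.decay_v k) (H.decay_head hβ0)).sub (Decay.sum fun i _ =>
      h2 (H.decay_v i) (H.decay_dv i k))).integrable (hZd k).continuous.aestronglyMeasurable
      (by linarith)
  have hint' : ∀ k, Integrable (pd k (Z k)) := fun k => by
    refine Decay.integrable (β := β + β) ?_ (hcont k).aestronglyMeasurable (by linarith)
    rw [funext (hdZ k)]
    exact ((h2 (H.decay_dv k k) (H.decay_head hβ0)).add
      (h2 (H.decay_v k) (H.decay_pd_head hβ0 k))).sub (Decay.sum fun i _ =>
      (h2 (H.decay_dv i k) (H.decay_dv i k)).add (h2 (H.decay_v i) (H.decay_ddv i k k)))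
  have hdiv := integral_sum_pd_eq_zero hZd hint hint'
  have hpt : ∀ x, ∑ k, pd k (Z k) x =
      ∑ i, v i x * h i x - ∑ i, ∑ k, pd k (v i) x ^ 2 := by
    intro x
    simp only [hdZ, H.pd_head, ← H.momentum, lap, Finset.sum_sub_distrib, Finset.sum_add_distrib,
      ← Finset.sum_mul, H.div_free, mul_add, Finset.mul_sum, mul_neg, Finset.sum_neg_distrib, zero_mul]
    rw [Finset.sum_comm (f := fun k i => v k x * (v i x * pd k (v i) x)),
      Finset.sum_comm (f := fun k i => pd k (v i) x * pd k (v i) x),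
      Finset.sum_comm (f := fun k i => v i x * pd k (pd k (v i)) x)]
    simp only [sq]
    have h3 : ∑ i, ∑ k, v k x * (v i x * pd k (v i) x) = ∑ i, ∑ k, v i x * (v k x * pd k (v i) x) :=
      Finset.sum_congr rfl fun i _ => Finset.sum_congr rfl fun k _ => by ring
    rw [h3]; ring
  simp only [hpt] at hdiv
  rw [integral_sub] at hdiv
  · linarith
  · exact (Decay.sum fun i _ => h2 (H.decay_v i) (H.decay_h i)).integrable
      (Continuous.aestronglyMeasurable (continuous_finsetSum _ fun i _ =>
        (H.smooth_v i).continuous.mul (H.smooth_h i).continuous)) (by linarith)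
  · refine (Decay.sum fun i _ => Decay.sum fun k _ => ?_).integrable (β := β + β)
      (Continuous.aestronglyMeasurable (continuous_finsetSum _ fun i _ =>
        continuous_finsetSum _ fun k _ => (contDiff_pd_infty (H.smooth_v i) k).continuous.pow 2))
        (by linarith)
    simpa [sq] using h2 (H.decay_dv i k) (H.decay_dv i k)

end IsFlow

end Flow

section Flow
variable {n : ℕ} {β : ℝ} {v : Fin n → E n → ℝ} {p : E n → ℝ} {h : Fin n → E n → ℝ}

namespace IsFlow

lemma sum_pd_pd_eq_zero (H : IsFlow β v p h) (k : Fin n) (x : E n) :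
    ∑ i, pd i (pd k (v i)) x = 0 := by
  have h1 : (fun x => ∑ i, pd i (v i) x) = fun _ => 0 := funext H.div_free
  have h2 : pd k (fun x => ∑ i, pd i (v i) x) x = 0 := by rw [h1]; simp [pd]
  rw [pd_sum fun i _ => H.diff_dv i i x] at h2
  rw [← h2]
  exact Finset.sum_congr rfl fun i _ => pd_comm ((H.smooth_v i).of_le two_le_infty) _ _ _

lemma lap_pressure (H : IsFlow β v p h) (x : E n) :
    lap p x = ∑ i, pd i (h i) x - ∑ i, ∑ k, pd i (v k) x * pd k (v i) x := by
  have hd := fun i k => (H.diff_v k x).fun_mul (H.diff_dv i k x)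
  rw [H.pressure, ← Finset.sum_sub_distrib]
  have h1 : ∀ i, pd i (fun x => h i x - ∑ k, v k x * pd k (v i) x) x = pd i (h i) x -
      (∑ k, pd i (v k) x * pd k (v i) x + ∑ k, v k x * pd i (pd k (v i)) x) := by
    intro i
    rw [pd_sub (H.diff_h i x) (DifferentiableAt.fun_sum fun k _ => hd i k), pd_sum fun k _ => hd i k,
      ← Finset.sum_add_distrib]
    congr 1
    exact Finset.sum_congr rfl fun k _ => pd_mul (H.diff_v k x) (H.diff_dv i k x) i
  have h2 : ∑ i, ∑ k, v k x * pd i (pd k (v i)) x = 0 := by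
    rw [Finset.sum_comm]
    refine Finset.sum_eq_zero fun k _ => ?_
    rw [← Finset.mul_sum, H.sum_pd_pd_eq_zero, mul_zero]
  simp only [h1, Finset.sum_sub_distrib, Finset.sum_add_distrib, h2, add_zero]

/-- The equation satisfied by the head pressure:
`-Δθ + (v · ∇)θ = v · h - div h - (|∇v|² - ∂ᵢvₖ ∂ₖvᵢ)`. -/
lemma head_equation (H : IsFlow β v p h) (x : E n) :
    ∑ k, pd k (h k) x - lap (head v p) x + ∑ k, v k x * pd k (head v p) x =
      ∑ i, v i x * h i x - ∑ i, ∑ k, pd k (v i) x ^ 2 +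
        ∑ i, ∑ k, pd i (v k) x * pd k (v i) x := by
  have h1 : lap (head v p) x = ∑ i, ∑ k, pd k (v i) x ^ 2 + ∑ i, v i x * lap (v i) x + lap p x := by
    simp only [lap, H.pd_pd_head, Finset.sum_add_distrib, Finset.mul_sum]
    rw [Finset.sum_comm (f := fun k i => pd k (v i) x * pd k (v i) x),
      Finset.sum_comm (f := fun k i => v i x * pd k (pd k (v i)) x)]
    simp only [sq]
  have h2 : ∑ k, v k x * pd k (head v p) x =
      ∑ i, v i x * ∑ k, v k x * pd k (v i) x + ∑ i, v i x * pd i p x := by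
    simp only [H.pd_head, mul_add, Finset.sum_add_distrib, Finset.mul_sum]
    rw [Finset.sum_comm]
    congr 1
    exact Finset.sum_congr rfl fun i _ => Finset.sum_congr rfl fun k _ => by ring
  have h3 : ∑ i, v i x * h i x = -∑ i, v i x * lap (v i) x +
      ∑ i, v i x * ∑ k, v k x * pd k (v i) x + ∑ i, v i x * pd i p x := by
    simp only [← H.momentum, mul_add, mul_neg, Finset.sum_add_distrib, Finset.sum_neg_distrib]
  rw [h1, h2, h3, H.lap_pressure]
  ring

/-- The head pressure is a subsolution up to the force. -/
lemma head_equation_le (H : IsFlow β v p h) (x : E n) :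
    ∑ k, pd k (h k) x - lap (head v p) x + ∑ k, v k x * pd k (head v p) x ≤
      ∑ i, v i x * h i x := by
  rw [H.head_equation]
  have h1 : ∑ i, ∑ k, (pd k (v i) x - pd i (v k) x) ^ 2 =
      2 * (∑ i, ∑ k, pd k (v i) x ^ 2 - ∑ i, ∑ k, pd i (v k) x * pd k (v i) x) := by
    have h2 : ∑ i, ∑ k, pd i (v k) x ^ 2 = ∑ i, ∑ k, pd k (v i) x ^ 2 := Finset.sum_comm
    have h3 : ∀ i k, (pd k (v i) x - pd i (v k) x) ^ 2 =
        pd k (v i) x ^ 2 + pd i (v k) x ^ 2 - 2 * (pd i (v k) x * pd k (v i) x) := fun i k => by ring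
    simp only [h3, Finset.sum_sub_distrib, Finset.sum_add_distrib, ← Finset.mul_sum]
    rw [h2]; ring
  have h4 : 0 ≤ ∑ i, ∑ k, (pd k (v i) x - pd i (v k) x) ^ 2 :=
    Finset.sum_nonneg fun i _ => Finset.sum_nonneg fun k _ => sq_nonneg _
  linarith

/-- The estimate obtained by testing the equation of the head pressure `θ` with `θ₊^q`. -/
lemma head_estimate (H : IsFlow β v p h) (hβ : n < 2 * β) {q : ℝ} (hq : 1 < q) :
    q / 2 * ∫ x, max (head v p x) 0 ^ (q - 1) * ∑ k, pd k (head v p) x ^ 2 ≤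
      ∫ x, ((∑ i, v i x * h i x) * max (head v p x) 0 ^ q +
        q / 2 * (max (head v p x) 0 ^ (q - 1) * ∑ k, h k x ^ 2)) := by
  have hβ0 : 0 ≤ β := by have : (0 : ℝ) ≤ n := Nat.cast_nonneg n; linarith
  have hθ := H.smooth_head
  have hθd : Differentiable ℝ (head v p) := hθ.differentiable (by simp)
  set θ := head v p with hθdef
  have hdθ := H.decay_head hβ0
  have hdθ1 := H.decay_pd_head hβ0
  have hdθ2 := H.decay_pd_pd_head hβ0
  rw [← hθdef] at hdθ hdθ1 hdθ2
  have hpθ : ∀ k, Differentiable ℝ (pd k θ) := fun k =>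
    (contDiff_pd_infty hθ k).differentiable (by simp)
  have hη : ∀ {s : ℝ}, 1 < s → Differentiable ℝ (fun x => max (θ x) 0 ^ s) := fun hs =>
    ((contDiff_posPart_rpow hs).differentiable one_ne_zero).comp hθd
  have hηc : ∀ {s : ℝ}, 0 ≤ s → Continuous (fun x => max (θ x) 0 ^ s) := fun hs =>
    (hθ.continuous.max continuous_const).rpow_const fun x => Or.inr hs
  have hηq := hη hq
  have hηq1 : Differentiable ℝ (fun x => max (θ x) 0 ^ (q + 1)) := hη (by linarith)
  set Z : Fin n → E n → ℝ := fun k x => (h k x - pd k θ x) * max (θ x) 0 ^ q +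
    1 / (q + 1) * (v k x * max (θ x) 0 ^ (q + 1)) with hZ
  have hdZ : ∀ k x, pd k (Z k) x = (pd k (h k) x - pd k (pd k θ) x) * max (θ x) 0 ^ q +
      (h k x - pd k θ x) * (q * max (θ x) 0 ^ (q - 1) * pd k θ x) +
      1 / (q + 1) * (pd k (v k) x * max (θ x) 0 ^ (q + 1)) +
      v k x * (max (θ x) 0 ^ q * pd k θ x) := by
    intro k x
    have d1 := (H.diff_h k x).fun_sub (hpθ k x)
    rw [hZ, pd_add (d1.fun_mul (hηq x)) (((H.diff_v k x).fun_mul (hηq1 x)).const_mul _),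
      pd_mul d1 (hηq x), pd_sub (H.diff_h k x) (hpθ k x),
      pd_const_mul ((H.diff_v k x).fun_mul (hηq1 x)), pd_mul (H.diff_v k x) (hηq1 x),
      pd_posPart_rpow hq hθd, pd_posPart_rpow (by linarith : 1 < q + 1) hθd, add_sub_cancel_right]
    have hq1 : q + 1 ≠ 0 := by linarith
    field_simp
    ring
  have hZd : ∀ k, Differentiable ℝ (Z k) := fun k =>
    (((H.diff_h k).fun_sub (hpθ k)).fun_mul hηq).fun_add
      (((H.diff_v k).fun_mul hηq1).const_mul _)
  have cq := hηc (s := q) (by linarith)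
  have cq1 := hηc (s := q + 1) (by linarith)
  have cq2 := hηc (s := q - 1) (by linarith)
  have cv := fun i => (H.smooth_v i).continuous
  have ch := fun i => (H.smooth_h i).continuous
  have cdv := fun i j => (contDiff_pd_infty (H.smooth_v i) j).continuous
  have cdh := fun i j => (contDiff_pd_infty (H.smooth_h i) j).continuous
  have cθ := hθ.continuous
  have cdθ := fun k => (contDiff_pd_infty hθ k).continuous
  have cddθ := fun k => (contDiff_pd_infty (contDiff_pd_infty hθ k) k).continuous
  have hcont : ∀ k, Continuous (pd k (Z k)) := fun k => by
    rw [funext (hdZ k)]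
    fun_prop
  have h2 : ∀ {f g : E n → ℝ}, Decay β f → Decay β g → Decay (β + β) (fun x => f x * g x) :=
    fun hf hg => hf.mul hg
  have dq := hdθ.posPart_rpow hβ0 (s := q) hq.le
  have dq1 := hdθ.posPart_rpow hβ0 (s := q + 1) (by linarith)
  have dq2 := hdθ.posPart_rpow_bdd hβ0 (s := q - 1) (by linarith)
  have hint : ∀ k, Integrable (Z k) := fun k =>
    ((h2 ((H.decay_h k).sub (hdθ1 k)) dq).add ((h2 (H.decay_v k) dq1).const_mul _)).integrable
      (hZd k).continuous.aestronglyMeasurable (by linarith)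
  have hint' : ∀ k, Integrable (pd k (Z k)) := fun k => by
    refine Decay.integrable (β := β + β) ?_ (hcont k).aestronglyMeasurable (by linarith)
    rw [funext (hdZ k)]
    refine (((h2 ((H.decay_dh k k).sub (hdθ2 k k)) dq).add ?_).add
      ((h2 (H.decay_dv k k) dq1).const_mul _)).add
      (h2 (H.decay_v k) (dq.mul_left_bdd hβ0 (hdθ1 k)))
    exact h2 ((H.decay_h k).sub (hdθ1 k)) ((dq2.const_mul q).mul_left_bdd le_rfl (hdθ1 k))
  have hdiv := integral_sum_pd_eq_zero hZd hint hint'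
  have hpt : ∀ x, ∑ k, pd k (Z k) x ≤ ((∑ i, v i x * h i x) * max (θ x) 0 ^ q +
        q / 2 * (max (θ x) 0 ^ (q - 1) * ∑ k, h k x ^ 2)) -
        q / 2 * (max (θ x) 0 ^ (q - 1) * ∑ k, pd k θ x ^ 2) := by
    intro x
    have e1 : ∑ k, pd k (Z k) x = (∑ k, pd k (h k) x - lap θ x + ∑ k, v k x * pd k θ x) *
        max (θ x) 0 ^ q + q * (max (θ x) 0 ^ (q - 1) * ∑ k, (h k x - pd k θ x) * pd k θ x) +
        1 / (q + 1) * ((∑ k, pd k (v k) x) * max (θ x) 0 ^ (q + 1)) := by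
      simp only [hdZ, lap, add_mul, sub_mul, Finset.sum_mul, Finset.mul_sum,
        ← Finset.sum_add_distrib, ← Finset.sum_sub_distrib]
      exact Finset.sum_congr rfl fun k _ => by ring
    have e2 := H.head_equation_le x
    have p1 : 0 ≤ max (θ x) 0 ^ q := Real.rpow_nonneg (le_max_right _ _) _
    have p2 : 0 ≤ max (θ x) 0 ^ (q - 1) := Real.rpow_nonneg (le_max_right _ _) _
    have e3 : ∑ k, (h k x - pd k θ x) * pd k θ x ≤ ∑ k, h k x ^ 2 / 2 - ∑ k, pd k θ x ^ 2 / 2 := by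
      rw [← Finset.sum_sub_distrib]
      refine Finset.sum_le_sum fun k _ => ?_
      nlinarith [sq_nonneg (h k x - pd k θ x)]
    rw [e1, H.div_free, zero_mul, mul_zero, add_zero]
    have e4 := mul_le_mul_of_nonneg_right e2 p1
    have e5 := mul_le_mul_of_nonneg_left (mul_le_mul_of_nonneg_left e3 p2) (by linarith : 0 ≤ q)
    rw [← Finset.sum_div, ← Finset.sum_div] at e5
    calc _ ≤ _ := add_le_add e4 e5
      _ = _ := by ring
  have i1 : Integrable fun x => ((∑ i, v i x * h i x) * max (θ x) 0 ^ q +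
        q / 2 * (max (θ x) 0 ^ (q - 1) * ∑ k, h k x ^ 2)) := by
    refine Decay.integrable (β := β + β) ?_ (Continuous.aestronglyMeasurable (by fun_prop))
      (by linarith)
    refine ((Decay.sum fun i _ => h2 (H.decay_v i) (H.decay_h i)).mul dq |>.mono
      (by linarith)).add ((dq2.mul_left_bdd le_rfl (Decay.sum fun k _ => ?_)).const_mul _)
    simpa [sq] using h2 (H.decay_h k) (H.decay_h k)
  have i2 : Integrable fun x => q / 2 * (max (θ x) 0 ^ (q - 1) * ∑ k, pd k θ x ^ 2) := by
    refine Decay.integrable (β := β + β) ?_ (Continuous.aestronglyMeasurable (by fun_prop))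
      (by linarith)
    refine ((dq2.mul_left_bdd le_rfl (Decay.sum fun k _ => ?_)).const_mul _)
    simpa [sq] using h2 (hdθ1 k) (hdθ1 k)
  have h3 := integral_mono (integrable_finsetSum _ fun k _ => hint' k) (i1.sub i2) hpt
  rw [hdiv] at h3
  simp only [Pi.sub_apply] at h3
  rw [integral_sub i1 i2, integral_const_mul] at h3
  linarith

end IsFlow

end Flow

/-! ### The weighted pressure identity -/

section Weight
variable {n : ℕ} {e : ℝ}

lemma decay_sq_norm_rpow (he : 0 < e) {m : ℝ} (hm : 0 ≤ m) (x₀ : E n) :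
    Decay (2 * m) (fun x : E n => (‖x - x₀‖ ^ 2 + e) ^ (-m)) := by
  set c : ℝ := (1 + ‖x₀‖) / √e + 1 with hc
  have hse : 0 < √e := Real.sqrt_pos.2 he
  have hc0 : 0 < c := by positivity
  refine decay_of_abs_le (C := c ^ (2 * m)) fun x => ?_
  have hs : 0 < ‖x - x₀‖ ^ 2 + e := by positivity
  set r := √(‖x - x₀‖ ^ 2 + e) with hr
  have hr0 : 0 < r := Real.sqrt_pos.2 hs
  have hr1 : √e ≤ r := Real.sqrt_le_sqrt (by nlinarith [norm_nonneg (x - x₀)])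
  have hr2 : ‖x - x₀‖ ≤ r := Real.le_sqrt_of_sq_le (by linarith)
  have h1 : 1 + ‖x‖ ≤ c * r := by
    have h2 : ‖x‖ ≤ ‖x - x₀‖ + ‖x₀‖ := by simpa using norm_add_le (x - x₀) x₀
    have h3 : 1 + ‖x₀‖ ≤ (1 + ‖x₀‖) / √e * r := by
      rw [div_mul_eq_mul_div, le_div_iff₀ hse]
      gcongr
    rw [hc]; linarith
  have h4 : (‖x - x₀‖ ^ 2 + e) ^ (-m) = r ^ (-(2 * m)) := by
    rw [← Real.sq_sqrt hs.le, ← hr, ← Real.rpow_two, ← Real.rpow_mul hr0.le]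
    congr 1; ring
  rw [h4, abs_of_pos (by positivity)]
  calc r ^ (-(2 * m)) = c ^ (2 * m) * (c * r) ^ (-(2 * m)) := by
        rw [Real.mul_rpow hc0.le hr0.le, ← mul_assoc, ← Real.rpow_add hc0]
        simp
    _ ≤ c ^ (2 * m) * (1 + ‖x‖) ^ (-(2 * m)) := by
        gcongr c ^ (2 * m) * ?_
        exact Real.rpow_le_rpow_of_nonpos (by positivity) h1 (by linarith)

lemma abs_coord_sub_le (x x₀ : E n) (i : Fin n) : |x i - x₀ i| ≤ ‖x - x₀‖ := by
  simpa using abs_apply_le (x - x₀) i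

lemma abs_coord_mul_rpow_le (he : 0 < e) (m : ℝ) (x₀ : E n) (i : Fin n) (x : E n) :
    |(x i - x₀ i) * (‖x - x₀‖ ^ 2 + e) ^ (-m)| ≤ (‖x - x₀‖ ^ 2 + e) ^ (-(m - 1 / 2)) := by
  have hs : 0 < ‖x - x₀‖ ^ 2 + e := by positivity
  rw [abs_mul, abs_of_pos (Real.rpow_pos_of_pos hs _),
    show -(m - 1 / 2) = 1 / 2 + -m by ring, Real.rpow_add hs, ← Real.sqrt_eq_rpow]
  gcongr
  exact (abs_coord_sub_le x x₀ i).trans (Real.le_sqrt_of_sq_le (by linarith))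

lemma decay_coord_mul_rpow (he : 0 < e) {m : ℝ} (hm : 1 / 2 ≤ m) (x₀ : E n) (i : Fin n) :
    Decay (2 * m - 1) (fun x : E n => (x i - x₀ i) * (‖x - x₀‖ ^ 2 + e) ^ (-m)) := by
  have h := decay_sq_norm_rpow he (m := m - 1 / 2) (by linarith) x₀
  rw [show 2 * (m - 1 / 2) = 2 * m - 1 by ring] at h
  refine h.of_le fun x => ?_
  rw [Real.norm_eq_abs, Real.norm_of_nonneg (by positivity)]
  exact abs_coord_mul_rpow_le he m x₀ i x

lemma decay_coord_mul_coord_mul_rpow (he : 0 < e) {m : ℝ} (hm : 1 ≤ m) (x₀ : E n) (i k : Fin n) :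
    Decay (2 * m - 2)
      (fun x : E n => (x k - x₀ k) * ((x i - x₀ i) * (‖x - x₀‖ ^ 2 + e) ^ (-m))) := by
  have h := decay_sq_norm_rpow he (m := m - 1) (by linarith) x₀
  rw [show 2 * (m - 1) = 2 * m - 2 by ring] at h
  refine h.of_le fun x => ?_
  have hs : 0 < ‖x - x₀‖ ^ 2 + e := by positivity
  rw [Real.norm_eq_abs, Real.norm_of_nonneg (by positivity), abs_mul]
  have h1 := abs_coord_mul_rpow_le he m x₀ i x
  have h2 : |x k - x₀ k| ≤ (‖x - x₀‖ ^ 2 + e) ^ ((1 : ℝ) / 2) := by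
    rw [← Real.sqrt_eq_rpow]
    exact (abs_coord_sub_le x x₀ k).trans (Real.le_sqrt_of_sq_le (by linarith))
  calc _ ≤ (‖x - x₀‖ ^ 2 + e) ^ ((1 : ℝ) / 2) * (‖x - x₀‖ ^ 2 + e) ^ (-(m - 1 / 2)) := by gcongr
    _ = _ := by rw [← Real.rpow_add hs]; congr 1; ring

lemma differentiable_coord_sub (x₀ : E n) (i : Fin n) :
    Differentiable ℝ (fun x : E n => x i - x₀ i) := by
  have : Differentiable ℝ (fun x : E n => x i) := (EuclideanSpace.proj i : E n →L[ℝ] ℝ).differentiable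
  exact this.sub_const _

lemma sum_coord_sub_sq (x x₀ : E n) : ∑ i, (x i - x₀ i) ^ 2 = ‖x - x₀‖ ^ 2 := by
  rw [EuclideanSpace.norm_sq_eq]
  simp

lemma pd_weight (he : 0 < e) (a : ℝ) (x₀ : E n) (i : Fin n) :
    pd i (fun x : E n => (‖x - x₀‖ ^ 2 + e) ^ (-(a / 2))) =
      fun x => -a * ((x i - x₀ i) * (‖x - x₀‖ ^ 2 + e) ^ (-(a / 2 + 1))) := by
  ext x
  rw [pd_sq_norm_rpow he, show -(a / 2 + 1) = -(a / 2) - 1 by ring]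
  ring

lemma pd_pd_weight (he : 0 < e) (a : ℝ) (x₀ : E n) (i k : Fin n) (x : E n) :
    pd k (pd i (fun x : E n => (‖x - x₀‖ ^ 2 + e) ^ (-(a / 2)))) x =
      -a * ((if k = i then 1 else 0) * (‖x - x₀‖ ^ 2 + e) ^ (-(a / 2 + 1))) +
      a * (a + 2) * ((x k - x₀ k) * ((x i - x₀ i) * (‖x - x₀‖ ^ 2 + e) ^ (-(a / 2 + 2)))) := by
  have h1 : DifferentiableAt ℝ (fun x : E n => (‖x - x₀‖ ^ 2 + e) ^ (-(a / 2 + 1))) x :=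
    (contDiff_sq_norm_rpow he _ x₀).differentiable (by simp) x
  have h2 := differentiable_coord_sub x₀ i x
  have h3 : pd k (fun x : E n => x i - x₀ i) x = if k = i then 1 else 0 := by
    have h4 : DifferentiableAt ℝ (fun x : E n => x i) x :=
      (EuclideanSpace.proj i : E n →L[ℝ] ℝ).differentiableAt
    rw [pd_sub h4 (differentiableAt_const _), pd_coord]
    simp [pd]
  rw [pd_weight he, pd_const_mul (h2.fun_mul h1), pd_mul h2 h1, h3, pd_sq_norm_rpow he,
    show -(a / 2 + 2) = -(a / 2 + 1) - 1 by ring]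
  ring

end Weight

section Flow
variable {n : ℕ} {β : ℝ} {v : Fin n → E n → ℝ} {p : E n → ℝ} {h : Fin n → E n → ℝ}

namespace IsFlow

/-- Testing the pressure equation with `(|x - x₀|² + e)^(-a/2)` bounds a weighted norm of `v` by
the positive part of the head pressure. The gain over general pressure estimates is that the
radial part of `v` enters with a favourable sign. -/
lemma weighted_estimate (H : IsFlow β v p h) (hβ : n < 2 * β) {a e : ℝ} (ha : 0 < a)
    (han : a + 2 ≤ n) (hβa : n < β + a) (he : 0 < e) (x₀ : E n) :
    (n - a - 4) / 2 * ∫ x, (∑ i, v i x ^ 2) * (‖x - x₀‖ ^ 2 + e) ^ (-(a / 2 + 1)) ≤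
      ∫ x, (n * (max (head v p x) 0 * (‖x - x₀‖ ^ 2 + e) ^ (-(a / 2 + 1))) +
        |∑ i, h i x * (x i - x₀ i)| * (‖x - x₀‖ ^ 2 + e) ^ (-(a / 2 + 1))) := by
  have hβ0 : 0 ≤ β := by have : (0 : ℝ) ≤ n := Nat.cast_nonneg n; linarith
  set ψ : E n → ℝ := fun x => (‖x - x₀‖ ^ 2 + e) ^ (-(a / 2)) with hψ
  set w : E n → ℝ := fun x => (‖x - x₀‖ ^ 2 + e) ^ (-(a / 2 + 1)) with hw
  set w' : E n → ℝ := fun x => (‖x - x₀‖ ^ 2 + e) ^ (-(a / 2 + 2)) with hw'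
  have sψ : ContDiff ℝ ∞ ψ := contDiff_sq_norm_rpow he _ x₀
  have sw : ContDiff ℝ ∞ w := contDiff_sq_norm_rpow he _ x₀
  have sw' : ContDiff ℝ ∞ w' := contDiff_sq_norm_rpow he _ x₀
  have dψ : Differentiable ℝ ψ := sψ.differentiable (by simp)
  have ddψ : ∀ i, Differentiable ℝ (pd i ψ) := fun i =>
    (contDiff_pd_infty sψ i).differentiable (by simp)
  have hp1 : ∀ i x, pd i ψ x = -a * ((x i - x₀ i) * w x) := fun i x =>
    congrFun (pd_weight he a x₀ i) x
  have hp2 : ∀ i k x, pd k (pd i ψ) x = -a * ((if k = i then 1 else 0) * w x) +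
      a * (a + 2) * ((x k - x₀ k) * ((x i - x₀ i) * w' x)) := fun i k x => pd_pd_weight he a x₀ i k x
  have eψ : Decay a ψ := (decay_sq_norm_rpow he (m := a / 2) (by linarith) x₀).mono (by linarith)
  have ew : Decay (a + 2) w := (decay_sq_norm_rpow he (m := a / 2 + 1) (by linarith) x₀).mono
    (by linarith)
  have edψ : ∀ i, Decay a (pd i ψ) := fun i => by
    rw [funext (hp1 i)]
    exact ((decay_coord_mul_rpow he (m := a / 2 + 1) (by linarith) x₀ i).const_mul _).mono
      (by linarith)
  have eddψ : ∀ i k, Decay a (pd k (pd i ψ)) := fun i k => by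
    rw [funext (hp2 i k)]
    exact ((((decay_zero_of_bounded (C := 1) (fun x => by split_ifs <;> simp)).mul ew).const_mul
      _).mono (by linarith)).add (((decay_coord_mul_coord_mul_rpow he (m := a / 2 + 2) (by linarith)
      x₀ i k).const_mul _).mono (by linarith))
  set G : Fin n → E n → ℝ := fun k x => h k x - ∑ l, v l x * pd l (v k) x with hG
  have dG : ∀ k, Differentiable ℝ (G k) := fun k => (H.diff_h k).fun_sub
    (Differentiable.fun_sum fun l _ => (H.diff_v l).fun_mul (H.diff_dv k l))
  have hpG : ∀ k x, pd k (G k) x = pd k (h k) x -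
      ∑ l, (pd k (v l) x * pd l (v k) x + v l x * pd k (pd l (v k)) x) := by
    intro k x
    have hd := fun l => (H.diff_v l x).fun_mul (H.diff_dv k l x)
    rw [hG, pd_sub (H.diff_h k x) (DifferentiableAt.fun_sum fun l _ => hd l),
      pd_sum fun l _ => hd l]
    congr 1
    exact Finset.sum_congr rfl fun l _ => pd_mul (H.diff_v l x) (H.diff_dv k l x) k
  have eG : ∀ k, Decay β (G k) := fun k => (H.decay_h k).sub
    (Decay.sum fun l _ => (H.decay_v l).mul_left_bdd hβ0 (H.decay_dv k l))
  have edG : ∀ k, Decay β (pd k (G k)) := fun k => by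
    rw [funext (hpG k)]
    exact (H.decay_dh k k).sub (Decay.sum fun l _ =>
      ((H.decay_dv l k).mul_left_bdd hβ0 (H.decay_dv k l)).add
      ((H.decay_v l).mul_left_bdd hβ0 (H.decay_ddv k l k)))
  have dQ : Differentiable ℝ fun x => ∑ i, v i x * pd i ψ x :=
    Differentiable.fun_sum fun i _ => (H.diff_v i).fun_mul (ddψ i)
  have hpQ : ∀ k x, pd k (fun x => ∑ i, v i x * pd i ψ x) x =
      ∑ i, (pd k (v i) x * pd i ψ x + v i x * pd k (pd i ψ) x) := by
    intro k x
    rw [pd_sum fun i _ => (H.diff_v i x).fun_mul (ddψ i x)]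
    exact Finset.sum_congr rfl fun i _ => pd_mul (H.diff_v i x) (ddψ i x) k
  -- The first three terms are Green's identity for `Δp = div G`; in the last, `(v · ∇) v` of `G` has been
  -- integrated by parts once more onto `ψ`.
  set Z : Fin n → E n → ℝ := fun k x => p x * pd k ψ x - ψ x * pd k p x + ψ x * G k x +
    v k x * ∑ i, v i x * pd i ψ x with hZ
  have hdZ : ∀ k x, pd k (Z k) x = (pd k p x * pd k ψ x + p x * pd k (pd k ψ) x) -
      (pd k ψ x * pd k p x + ψ x * pd k (pd k p) x) + (pd k ψ x * G k x + ψ x * pd k (G k) x) +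
      (pd k (v k) x * ∑ i, v i x * pd i ψ x +
        v k x * ∑ i, (pd k (v i) x * pd i ψ x + v i x * pd k (pd i ψ) x)) := by
    intro k x
    have d1 := (H.diff_p x).fun_mul (ddψ k x)
    have d2 := (dψ x).fun_mul (H.diff_dp k x)
    have d3 := (dψ x).fun_mul (dG k x)
    have d4 := (H.diff_v k x).fun_mul (dQ x)
    rw [hZ, pd_add ((d1.fun_sub d2).fun_add d3) d4, pd_add (d1.fun_sub d2) d3, pd_sub d1 d2,
      pd_mul (H.diff_p x) (ddψ k x), pd_mul (dψ x) (H.diff_dp k x), pd_mul (dψ x) (dG k x),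
      pd_mul (H.diff_v k x) (dQ x), hpQ]
  have hZd : ∀ k, Differentiable ℝ (Z k) := fun k =>
    ((((H.diff_p).fun_mul (ddψ k)).fun_sub (dψ.fun_mul (H.diff_dp k))).fun_add
      (dψ.fun_mul (dG k))).fun_add ((H.diff_v k).fun_mul dQ)
  have cv := fun i => (H.smooth_v i).continuous
  have ch := fun i => (H.smooth_h i).continuous
  have cdv := fun i j => (contDiff_pd_infty (H.smooth_v i) j).continuous
  have cddv := fun i j l => (contDiff_pd_infty (contDiff_pd_infty (H.smooth_v i) j) l).continuous
  have cdh := fun i j => (contDiff_pd_infty (H.smooth_h i) j).continuous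
  have cp := H.smooth_p.continuous
  have cdp := fun i => (contDiff_pd_infty H.smooth_p i).continuous
  have cddp := fun i j => (contDiff_pd_infty (contDiff_pd_infty H.smooth_p i) j).continuous
  have cψ := sψ.continuous
  have cdψ := fun i => (contDiff_pd_infty sψ i).continuous
  have cddψ := fun i j => (contDiff_pd_infty (contDiff_pd_infty sψ i) j).continuous
  have cw := sw.continuous
  have cG := fun k => (dG k).continuous
  have cdG : ∀ k, Continuous (pd k (G k)) := fun k => by
    rw [funext (hpG k)]; fun_prop
  have hcont : ∀ k, Continuous (pd k (Z k)) := fun k => by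
    rw [funext (hdZ k)]
    fun_prop
  set γ := min (β + a) (2 * β) with hγ
  have hγn : n < γ := lt_min hβa hβ
  have m1 : ∀ {f g : E n → ℝ}, Decay β f → Decay a g → Decay γ (fun x => f x * g x) :=
    fun hf hg => (hf.mul hg).mono (min_le_left _ _)
  have m2 : ∀ {f g : E n → ℝ}, Decay a f → Decay β g → Decay γ (fun x => f x * g x) :=
    fun hf hg => (hf.mul hg).mono (by rw [add_comm]; exact min_le_left _ _)
  have eQ : Decay a fun x => ∑ i, v i x * pd i ψ x :=
    Decay.sum fun i _ => (H.decay_v i).mul_left_bdd hβ0 (edψ i)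
  have hint : ∀ k, Integrable (Z k) := fun k =>
    ((((m1 H.decay_p (edψ k)).sub (m2 eψ (H.decay_dp k))).add (m2 eψ (eG k))).add
      (m1 (H.decay_v k) eQ)).integrable (hZd k).continuous.aestronglyMeasurable hγn
  have hint' : ∀ k, Integrable (pd k (Z k)) := fun k => by
    refine Decay.integrable (β := γ) ?_ (hcont k).aestronglyMeasurable hγn
    rw [funext (hdZ k)]
    exact ((((m1 (H.decay_dp k) (edψ k)).add (m1 H.decay_p (eddψ k k))).sub
      ((m2 (edψ k) (H.decay_dp k)).add (m2 eψ (H.decay_ddp k k)))).add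
      ((m2 (edψ k) (eG k)).add (m2 eψ (edG k)))).add
      ((m1 (H.decay_dv k k) eQ).add (m1 (H.decay_v k) (Decay.sum fun i _ =>
        ((H.decay_dv i k).mul_left_bdd hβ0 (edψ i)).add
        ((H.decay_v i).mul_left_bdd hβ0 (eddψ i k)))))
  have hdiv := integral_sum_pd_eq_zero hZd hint hint'
  -- The divergence of `Z`, divided by `-a`.
  have hX : ∀ x, ∑ k, pd k (Z k) x = -a * (p x * ((n - a - 2) * w x + (a + 2) * (e * w' x)) +
      (∑ i, v i x ^ 2) * w x - (a + 2) * ((∑ i, v i x * (x i - x₀ i)) ^ 2 * w' x) +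
      (∑ i, h i x * (x i - x₀ i)) * w x) := by
    intro x
    have hs : 0 < ‖x - x₀‖ ^ 2 + e := by positivity
    have e1 : ∑ k, pd k (Z k) x = p x * lap ψ x - ψ x * (lap p x - ∑ k, pd k (G k) x) +
        ∑ k, pd k ψ x * G k x + (∑ k, pd k (v k) x) * (∑ i, v i x * pd i ψ x) +
        (∑ k, ∑ i, v k x * (pd k (v i) x * pd i ψ x) +
          ∑ k, ∑ i, v k x * (v i x * pd k (pd i ψ) x)) := by
      simp only [hdZ]
      generalize ∑ i, v i x * pd i ψ x = Q
      simp only [lap, Finset.sum_mul, Finset.mul_sum, mul_sub,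
        ← Finset.sum_add_distrib, ← Finset.sum_sub_distrib]
      refine Finset.sum_congr rfl fun k _ => ?_
      simp only [mul_add, Finset.sum_add_distrib]
      ring
    have e2 : lap p x - ∑ k, pd k (G k) x = 0 := sub_eq_zero.2 (H.pressure x)
    have e3 : ∑ k, pd k ψ x * G k x + ∑ k, ∑ i, v k x * (pd k (v i) x * pd i ψ x) =
        ∑ k, pd k ψ x * h k x := by
      rw [Finset.sum_comm, ← Finset.sum_add_distrib]
      refine Finset.sum_congr rfl fun k _ => ?_
      rw [hG, mul_sub, Finset.mul_sum, sub_add, sub_eq_self, sub_eq_zero]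
      exact Finset.sum_congr rfl fun l _ => by ring
    have ew1 : w x = (‖x - x₀‖ ^ 2 + e) * w' x := by
      simp only [hw, hw']
      rw [show -(a / 2 + 1) = 1 + -(a / 2 + 2) by ring, Real.rpow_add hs, Real.rpow_one]
    have e4 : lap ψ x = -a * ((n - a - 2) * w x + (a + 2) * (e * w' x)) := by
      simp only [lap, hp2, if_true, Finset.sum_add_distrib, ← Finset.mul_sum]
      have : ∑ i, (x i - x₀ i) * ((x i - x₀ i) * w' x) = ‖x - x₀‖ ^ 2 * w' x := by
        rw [← sum_coord_sub_sq, Finset.sum_mul]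
        exact Finset.sum_congr rfl fun i _ => by ring
      rw [this]
      simp only [one_mul, Finset.sum_const, Finset.card_univ, Fintype.card_fin, nsmul_eq_mul]
      rw [ew1]; ring
    have e5 : ∑ k, ∑ i, v k x * (v i x * pd k (pd i ψ) x) =
        -a * ((∑ i, v i x ^ 2) * w x) +
          a * (a + 2) * ((∑ i, v i x * (x i - x₀ i)) ^ 2 * w' x) := by
      have f1 : ∑ k, ∑ i, v k x * (v i x * (-a * ((if k = i then 1 else 0) * w x))) =
          -a * ((∑ i, v i x ^ 2) * w x) := by
        rw [Finset.sum_mul, Finset.mul_sum]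
        refine Finset.sum_congr rfl fun k _ => ?_
        rw [Finset.sum_eq_single k]
        · simp; ring
        · intro i _ hik
          simp [hik.symm]
        · simp
      have f2 : ∑ k, ∑ i, v k x * (v i x *
          (a * (a + 2) * ((x k - x₀ k) * ((x i - x₀ i) * w' x)))) =
          a * (a + 2) * ((∑ i, v i x * (x i - x₀ i)) ^ 2 * w' x) := by
        rw [sq, Finset.sum_mul_sum, Finset.sum_mul, Finset.mul_sum]
        refine Finset.sum_congr rfl fun k _ => ?_
        rw [Finset.sum_mul, Finset.mul_sum]
        exact Finset.sum_congr rfl fun i _ => by ring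
      rw [← f1, ← f2, ← Finset.sum_add_distrib]
      refine Finset.sum_congr rfl fun k _ => ?_
      rw [← Finset.sum_add_distrib]
      refine Finset.sum_congr rfl fun i _ => ?_
      rw [hp2]; ring
    have e6 : ∑ k, pd k ψ x * h k x = -a * ((∑ i, h i x * (x i - x₀ i)) * w x) := by
      rw [Finset.sum_mul, Finset.mul_sum]
      refine Finset.sum_congr rfl fun k _ => ?_
      rw [hp1]; ring
    rw [e1, e2, H.div_free, e5, e4, mul_zero, zero_mul, sub_zero, add_zero]
    have e7 := e3
    rw [e6] at e7
    linear_combination e7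
  have hpt : ∀ x, (n - a - 4) / 2 * ((∑ i, v i x ^ 2) * w x) -
      (n * (max (head v p x) 0 * w x) + |∑ i, h i x * (x i - x₀ i)| * w x) ≤
      a⁻¹ * ∑ k, pd k (Z k) x := by
    intro x
    have hs : 0 < ‖x - x₀‖ ^ 2 + e := by positivity
    have w0 : 0 < w x := Real.rpow_pos_of_pos hs _
    have w0' : 0 < w' x := Real.rpow_pos_of_pos hs _
    have hew : e * w' x ≤ w x := by
      have : w x = (‖x - x₀‖ ^ 2 + e) * w' x := by
        simp only [hw, hw']
        rw [show -(a / 2 + 1) = 1 + -(a / 2 + 2) by ring, Real.rpow_add hs, Real.rpow_one]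
      rw [this]
      have : 0 ≤ ‖x - x₀‖ ^ 2 := by positivity
      nlinarith
    have hcancel : ∀ Y, a⁻¹ * (-a * Y) = -Y := fun Y => by field_simp
    rw [hX, hcancel]
    have hpθ : p x = head v p x - (∑ i, v i x ^ 2) / 2 := by rw [head]; ring
    set V := ∑ i, v i x ^ 2
    have hV : 0 ≤ V := Finset.sum_nonneg fun i _ => sq_nonneg _
    set B := (n - a - 2) * w x + (a + 2) * (e * w' x) with hB
    have hew0 : 0 ≤ e * w' x := by positivity
    have hB0 : 0 ≤ B := add_nonneg (mul_nonneg (by linarith) w0.le) (by positivity)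
    have hB1 : B ≤ n * w x := by rw [hB]; nlinarith
    have t1 : head v p x * B ≤ max (head v p x) 0 * (n * w x) :=
      (mul_le_mul_of_nonneg_right (le_max_left _ _) hB0).trans
        (mul_le_mul_of_nonneg_left hB1 (le_max_right _ _))
    have t2 : (∑ i, h i x * (x i - x₀ i)) * w x ≤ |∑ i, h i x * (x i - x₀ i)| * w x :=
      mul_le_mul_of_nonneg_right (le_abs_self _) w0.le
    have t3 : 0 ≤ (a + 2) * ((∑ i, v i x * (x i - x₀ i)) ^ 2 * w' x) := by positivity
    have t4 : (n - a - 2) * w x * V ≤ B * V := by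
      refine mul_le_mul_of_nonneg_right ?_ hV
      rw [hB]; linarith [mul_nonneg (by linarith : 0 ≤ a + 2) hew0]
    rw [hpθ]
    nlinarith
  have i1 : Integrable fun x => (n - a - 4) / 2 * ((∑ i, v i x ^ 2) * w x) := by
    refine Decay.integrable (β := γ) ?_ (Continuous.aestronglyMeasurable (by fun_prop)) hγn
    refine (m1 (Decay.sum fun i _ => ?_) (ew.mono (by linarith))).const_mul _
    simpa [sq] using (H.decay_v i).mul_left_bdd hβ0 (H.decay_v i)
  have i2 : Integrable fun x =>
      (n * (max (head v p x) 0 * w x) + |∑ i, h i x * (x i - x₀ i)| * w x) := by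
    have cθ := H.smooth_head.continuous
    refine Decay.integrable (β := γ) ?_ (Continuous.aestronglyMeasurable (by fun_prop)) hγn
    have hθ1 : Decay β fun x => max (head v p x) 0 := by
      simpa using (H.decay_head hβ0).posPart_rpow hβ0 le_rfl
    refine ((m1 hθ1 (ew.mono (by linarith))).const_mul _).add ?_
    have : Decay γ fun x => ∑ i, h i x * ((x i - x₀ i) * w x) := Decay.sum fun i _ =>
      m1 (H.decay_h i) ((decay_coord_mul_rpow he (m := a / 2 + 1) (by linarith) x₀ i).mono
        (by linarith))
    refine this.of_le fun x => le_of_eq ?_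
    have hw0 : 0 ≤ w x := Real.rpow_nonneg (by positivity) _
    simp_rw [← mul_assoc, ← Finset.sum_mul]
    rw [norm_mul, norm_mul, Real.norm_eq_abs, Real.norm_eq_abs, Real.norm_eq_abs, abs_abs]
  have h3 := integral_mono (i1.sub i2) ((integrable_finsetSum _ fun k _ => hint' k).const_mul a⁻¹) hpt
  simp only [Pi.sub_apply] at h3
  rw [integral_const_mul, hdiv, mul_zero, integral_sub i1 i2, integral_const_mul] at h3
  linarith

end IsFlow

end Flow

/-! ### Sobolev and potential estimates for decaying functions -/

section Sobolev
variable {n : ℕ}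

/-- Cutoff functions equal to one on large balls, with gradients tending to zero uniformly. -/
lemma exists_cutoff (n : ℕ) : ∃ C : ℝ, 0 ≤ C ∧ ∀ k : ℕ, ∃ χ : E n → ℝ, ContDiff ℝ 1 χ ∧
    HasCompactSupport χ ∧ (∀ x, ‖x‖ ≤ k + 1 → χ x = 1) ∧ (∀ x, ‖χ x‖ ≤ 1) ∧
    ∀ x, ‖fderiv ℝ χ x‖ ≤ C / (k + 1) := by
  let b : ContDiffBump (0 : E n) := ⟨1, 2, one_pos, one_lt_two⟩
  have hb : ContDiff ℝ 1 b := b.contDiff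
  obtain ⟨C, hC⟩ := (b.hasCompactSupport.fderiv (𝕜 := ℝ)).exists_bound_of_continuous
    (hb.continuous_fderiv one_ne_zero)
  refine ⟨C, (norm_nonneg _).trans (hC 0), fun k => ?_⟩
  have hk : (0 : ℝ) < (k : ℝ) + 1 := by positivity
  have hk' : ‖((k : ℝ) + 1)⁻¹‖ = ((k : ℝ) + 1)⁻¹ := by
    rw [Real.norm_eq_abs, abs_of_pos (by positivity)]
  refine ⟨fun x => b (((k : ℝ) + 1)⁻¹ • x), by fun_prop, ?_, fun x hx => ?_, fun x => ?_, fun x => ?_⟩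
  · exact b.hasCompactSupport.comp_homeomorph (Homeomorph.smulOfNeZero _ (inv_ne_zero hk.ne'))
  · refine b.one_of_mem_closedBall ?_
    rw [mem_closedBall_zero_iff, norm_smul, hk', inv_mul_le_iff₀ hk]
    simpa [b] using hx
  · rw [Real.norm_eq_abs, abs_of_nonneg b.nonneg]
    exact b.le_one
  · rw [fderiv_comp_smul, norm_smul, hk', div_eq_inv_mul]
    gcongr
    exact hC _

/-- The Sobolev inequality for square-integrable functions without compact support. -/
lemma exists_sobolev (F : Type*) [NormedAddCommGroup F] [NormedSpace ℝ F] [FiniteDimensional ℝ F]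
    (hn : 3 ≤ n) : ∃ C : ℝ≥0∞, C < ⊤ ∧ ∀ g : E n → F, ContDiff ℝ 1 g → MemLp g 2 →
    (∫⁻ x, ‖g x‖ₑ ^ (2 * n / (n - 2) : ℝ)) ^ ((n - 2) / n : ℝ) ≤
      C * ∫⁻ x, ‖fderiv ℝ g x‖ₑ ^ (2 : ℝ) := by
  have hn3 : (3 : ℝ) ≤ n := by exact_mod_cast hn
  have hp0 : 0 < (2 * n / (n - 2) : ℝ) := div_pos (by linarith) (by linarith)
  set p' : NNReal := ⟨2 * n / (n - 2), hp0.le⟩ with hp'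
  have hp'c : (p' : ℝ) = 2 * n / (n - 2) := rfl
  set S : ℝ≥0∞ := ((SNormLESNormFDerivOfEqConst F (volume : Measure (E n)) ((2 : NNReal) : ℝ) : NNReal) : ℝ≥0∞)
  obtain ⟨C, hC0, hχ⟩ := exists_cutoff n
  choose χ h1 h2 h3 h4 h5 using hχ
  refine ⟨S ^ 2, by simp [S], fun g hg hg2 => ?_⟩
  have main : eLpNorm g p' volume ≤ S * eLpNorm (fderiv ℝ g) 2 volume := by
    have hb : ∀ k : ℕ, eLpNorm (fun x => χ k x • g x) p' volume ≤
        S * (eLpNorm (fderiv ℝ g) 2 volume +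
          ENNReal.ofReal (C / (k + 1)) * eLpNorm g 2 volume) := by
      intro k
      have hgk : ContDiff ℝ 1 fun x => χ k x • g x := (h1 k).smul hg
      refine (eLpNorm_le_eLpNorm_fderiv_of_eq volume hgk (h2 k).smul_right (p := 2) (p' := p')
        (by norm_num) (by simp; omega) ?_).trans ?_
      · rw [hp'c]
        simp only [finrank_euclideanSpace, Fintype.card_fin, NNReal.coe_inv, NNReal.coe_ofNat]
        have : (n : ℝ) - 2 ≠ 0 := by linarith
        field_simp
      · gcongr
        have h6 : eLpNorm (fderiv ℝ fun x => χ k x • g x) 2 volume ≤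
            eLpNorm (fun x => ‖fderiv ℝ g x‖ + (C / (k + 1)) * ‖g x‖) 2 volume := by
          refine eLpNorm_mono_real fun x => ?_
          rw [fderiv_fun_smul ((h1 k).differentiable one_ne_zero x)
            (hg.differentiable one_ne_zero x)]
          refine (norm_add_le _ _).trans (add_le_add ?_ ?_)
          · rw [norm_smul]
            exact mul_le_of_le_one_left (norm_nonneg _) (h4 k x)
          · refine (ContinuousLinearMap.norm_smulRight_apply _ _).le.trans ?_
            gcongr
            exact h5 k x
        refine h6.trans ((eLpNorm_add_le (f := fun x => ‖fderiv ℝ g x‖)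
          (g := fun x => C / (k + 1) * ‖g x‖) ?_ ?_ (by norm_num)).trans ?_)
        · exact (hg.continuous_fderiv one_ne_zero).norm.aestronglyMeasurable
        · exact (hg.continuous.norm.const_mul _).aestronglyMeasurable
        · have h7 : eLpNorm (fun x => C / ((k : ℝ) + 1) * ‖g x‖) 2 volume =
              ENNReal.ofReal (C / (k + 1)) * eLpNorm g 2 volume := by
            have := eLpNorm_const_smul (C / ((k : ℝ) + 1)) (fun x => ‖g x‖) 2 (volume : Measure (E n))
            rw [eLpNorm_norm, Real.enorm_eq_ofReal (by positivity)] at this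
            exact this
          rw [h7, eLpNorm_norm]
    have hlim : ∀ᵐ x : E n, Tendsto (fun k => χ k x • g x) atTop (𝓝 (g x)) := by
      refine Eventually.of_forall fun x => tendsto_const_nhds.congr' ?_
      filter_upwards [eventually_ge_atTop ⌈‖x‖⌉₊] with k hk
      rw [h3 k x, one_smul]
      exact (Nat.ceil_le.1 hk).trans (by linarith)
    refine (Lp.eLpNorm_lim_le_liminf_eLpNorm (p := p') (fun k =>
      ((h1 k).continuous.smul hg.continuous).aestronglyMeasurable) g hlim).trans ?_
    have ht : Tendsto (fun k : ℕ => S * (eLpNorm (fderiv ℝ g) 2 volume +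
        ENNReal.ofReal (C / (k + 1)) * eLpNorm g 2 volume)) atTop
        (𝓝 (S * (eLpNorm (fderiv ℝ g) 2 volume + ENNReal.ofReal 0 * eLpNorm g 2 volume))) := by
      refine ENNReal.Tendsto.const_mul (tendsto_const_nhds.add
        (ENNReal.Tendsto.mul_const (ENNReal.tendsto_ofReal ?_) (Or.inr hg2.2.ne)))
        (Or.inr (by simp [S]))
      have := (tendsto_one_div_add_atTop_nhds_zero_nat (𝕜 := ℝ)).const_mul C
      simpa [div_eq_mul_inv] using this
    refine (liminf_le_liminf (Eventually.of_forall hb)).trans ?_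
    rw [ht.liminf_eq]
    simp
  rw [eLpNorm_eq_lintegral_rpow_enorm_toReal (by simpa [← NNReal.coe_eq_zero, hp'c] using hp0.ne')
    (by simp), eLpNorm_eq_lintegral_rpow_enorm_toReal (by simp) (by simp)] at main
  simp only [ENNReal.coe_toReal, hp'c, ENNReal.toReal_ofNat] at main
  have := ENNReal.rpow_le_rpow main (z := 2) (by norm_num)
  rw [ENNReal.mul_rpow_of_nonneg _ _ (by norm_num), ← ENNReal.rpow_mul, ← ENNReal.rpow_mul] at this
  simp only [ENNReal.rpow_ofNat] at this ⊢
  convert this using 2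
  · have : (n : ℝ) - 2 ≠ 0 := by linarith
    field_simp
  · norm_num


/-- A decaying function is controlled by the Riesz potential of its derivative: average the
fundamental theorem of calculus over all rays issuing from the point. -/
lemma exists_enorm_le_riesz {F : Type*} [NormedAddCommGroup F] [NormedSpace ℝ F]
    [CompleteSpace F] (hn : 1 ≤ n) : ∃ C : ℝ≥0∞, C < ⊤ ∧ ∀ g : E n → F,
    ContDiff ℝ 1 g → Tendsto g (cocompact (E n)) (𝓝 0) → ∀ x,
    ‖g x‖ₑ ≤ C * ∫⁻ z, ‖x - z‖ₑ ^ (-((n : ℝ) - 1)) * ‖fderiv ℝ g z‖ₑ := by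
  have hn0 : 0 < n := by omega
  set σ := (volume : Measure (E n)).toSphere univ with hσ
  have hσ0 : σ ≠ 0 := by
    rw [hσ, Measure.toSphere_apply_univ]
    simp only [finrank_euclideanSpace, Fintype.card_fin, ne_eq, mul_eq_zero, not_or]
    exact ⟨by simp; omega, (measure_ball_pos _ _ one_pos).ne'⟩
  have hσt : σ ≠ ⊤ := by
    rw [hσ, Measure.toSphere_apply_univ]
    exact ENNReal.mul_ne_top (by simp) measure_ball_lt_top.ne
  refine ⟨σ⁻¹, ENNReal.inv_lt_top.2 (pos_iff_ne_zero.2 hσ0), fun g hg hg0 x => ?_⟩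
  have hcf := hg.continuous_fderiv one_ne_zero
  have h1 : ∫⁻ z, ‖x - z‖ₑ ^ (-((n : ℝ) - 1)) * ‖fderiv ℝ g z‖ₑ =
      ∫⁻ z, ‖z‖ₑ ^ (-((n : ℝ) - 1)) * ‖fderiv ℝ g (x + z)‖ₑ := by
    rw [← lintegral_add_left_eq_self _ x]
    refine lintegral_congr fun z => ?_
    rw [sub_add_cancel_left, enorm_neg]
  have hm : Measurable fun z => ‖z‖ₑ ^ (-((n : ℝ) - 1)) * ‖fderiv ℝ g (x + z)‖ₑ := by
    have : Continuous fun z => fderiv ℝ g (x + z) := by fun_prop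
    exact (measurable_enorm.pow_const _).mul this.measurable.enorm
  have h2 : ∀ w : sphere (0 : E n) 1, ‖g x‖ₑ ≤ ∫⁻ r in Ioi (0 : ℝ), ENNReal.ofReal (r ^ (n - 1)) *
      (‖r • (w : E n)‖ₑ ^ (-((n : ℝ) - 1)) * ‖fderiv ℝ g (x + r • (w : E n))‖ₑ) := by
    intro w
    have hw : ‖(w : E n)‖ = 1 := by simp
    have h3 : ∀ r ∈ Ioi (0 : ℝ), ENNReal.ofReal (r ^ (n - 1)) *
        (‖r • (w : E n)‖ₑ ^ (-((n : ℝ) - 1)) * ‖fderiv ℝ g (x + r • (w : E n))‖ₑ) =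
        ‖fderiv ℝ g (x + r • (w : E n))‖ₑ := by
      intro r hr
      have hr0 : 0 < r := hr
      have h4 : ‖r • (w : E n)‖ₑ = ENNReal.ofReal r := by
        rw [← ofReal_norm, norm_smul, hw, mul_one, Real.norm_eq_abs, abs_of_pos hr0]
      rw [h4, ENNReal.ofReal_rpow_of_pos hr0, ← mul_assoc, ← ENNReal.ofReal_mul (by positivity),
        ← Real.rpow_natCast, ← Real.rpow_add hr0, Nat.cast_sub hn]
      simp
    rw [setLIntegral_congr_fun measurableSet_Ioi h3]
    by_cases hfin : ∫⁻ r in Ioi (0 : ℝ), ‖fderiv ℝ g (x + r • (w : E n))‖ₑ = ⊤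
    · rw [hfin]; exact le_top
    have hc : Continuous fun r : ℝ => fderiv ℝ g (x + r • (w : E n)) := by fun_prop
    have hle : ∀ r : ℝ, ‖fderiv ℝ g (x + r • (w : E n)) w‖ₑ ≤ ‖fderiv ℝ g (x + r • (w : E n))‖ₑ := by
      intro r
      rw [← ofReal_norm, ← ofReal_norm]
      refine ENNReal.ofReal_le_ofReal ?_
      simpa [hw] using (fderiv ℝ g (x + r • (w : E n))).le_opNorm w
    have hint : IntegrableOn (fun r : ℝ => fderiv ℝ g (x + r • (w : E n)) w) (Ioi 0) :=
      ⟨(hc.clm_apply continuous_const).aestronglyMeasurable,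
        (lintegral_mono hle).trans_lt (lt_top_iff_ne_top.2 hfin)⟩
    have ht : Tendsto (fun r : ℝ => g (x + r • (w : E n))) atTop (𝓝 0) := by
      refine hg0.comp ?_
      rw [← Metric.cobounded_eq_cocompact, ← comap_norm_atTop, tendsto_comap_iff]
      refine tendsto_atTop_mono (f := fun r : ℝ => r - ‖x‖) (fun r => ?_)
        (tendsto_atTop_add_const_right _ _ tendsto_id)
      have h5 := norm_sub_norm_le (r • (w : E n)) (-x)
      rw [norm_smul, hw, mul_one, norm_neg, sub_neg_eq_add, add_comm _ x] at h5
      exact (sub_le_sub_right (le_abs_self r) _).trans h5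
    have h6 := integral_Ioi_of_hasDerivAt_of_tendsto' (a := 0)
      (fun r _ => hasDerivAt_comp_ray hg x (w : E n) r) hint ht
    simp only [zero_smul, add_zero, zero_sub] at h6
    rw [← enorm_neg, ← h6]
    exact (enorm_integral_le_lintegral_enorm _).trans (lintegral_mono hle)
  rw [h1, lintegral_polar hn0 hm]
  calc ‖g x‖ₑ = σ⁻¹ * ∫⁻ _ : sphere (0 : E n) 1, ‖g x‖ₑ ∂(volume : Measure (E n)).toSphere := by
        rw [lintegral_const, ← hσ, mul_comm, mul_assoc, ENNReal.mul_inv_cancel hσ0 hσt,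
          mul_one]
    _ ≤ _ := mul_le_mul' le_rfl (lintegral_mono h2)

end Sobolev

/-! ### Limits of smooth flows -/

section UDecay
variable {n : ℕ} {β γ : ℝ} {g h : ℕ → E n → ℝ}

/-- All members of the sequence decay like `(1 + |x|)⁻ᵝ`, uniformly in the index. -/
def UDecay (β : ℝ) (g : ℕ → E n → ℝ) : Prop :=
  ∃ G : E n → ℝ, Decay β G ∧ ∀ k x, ‖g k x‖ ≤ ‖G x‖

lemma Decay.uDecay {G : E n → ℝ} (hG : Decay β G) : UDecay β (fun _ => G) :=
  ⟨G, hG, fun _ _ => le_rfl⟩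

lemma Decay.norm {G : E n → ℝ} (hG : Decay β G) : Decay β fun x => ‖G x‖ :=
  hG.of_le fun x => by simp

lemma UDecay.of_le (hg : UDecay β g) (hh : ∀ k x, ‖h k x‖ ≤ ‖g k x‖) : UDecay β h := by
  obtain ⟨G, hG, hb⟩ := hg
  exact ⟨G, hG, fun k x => (hh k x).trans (hb k x)⟩

lemma UDecay.mono (hg : UDecay β g) (hγ : γ ≤ β) : UDecay γ g := by
  obtain ⟨G, hG, hb⟩ := hg
  exact ⟨G, hG.mono hγ, hb⟩

lemma UDecay.add (hg : UDecay β g) (hh : UDecay β h) : UDecay β fun k x => g k x + h k x := by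
  obtain ⟨G, hG, hb⟩ := hg
  obtain ⟨H, hH, hc⟩ := hh
  refine ⟨_, hG.norm.add hH.norm, fun k x => ?_⟩
  refine (norm_add_le _ _).trans ((add_le_add (hb k x) (hc k x)).trans (le_abs_self _))

lemma UDecay.sum {ι : Type*} {s : Finset ι} {g : ι → ℕ → E n → ℝ} (hg : ∀ i ∈ s, UDecay β (g i)) :
    UDecay β fun k x => ∑ i ∈ s, g i k x := by
  classical
  induction s using Finset.induction_on with
  | empty => simpa using (decay_zero (β := β)).uDecay
  | insert i s hi ih =>
    simp only [Finset.sum_insert hi]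
    exact (hg i (Finset.mem_insert_self i s)).add
      (ih fun j hj => hg j (Finset.mem_insert_of_mem hj))

lemma UDecay.mul (hg : UDecay β g) (hh : UDecay γ h) :
    UDecay (β + γ) fun k x => g k x * h k x := by
  obtain ⟨G, hG, hb⟩ := hg
  obtain ⟨H, hH, hc⟩ := hh
  refine ⟨_, hG.mul hH, fun k x => ?_⟩
  rw [norm_mul, norm_mul]
  exact mul_le_mul (hb k x) (hc k x) (norm_nonneg _) (norm_nonneg _)

lemma UDecay.const_mul (hg : UDecay β g) (c : ℝ) : UDecay β fun k x => c * g k x := by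
  obtain ⟨G, hG, hb⟩ := hg
  refine ⟨_, hG.const_mul c, fun k x => ?_⟩
  rw [norm_mul, norm_mul]
  exact mul_le_mul_of_nonneg_left (hb k x) (norm_nonneg _)

lemma UDecay.posPart_rpow_bdd (hg : UDecay β g) (hβ : 0 ≤ β) {s : ℝ} (hs : 0 ≤ s) :
    UDecay 0 fun k x => max (g k x) 0 ^ s := by
  obtain ⟨G, hG, hb⟩ := hg
  refine ⟨_, hG.norm.posPart_rpow_bdd hβ hs, fun k x => ?_⟩
  have h0 : 0 ≤ max (g k x) 0 := le_max_right _ _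
  rw [Real.norm_of_nonneg (by positivity), Real.norm_of_nonneg (by positivity)]
  exact Real.rpow_le_rpow h0 (max_le_max ((le_abs_self _).trans (hb k x)) le_rfl) hs

lemma Decay.exists_norm_le {F : Type*} [NormedAddCommGroup F] {G : E n → F} (hG : Decay β G) :
    ∃ C : ℝ, ∀ x, ‖G x‖ ≤ C * (1 + ‖x‖) ^ (-β) := by
  obtain ⟨C, hC, hG⟩ := hG
  refine ⟨C.toReal, fun x => ?_⟩
  have h1 := hG x
  rw [← ENNReal.ofReal_toReal hC.ne, ← ofReal_norm, ← ofReal_norm, ← ENNReal.ofReal_one,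
    ← ENNReal.ofReal_add zero_le_one (norm_nonneg _), ENNReal.ofReal_rpow_of_pos (by positivity),
    ← ENNReal.ofReal_mul (by positivity), ENNReal.ofReal_le_ofReal_iff (by positivity)] at h1
  exact h1

lemma Decay.tendsto_zero {F : Type*} [NormedAddCommGroup F] {G : E n → F} (hG : Decay β G)
    (hβ : 0 < β) : Tendsto G (cocompact (E n)) (𝓝 0) := by
  obtain ⟨C, hC⟩ := hG.exists_norm_le
  refine squeeze_zero_norm hC ?_
  have h1 : Tendsto (fun x : E n => (1 + ‖x‖) ^ (-β)) (cocompact (E n)) (𝓝 0) :=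
    (tendsto_rpow_neg_atTop hβ).comp
      (tendsto_atTop_add_const_left _ 1 tendsto_norm_cocompact_atTop)
  simpa using h1.const_mul C

lemma UDecay.tendsto_integral (hg : UDecay β g) (hβ : n < β) (hm : ∀ k, Continuous (g k))
    {G : E n → ℝ} (hlim : ∀ᵐ x, Tendsto (fun k => g k x) atTop (𝓝 (G x))) :
    Tendsto (fun k => ∫ x, g k x) atTop (𝓝 (∫ x, G x)) := by
  obtain ⟨H, hH, hb⟩ := hg
  obtain ⟨C, hC⟩ := hH.exists_norm_le
  refine tendsto_integral_of_dominated_convergence (fun x => C * (1 + ‖x‖) ^ (-β))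
    (fun k => (hm k).aestronglyMeasurable) ?_
    (fun k => Eventually.of_forall fun x => (hb k x).trans (hC x)) hlim
  exact (integrable_one_add_norm (by simpa using hβ)).const_mul _

lemma uDecay_conv_moll {b : ℝ} (hb : 0 ≤ b) {G : E n → ℝ} (hG : Decay b G) :
    UDecay b fun k => conv (moll n k) G := by
  obtain ⟨C, hC, hG⟩ := hG
  refine ⟨fun x => (C * 2 ^ b * (1 + ‖x‖ₑ) ^ (-b)).toReal, ⟨C * 2 ^ b, ?_, fun x => ?_⟩,
    fun k x => ?_⟩
  · exact ENNReal.mul_lt_top hC (ENNReal.rpow_lt_top_of_nonneg hb (by simp))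
  · rw [Real.enorm_eq_ofReal ENNReal.toReal_nonneg]
    exact ENNReal.ofReal_toReal_le
  · have h1 := enorm_conv_le hb (contDiff_moll k).continuous
      (fun z hz => moll_eq_zero_of_one_lt hz) hG x
    rw [lintegral_moll, one_mul, ← ofReal_norm] at h1
    rw [Real.norm_of_nonneg ENNReal.toReal_nonneg]
    refine (ENNReal.ofReal_le_iff_le_toReal ?_).1 h1
    have h2 : (2 : ℝ≥0∞) ^ b ≠ ⊤ := ENNReal.rpow_ne_top_of_nonneg hb (by simp)
    have h3 : (1 + ‖x‖ₑ) ^ (-b) ≠ ⊤ :=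
      ((one_add_enorm_rpow_le_one x hb).trans_lt ENNReal.one_lt_top).ne
    exact ENNReal.mul_ne_top (ENNReal.mul_ne_top hC.ne h2) h3

end UDecay

/-- A solution `u, p` with force `f` that is a limit of smooth flows, with uniform decay. -/
structure FlowApprox {n : ℕ} (β : ℝ) (u : Fin n → E n → ℝ) (p : E n → ℝ) (f : Fin n → E n → ℝ)
    (v : ℕ → Fin n → E n → ℝ) (P : ℕ → E n → ℝ) (h : ℕ → Fin n → E n → ℝ) : Prop where
  isFlow : ∀ k, IsFlow β (v k) (P k) (h k)
  decay_v : ∀ i, UDecay β fun k => v k i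
  decay_dv : ∀ i l, UDecay β fun k => pd l (v k i)
  decay_p : UDecay β P
  decay_h : ∀ i, UDecay β fun k => h k i
  lim_v : ∀ i x, Tendsto (fun k => v k i x) atTop (𝓝 (u i x))
  lim_dv : ∀ i l x, Tendsto (fun k => pd l (v k i) x) atTop (𝓝 (pd l (u i) x))
  lim_p : ∀ᵐ x, Tendsto (fun k => P k x) atTop (𝓝 (p x))
  lim_h : ∀ i, ∀ᵐ x, Tendsto (fun k => h k i x) atTop (𝓝 (f i x))

lemma tendsto_conv_moll_ae {n : ℕ} {g : E n → ℝ} (hg : LocallyIntegrable g volume) :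
    ∀ᵐ x, Tendsto (fun k => conv (moll n k) g x) atTop (𝓝 (g x)) := by
  have h := ContDiffBump.ae_convolution_tendsto_right_of_locallyIntegrable (μ := volume)
    (φ := mollifier n) (l := atTop) (K := 2) (tendsto_one_div_add_atTop_nhds_zero_nat)
    (Eventually.of_forall fun k => by simp [mollifier]; ring_nf; rfl) hg
  filter_upwards [h] with x hx
  refine hx.congr fun k => ?_
  rw [convolution_lsmul_swap]
  rfl

/-- The mollified fields are smooth flows with force `F_k + (u_k · ∇) u_k`, where the subscript
denotes mollification. By Lebesgue differentiation of `F` this force converges to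
`F + (u · ∇) u = f` almost everywhere, so the commutator of mollification and the nonlinear term
needs no separate estimate. -/
lemma flowApprox_mollified {n : ℕ} {F u f : Fin n → E n → ℝ} {p : E n → ℝ}
    (hn : 5 ≤ n) {β : ℝ} (hβ0 : 0 ≤ β) (hβ : β ≤ n) (hF : ∀ j, Decay n (F j))
    (hFm : ∀ j, Measurable (F j))
    (hu : ∀ i x, u i x = ∫ y, ∑ j, stokesU n i j (x - y) * F j y)
    (hp : ∀ x, p x = ∫ y, ∑ j, stokesP n j (x - y) * F j y)
    (hu1 : ∀ i, ContDiff ℝ 1 (u i)) (hdiv : ∀ x, ∑ i, pd i (u i) x = 0)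
    (hud : ∀ i, Decay β (u i)) (hudd : ∀ i l, Decay β (pd l (u i))) (hpd : Decay β p)
    (hpm : Measurable p) (hf : ∀ i x, f i x = F i x + ∑ l, u l x * pd l (u i) x) :
    FlowApprox β u p f (fun k i => conv (moll n k) (u i)) (fun k => conv (moll n k) p)
      (fun k i x => conv (moll n k) (F i) x +
        ∑ l, conv (moll n k) (u l) x * pd l (conv (moll n k) (u i)) x) := by
  have hpdc : ∀ k i l, pd l (conv (moll n k) (u i)) = conv (moll n k) (pd l (u i)) := fun k i l =>
    (conv_pd_right ((contDiff_moll k).of_le (by simp)) (hasCompactSupport_moll k) (hu1 i) l).symm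
  have hv : ∀ i, UDecay β fun k => conv (moll n k) (u i) := fun i => uDecay_conv_moll hβ0 (hud i)
  have hdv : ∀ i l, UDecay β fun k => pd l (conv (moll n k) (u i)) := fun i l => by
    simp only [hpdc]
    exact uDecay_conv_moll hβ0 (hudd i l)
  have lv : ∀ i x, Tendsto (fun k => conv (moll n k) (u i) x) atTop (𝓝 (u i x)) := fun i x =>
    tendsto_conv_moll (hu1 i).continuous x
  have ldv : ∀ i l x, Tendsto (fun k => pd l (conv (moll n k) (u i)) x) atTop
      (𝓝 (pd l (u i) x)) := fun i l x => by
    simp only [hpdc]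
    exact tendsto_conv_moll (continuous_pd (hu1 i) l) x
  refine ⟨isFlow_mollified hn hβ0 hβ hF hFm hu hp hu1 hdiv hud hpd hpm, hv, hdv,
    uDecay_conv_moll hβ0 hpd, fun i => ?_, lv, ldv, tendsto_conv_moll_ae (hpd.locallyIntegrable hβ0 hpm), fun i => ?_⟩
  · refine ((uDecay_conv_moll hβ0 ((hF i).mono hβ))).add (UDecay.sum fun l _ => ?_)
    exact ((hv l).mul (hdv i l)).mono (by linarith)
  · have hl : LocallyIntegrable (F i) volume := (hF i).locallyIntegrable n.cast_nonneg (hFm i)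
    filter_upwards [tendsto_conv_moll_ae hl] with x hx
    rw [hf]
    exact hx.add (tendsto_finsetSum _ fun l _ => (lv l x).mul (ldv i l x))

namespace FlowApprox
variable {n : ℕ} {β : ℝ} {u f : Fin n → E n → ℝ} {p : E n → ℝ} {v h : ℕ → Fin n → E n → ℝ}
  {P : ℕ → E n → ℝ}

lemma lim_head (A : FlowApprox β u p f v P h) :
    ∀ᵐ x, Tendsto (fun k => head (v k) (P k) x) atTop (𝓝 (head u p x)) :=
  A.lim_p.mono fun x hx =>
    ((tendsto_finsetSum _ fun i _ => (A.lim_v i x).pow 2).div_const 2).add hx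

lemma decay_head (A : FlowApprox β u p f v P h) (hβ : 0 ≤ β) :
    UDecay β fun k => head (v k) (P k) := by
  have h1 : UDecay β fun k x => (2 : ℝ)⁻¹ * ∑ i, v k i x * v k i x :=
    (UDecay.sum fun i _ => ((A.decay_v i).mul (A.decay_v i)).mono (by linarith)).const_mul _
  refine (h1.add A.decay_p).of_le fun k x => le_of_eq ?_
  simp only [head, sq]
  ring_nf

lemma continuous_v (A : FlowApprox β u p f v P h) (k : ℕ) (i : Fin n) : Continuous (v k i) :=
  ((A.isFlow k).smooth_v i).continuous

lemma continuous_h (A : FlowApprox β u p f v P h) (k : ℕ) (i : Fin n) : Continuous (h k i) :=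
  ((A.isFlow k).smooth_h i).continuous

lemma continuous_head (A : FlowApprox β u p f v P h) (k : ℕ) : Continuous (head (v k) (P k)) :=
  (A.isFlow k).smooth_head.continuous

lemma ae_lim_h (A : FlowApprox β u p f v P h) :
    ∀ᵐ x, ∀ i, Tendsto (fun k => h k i x) atTop (𝓝 (f i x)) := ae_all_iff.2 A.lim_h

lemma energy (A : FlowApprox β u p f v P h) (hβ : n < 2 * β) :
    ∫ x, ∑ i, ∑ k, pd k (u i) x ^ 2 = ∫ x, ∑ i, u i x * f i x := by
  have h1 := UDecay.tendsto_integral (G := fun x => ∑ i, ∑ l, pd l (u i) x ^ 2)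
    (g := fun k x => ∑ i, ∑ l, pd l (v k i) x ^ 2) (β := 2 * β)
    (UDecay.sum fun i _ => UDecay.sum fun l _ => by
      simpa [sq, two_mul] using (A.decay_dv i l).mul (A.decay_dv i l)) hβ
    (fun k => by
      have := fun i l => (contDiff_pd_infty ((A.isFlow k).smooth_v i) l).continuous
      fun_prop)
    (Eventually.of_forall fun x => tendsto_finsetSum _ fun i _ => tendsto_finsetSum _ fun l _ =>
      (A.lim_dv i l x).pow 2)
  have h2 := UDecay.tendsto_integral (G := fun x => ∑ i, u i x * f i x)
    (g := fun k x => ∑ i, v k i x * h k i x) (β := 2 * β)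
    (UDecay.sum fun i _ => by simpa [two_mul] using (A.decay_v i).mul (A.decay_h i)) hβ
    (fun k => by
      have := A.continuous_v k
      have := A.continuous_h k
      fun_prop)
    (A.ae_lim_h.mono fun x hx => tendsto_finsetSum _ fun i _ => (A.lim_v i x).mul (hx i))
  exact tendsto_nhds_unique (h1.congr fun k => (A.isFlow k).energy hβ) h2

/-- The weighted estimate passes to the limit: both sides involve only the velocity, the head pressure
and the force, so no convergence of derivatives is required. -/
lemma weighted_estimate (A : FlowApprox β u p f v P h) (hβ : n < 2 * β) {a e : ℝ} (ha : 0 < a)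
    (han : a + 2 ≤ n) (hβa : n < β + a) (he : 0 < e) (x₀ : E n) :
    (n - a - 4) / 2 * ∫ x, (∑ i, u i x ^ 2) * (‖x - x₀‖ ^ 2 + e) ^ (-(a / 2 + 1)) ≤
      ∫ x, (n * (max (head u p x) 0 * (‖x - x₀‖ ^ 2 + e) ^ (-(a / 2 + 1))) +
        |∑ i, f i x * (x i - x₀ i)| * (‖x - x₀‖ ^ 2 + e) ^ (-(a / 2 + 1))) := by
  have hβ0 : 0 ≤ β := by have : (0 : ℝ) ≤ n := Nat.cast_nonneg n; linarith
  set w : E n → ℝ := fun x => (‖x - x₀‖ ^ 2 + e) ^ (-(a / 2 + 1)) with hw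
  have hw0 : ∀ x, 0 ≤ w x := fun x => Real.rpow_nonneg (by positivity) _
  have cw : Continuous w := (by fun_prop : Continuous fun x : E n => ‖x - x₀‖ ^ 2 + e).rpow_const
    fun x => Or.inl (by positivity)
  have dw : Decay a w := (decay_sq_norm_rpow he (m := a / 2 + 1) (by linarith) x₀).mono
    (by linarith)
  have h1 := UDecay.tendsto_integral (G := fun x => (∑ i, u i x ^ 2) * w x)
    (g := fun k x => (∑ i, v k i x ^ 2) * w x) (β := β + a)
    (UDecay.mul (UDecay.sum fun i _ => ((A.decay_v i).mul (A.decay_v i)).mono (γ := β) (by linarith)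
      |>.of_le fun k x => by rw [sq]) dw.uDecay) hβa
    (fun k => by
      have := A.continuous_v k
      fun_prop)
    (Eventually.of_forall fun x => (tendsto_finsetSum _ fun i _ => (A.lim_v i x).pow 2).mul_const _)
  have h2 := UDecay.tendsto_integral
    (G := fun x => n * (max (head u p x) 0 * w x) + |∑ i, f i x * (x i - x₀ i)| * w x)
    (g := fun k x => n * (max (head (v k) (P k) x) 0 * w x) +
      |∑ i, h k i x * (x i - x₀ i)| * w x) (β := β + a)
    (by
      refine UDecay.add ((UDecay.mul (UDecay.of_le (A.decay_head hβ0) fun k x => ?_)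
        dw.uDecay).const_mul _) ?_
      · rw [Real.norm_of_nonneg (le_max_right _ _)]
        exact max_le (le_abs_self _) (abs_nonneg _)
      · have : UDecay (β + a) fun k x => ∑ i, h k i x * ((x i - x₀ i) * w x) :=
          UDecay.sum fun i _ => (A.decay_h i).mul
            ((decay_coord_mul_rpow he (m := a / 2 + 1) (by linarith) x₀ i).mono
              (by linarith)).uDecay
        refine this.of_le fun k x => le_of_eq ?_
        simp_rw [← mul_assoc, ← Finset.sum_mul]
        rw [norm_mul, norm_mul, Real.norm_eq_abs, Real.norm_eq_abs, Real.norm_eq_abs, abs_abs]) hβa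
    (fun k => by
      have := A.continuous_head k
      have := A.continuous_h k
      fun_prop)
    ((A.ae_lim_h.and A.lim_head).mono fun x ⟨hx, hx'⟩ =>
      (((hx'.max tendsto_const_nhds).mul_const _).const_mul _).add
        ((tendsto_finsetSum _ fun i _ => (hx i).mul_const _).abs.mul_const _))
  exact le_of_tendsto_of_tendsto' (h1.const_mul _) h2 fun k =>
    (A.isFlow k).weighted_estimate hβ ha han hβa he x₀

end FlowApprox

section Head
variable {n : ℕ}

lemma enorm_fderiv_rpow_two_le (g : E n → ℝ) (x : E n) :
    ‖fderiv ℝ g x‖ₑ ^ (2 : ℝ) ≤ ENNReal.ofReal (∑ k, pd k g x ^ 2) := by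
  have h : ‖fderiv ℝ g x‖ ≤ √(∑ k, pd k g x ^ 2) := by
    refine ContinuousLinearMap.opNorm_le_bound _ (Real.sqrt_nonneg _) fun y => ?_
    rw [fderiv_apply_eq_sum_pd, EuclideanSpace.norm_eq, Real.norm_eq_abs]
    refine Real.abs_le_sqrt (y := (∑ k, pd k g x ^ 2) * (∑ k, ‖y k‖ ^ 2)) ?_ |>.trans ?_
    · simp only [Real.norm_eq_abs, sq_abs]
      refine le_trans (le_of_eq ?_) (Finset.sum_mul_sq_le_sq_mul_sq _ _ _)
      congr 1
      exact Finset.sum_congr rfl fun i _ => by ring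
    · rw [Real.sqrt_mul (Finset.sum_nonneg fun i _ => sq_nonneg _)]
  rw [← ofReal_norm, ENNReal.ofReal_rpow_of_nonneg (norm_nonneg _) (by norm_num)]
  refine ENNReal.ofReal_le_ofReal ?_
  rw [Real.rpow_two]
  calc ‖fderiv ℝ g x‖ ^ 2 ≤ √(∑ k, pd k g x ^ 2) ^ 2 := by gcongr
    _ = _ := Real.sq_sqrt (Finset.sum_nonneg fun i _ => sq_nonneg _)

lemma Decay.memLp_two {β : ℝ} {g : E n → ℝ} (hg : Decay β g) (hβ : n < 2 * β)
    (hm : Measurable g) : MemLp g 2 volume := by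
  rw [memLp_two_iff_integrable_sq hm.aestronglyMeasurable]
  refine Decay.integrable (β := 2 * β) ?_ (hm.pow_const 2).aestronglyMeasurable hβ
  simpa [sq, two_mul] using hg.mul hg

/-- The estimate for powers of the head pressure, combined with the Sobolev inequality. -/
lemma exists_head_sobolev (hn : 3 ≤ n) {q : ℝ} (hq : 1 < q) : ∃ C : ℝ≥0∞, C < ⊤ ∧
    ∀ (β : ℝ) (v : Fin n → E n → ℝ) (p : E n → ℝ) (h : Fin n → E n → ℝ), IsFlow β v p h →
    n < 2 * β → (∫⁻ x, ENNReal.ofReal (max (head v p x) 0) ^ ((q + 1) * n / (n - 2) : ℝ)) ^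
      ((n - 2) / n : ℝ) ≤ C * ENNReal.ofReal (∫ x, ((∑ i, v i x * h i x) * max (head v p x) 0 ^ q +
        q / 2 * (max (head v p x) 0 ^ (q - 1) * ∑ k, h k x ^ 2))) := by
  obtain ⟨C, hC, hS⟩ := exists_sobolev ℝ hn
  have hn3 : (3 : ℝ) ≤ n := by exact_mod_cast hn
  set c : ℝ := ((q + 1) / 2) ^ 2 * (2 / q) with hc
  have hc0 : 0 < c := by positivity
  refine ⟨C * ENNReal.ofReal c, ENNReal.mul_lt_top hC ENNReal.ofReal_lt_top,
    fun β v p h H hβ => ?_⟩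
  have hβ0 : 0 ≤ β := by linarith
  set θ := head v p with hθ
  have hθd : Differentiable ℝ θ := H.smooth_head.differentiable (by simp)
  have hs : 1 < (q + 1) / 2 := by linarith
  set g : E n → ℝ := fun x => max (θ x) 0 ^ ((q + 1) / 2) with hg
  have hg1 : ContDiff ℝ 1 g := (contDiff_posPart_rpow hs).comp (H.smooth_head.of_le (by simp))
  have hθD : Decay β θ := H.decay_head hβ0
  have hcont := H.smooth_head.continuous
  have hg2 : MemLp g 2 volume :=
    (hθD.posPart_rpow hβ0 hs.le).memLp_two hβ hg1.continuous.measurable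
  have h1 := hS g hg1 hg2
  have e1 : ∀ x, ‖g x‖ₑ ^ (2 * n / (n - 2) : ℝ) =
      ENNReal.ofReal (max (θ x) 0) ^ ((q + 1) * n / (n - 2) : ℝ) := fun x => by
    rw [hg, Real.enorm_eq_ofReal (by positivity),
      ← ENNReal.ofReal_rpow_of_nonneg (le_max_right _ _) (by linarith), ← ENNReal.rpow_mul]
    congr 1
    ring
  have e2 : ∫⁻ x, ‖fderiv ℝ g x‖ₑ ^ (2 : ℝ) ≤ ENNReal.ofReal c *
      ENNReal.ofReal (q / 2 * ∫ x, max (θ x) 0 ^ (q - 1) * ∑ k, pd k θ x ^ 2) := by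
    have e3 : ∀ x, ∑ k, pd k g x ^ 2 =
        ((q + 1) / 2) ^ 2 * (max (θ x) 0 ^ (q - 1) * ∑ k, pd k θ x ^ 2) := by
      intro x
      rw [Finset.mul_sum, Finset.mul_sum]
      refine Finset.sum_congr rfl fun k _ => ?_
      rw [hg, pd_posPart_rpow hs hθd, mul_pow, mul_pow, ← Real.rpow_mul_natCast (le_max_right _ _)]
      rw [show ((q + 1) / 2 - 1) * ((2 : ℕ) : ℝ) = q - 1 by push_cast; ring]
      ring
    have hint : Integrable fun x => max (θ x) 0 ^ (q - 1) * ∑ k, pd k θ x ^ 2 := by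
      refine Decay.integrable (β := 2 * β) ?_ (Continuous.aestronglyMeasurable ?_) hβ
      · have h3 : Decay (0 + 2 * β) fun x => max (θ x) 0 ^ (q - 1) * ∑ k, pd k θ x ^ 2 :=
          (hθD.posPart_rpow_bdd hβ0 (by linarith)).mul (Decay.sum fun k _ => by
            simpa [sq, two_mul] using (H.decay_pd_head hβ0 k).mul (H.decay_pd_head hβ0 k))
        simpa using h3
      · have h4 := fun k => (contDiff_pd_infty H.smooth_head k).continuous
        refine Continuous.mul ((by fun_prop : Continuous fun x => max (θ x) 0).rpow_const
          fun x => Or.inr (by linarith)) (by fun_prop)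
    rw [← ENNReal.ofReal_mul hc0.le, ← mul_assoc, hc,
      show ((q + 1) / 2) ^ 2 * (2 / q) * (q / 2) = ((q + 1) / 2) ^ 2 by field_simp,
      ← integral_const_mul, ofReal_integral_eq_lintegral_ofReal (hint.const_mul _)
        (Eventually.of_forall fun x => mul_nonneg (sq_nonneg _) (mul_nonneg
          (Real.rpow_nonneg (le_max_right _ _) _) (Finset.sum_nonneg fun i _ => sq_nonneg _)))]
    refine lintegral_mono fun x => ?_
    rw [← e3]
    exact enorm_fderiv_rpow_two_le g x
  simp only [e1] at h1
  refine h1.trans ?_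
  rw [mul_assoc]
  gcongr
  exact e2.trans (mul_le_mul' le_rfl (ENNReal.ofReal_le_ofReal (H.head_estimate hβ hq)))

end Head

/-- The estimate of `exists_head_sobolev` for limits of smooth flows. -/
lemma exists_head_sobolev_limit {n : ℕ} (hn : 3 ≤ n) {q : ℝ} (hq : 1 < q) :
    ∃ C : ℝ≥0∞, C < ⊤ ∧
    ∀ {β : ℝ} {u : Fin n → E n → ℝ} {p : E n → ℝ} {f : Fin n → E n → ℝ}
      {v h : ℕ → Fin n → E n → ℝ} {P : ℕ → E n → ℝ}, FlowApprox β u p f v P h →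
    n < 2 * β → (∫⁻ x, ENNReal.ofReal (max (head u p x) 0) ^ ((q + 1) * n / (n - 2) : ℝ)) ^
      ((n - 2) / n : ℝ) ≤ C * ENNReal.ofReal (∫ x, ((∑ i, u i x * f i x) * max (head u p x) 0 ^ q +
        q / 2 * (max (head u p x) 0 ^ (q - 1) * ∑ k, f k x ^ 2))) := by
  obtain ⟨C, hC, hS⟩ := exists_head_sobolev hn hq
  refine ⟨C, hC, fun {β u p f v h P} A hβ => ?_⟩
  have hn3 : (3 : ℝ) ≤ n := by exact_mod_cast hn
  have hβ0 : 0 ≤ β := by linarith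
  have hr0 : 0 < (q + 1) * n / (n - 2) := div_pos (by nlinarith) (by linarith)
  have hpos : ∀ {s : ℝ}, 0 ≤ s → ∀ {x},
      Tendsto (fun k => head (v k) (P k) x) atTop (𝓝 (head u p x)) →
      Tendsto (fun k => max (head (v k) (P k) x) 0 ^ s) atTop (𝓝 (max (head u p x) 0 ^ s)) :=
    fun hs x hx => (hx.max tendsto_const_nhds).rpow_const (Or.inr hs)
  have hcont : ∀ {s : ℝ}, 0 ≤ s → ∀ k, Continuous fun x => max (head (v k) (P k) x) 0 ^ s :=
    fun hs k => ((A.continuous_head k).max continuous_const).rpow_const fun x => Or.inr hs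
  have h1 := UDecay.tendsto_integral (β := 2 * β)
    (G := fun x => (∑ i, u i x * f i x) * max (head u p x) 0 ^ q +
        q / 2 * (max (head u p x) 0 ^ (q - 1) * ∑ k, f k x ^ 2))
    (g := fun k x => (∑ i, v k i x * h k i x) * max (head (v k) (P k) x) 0 ^ q +
        q / 2 * (max (head (v k) (P k) x) 0 ^ (q - 1) * ∑ l, h k l x ^ 2))
    (by
      refine UDecay.add ?_ (UDecay.const_mul ?_ _)
      · have : UDecay (2 * β + 0) fun k x =>
            (∑ i, v k i x * h k i x) * max (head (v k) (P k) x) 0 ^ q :=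
          (UDecay.sum fun i _ => by simpa [two_mul] using (A.decay_v i).mul (A.decay_h i)).mul
            ((A.decay_head hβ0).posPart_rpow_bdd hβ0 (by linarith))
        simpa using this
      · have : UDecay (0 + 2 * β) fun k x =>
            max (head (v k) (P k) x) 0 ^ (q - 1) * ∑ l, h k l x ^ 2 :=
          ((A.decay_head hβ0).posPart_rpow_bdd hβ0 (by linarith)).mul
            (UDecay.sum fun i _ => by simpa [sq, two_mul] using (A.decay_h i).mul (A.decay_h i))
        simpa using this) hβ
    (fun k => by
      have h2 := A.continuous_v k
      have h3 := A.continuous_h k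
      have h4 := hcont (s := q) (by linarith) k
      have h5 := hcont (s := q - 1) (by linarith) k
      fun_prop)
    ((A.ae_lim_h.and A.lim_head).mono fun x ⟨hx, hx'⟩ =>
      ((tendsto_finsetSum _ fun i _ => (A.lim_v i x).mul (hx i)).mul (hpos (by linarith) hx')).add
        (((hpos (by linarith) hx').mul (tendsto_finsetSum _ fun i _ => (hx i).pow 2)).const_mul _))
  have h2 : ∫⁻ x, ENNReal.ofReal (max (head u p x) 0) ^ ((q + 1) * n / (n - 2) : ℝ) ≤
      liminf (fun k => ∫⁻ x, ENNReal.ofReal (max (head (v k) (P k) x) 0) ^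
        ((q + 1) * n / (n - 2) : ℝ)) atTop := by
    refine le_trans (le_of_eq (lintegral_congr_ae (A.lim_head.mono fun x hx => ?_)))
      (lintegral_liminf_le fun k => ?_)
    · refine (Tendsto.liminf_eq ?_).symm
      exact ((ENNReal.continuous_rpow_const.tendsto _).comp
        (ENNReal.tendsto_ofReal (hx.max tendsto_const_nhds)))
    · exact (((A.continuous_head k).max continuous_const).measurable.ennreal_ofReal).pow_const _
  have hz : 0 < ((n - 2) / n : ℝ) := div_pos (by linarith) (by linarith)
  have hzr : ∀ a b : ℝ≥0∞, a ^ ((n - 2) / n : ℝ) ≤ b ↔ a ≤ b ^ ((n - 2) / n : ℝ)⁻¹ := fun a b =>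
    (ENNReal.le_rpow_inv_iff hz).symm
  rw [hzr]
  refine h2.trans ?_
  have h3 := ((ENNReal.continuous_rpow_const (y := ((n - 2) / n : ℝ)⁻¹)).tendsto _).comp
    (ENNReal.Tendsto.const_mul (a := C) (ENNReal.tendsto_ofReal h1) (Or.inr hC.ne))
  rw [← h3.liminf_eq]
  refine liminf_le_liminf (Eventually.of_forall fun k => ?_)
  simp only [Function.comp_def]
  rw [← hzr]
  exact hS β _ _ _ (A.isFlow k) hβ

/-! ### Hölder and Schur estimates for Riesz kernels -/

/-- Hölder's inequality with three factors, the third of which is the constant one. -/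
lemma lintegral_rpow_mul_rpow_le {α : Type*} [MeasurableSpace α] {μ : Measure α} {f g : α → ℝ≥0∞}
    (hf : AEMeasurable f μ) (hg : AEMeasurable g μ) {a b s t : ℝ} (ha : 0 < a) (hb : 0 < b)
    (hs : 0 ≤ s) (ht : 0 ≤ t) (hst : s / a + t / b ≤ 1) :
    ∫⁻ x, f x ^ s * g x ^ t ∂μ ≤ (∫⁻ x, f x ^ a ∂μ) ^ (s / a) * (∫⁻ x, g x ^ b ∂μ) ^ (t / b) *
      μ univ ^ (1 - s / a - t / b) := by
  have h := ENNReal.lintegral_prod_norm_pow_le (μ := μ) Finset.univ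
    (f := ![fun x => f x ^ a, fun x => g x ^ b, fun _ => 1])
    (p := ![s / a, t / b, 1 - s / a - t / b])
    (by
      intro i _
      fin_cases i
      · exact hf.pow_const a
      · exact hg.pow_const b
      · exact aemeasurable_const)
    (by simp [Fin.sum_univ_three])
    (by
      intro i _
      fin_cases i
      · exact div_nonneg hs ha.le
      · exact div_nonneg ht hb.le
      · simp only [Fin.reduceFinMk, Matrix.cons_val]; linarith)
  simp only [Fin.prod_univ_three, Matrix.cons_val_zero, Matrix.cons_val_one, Matrix.cons_val,
    ← ENNReal.rpow_mul, ENNReal.one_rpow, mul_one, lintegral_const, one_mul,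
    mul_div_cancel₀ _ ha.ne', mul_div_cancel₀ _ hb.ne'] at h
  exact h

section Kernel
variable {n : ℕ}

lemma lintegral_ball_center (x : E n) (f : E n → ℝ≥0∞) :
    ∫⁻ y in ball x 1, f (x - y) = ∫⁻ z in ball (0 : E n) 1, f z := by
  rw [← lintegral_indicator measurableSet_ball, ← lintegral_indicator measurableSet_ball,
    ← lintegral_sub_left_eq_self ((ball (0 : E n) 1).indicator f) x]
  refine lintegral_congr fun y => ?_
  by_cases h : y ∈ ball x 1
  · rw [indicator_of_mem h, indicator_of_mem]
    rwa [mem_ball_zero_iff, ← dist_eq_norm, dist_comm]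
  · rw [indicator_of_notMem h, indicator_of_notMem]
    rwa [mem_ball_zero_iff, ← dist_eq_norm, dist_comm]

lemma one_le_enorm_sub {x y : E n} (h : y ∉ ball x 1) : 1 ≤ ‖x - y‖ₑ := by
  rw [enorm_eq_ofReal_norm, ← ENNReal.ofReal_one, ← dist_eq_norm, dist_comm]
  exact ENNReal.ofReal_le_ofReal (by simpa using h)

lemma exists_setLIntegral_enorm_rpow_le (hn : 0 < n) {a : ℝ} (ha0 : 0 ≤ a) (ha : a < n) :
    ∃ C : ℝ≥0∞, C < ⊤ ∧ ∀ (K : Set (E n)) (x : E n), MeasurableSet K →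
      ∫⁻ y in K, ‖x - y‖ₑ ^ (-a) ≤ C + volume K := by
  refine ⟨_, lintegral_ball_enorm_rpow_lt_top hn ha, fun K x hK => ?_⟩
  calc ∫⁻ y in K, ‖x - y‖ₑ ^ (-a)
      ≤ ∫⁻ y in K, ((ball x 1).indicator (fun y => ‖x - y‖ₑ ^ (-a)) y + 1) := by
        refine lintegral_mono fun y => ?_
        by_cases h : y ∈ ball x 1
        · rw [indicator_of_mem h]; exact le_self_add
        · rw [indicator_of_notMem h, zero_add]
          simpa using rpow_neg_le_rpow_neg ha0 (one_le_enorm_sub h)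
    _ = (∫⁻ y in K, (ball x 1).indicator (fun y => ‖x - y‖ₑ ^ (-a)) y) + volume K := by
        rw [lintegral_add_right _ measurable_const, setLIntegral_one]
    _ ≤ (∫⁻ y, (ball x 1).indicator (fun y => ‖x - y‖ₑ ^ (-a)) y) + volume K := by
        gcongr
        exact Measure.restrict_le_self
    _ = _ := by
        rw [lintegral_indicator measurableSet_ball, lintegral_ball_center x fun z => ‖z‖ₑ ^ (-a)]

/-- Hölder's inequality for a Riesz potential, with different exponents near the singularity and at
infinity. -/
lemma exists_riesz_le_rpow (hn : 0 < n) {a r s : ℝ} (ha : 0 ≤ a) (hr : 1 < r) (hs : 1 < s)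
    (har : a * (r / (r - 1)) < n) (has : n < a * (s / (s - 1))) : ∃ C : ℝ≥0∞, C < ⊤ ∧
    ∀ (Θ : E n → ℝ≥0∞), Measurable Θ → ∀ x, ∫⁻ y, Θ y * ‖x - y‖ₑ ^ (-a) ≤
      C * ((∫⁻ y, Θ y ^ r) ^ (1 / r) + (∫⁻ y, Θ y ^ s) ^ (1 / s)) := by
  set r' := r / (r - 1) with hr'
  set s' := s / (s - 1) with hs'
  have hr'0 : 0 < r' := div_pos (by linarith) (by linarith)
  have hs'0 : 0 < s' := div_pos (by linarith) (by linarith)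
  have hrr : 1 / r + 1 / r' = 1 := by
    rw [hr', one_div_div]; field_simp; ring
  have hss : 1 / s + 1 / s' = 1 := by
    rw [hs', one_div_div]; field_simp; ring
  set A := (∫⁻ y in ball (0 : E n) 1, ‖y‖ₑ ^ (-(a * r'))) ^ (1 / r') with hA
  set B := (2 ^ (a * s') * ∫⁻ y : E n, (1 + ‖y‖ₑ) ^ (-(a * s'))) ^ (1 / s') with hB
  have hA' : A < ⊤ := ENNReal.rpow_lt_top_of_nonneg (by positivity)
    (lintegral_ball_enorm_rpow_lt_top hn har).ne
  have hB' : B < ⊤ := ENNReal.rpow_lt_top_of_nonneg (by positivity) (ENNReal.mul_lt_top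
    (ENNReal.rpow_lt_top_of_nonneg (by positivity) (by simp))
    (lintegral_one_add_enorm_rpow_lt_top has)).ne
  refine ⟨A + B, ENNReal.add_lt_top.2 ⟨hA', hB'⟩, fun Θ hΘ x => ?_⟩
  have hmk : ∀ S : Set (E n), AEMeasurable (fun y => ‖x - y‖ₑ ^ (-a)) (volume.restrict S) :=
    fun S => (((by fun_prop : Measurable fun y => x - y).enorm).pow_const _).aemeasurable
  have key : ∀ (S : Set (E n)) {r r' : ℝ}, 0 < r → 0 < r' → 1 / r + 1 / r' = 1 →
      ∫⁻ y in S, Θ y * ‖x - y‖ₑ ^ (-a) ≤ (∫⁻ y, Θ y ^ r) ^ (1 / r) *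
        (∫⁻ y in S, ‖x - y‖ₑ ^ (-(a * r'))) ^ (1 / r') := by
    intro S r r' h0 h0' h1
    have h2 := lintegral_rpow_mul_rpow_le (μ := volume.restrict S) hΘ.aemeasurable (hmk S) h0 h0'
      zero_le_one zero_le_one h1.le
    have h3 : (1 : ℝ) - 1 / r - 1 / r' = 0 := by linarith
    simp only [ENNReal.rpow_one, h3, ENNReal.rpow_zero, mul_one, ← ENNReal.rpow_mul, neg_mul] at h2
    refine h2.trans ?_
    gcongr
    exact Measure.restrict_le_self
  rw [← lintegral_add_compl _ (measurableSet_ball (x := x) (ε := 1))]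
  have hnear := key (ball x 1) (by linarith : 0 < r) hr'0 hrr
  rw [lintegral_ball_center x fun z => ‖z‖ₑ ^ (-(a * r')), ← hA] at hnear
  have hfar := key (ball x 1)ᶜ (by linarith : 0 < s) hs'0 hss
  have h4 : (∫⁻ y in (ball x 1)ᶜ, ‖x - y‖ₑ ^ (-(a * s'))) ^ (1 / s') ≤ B := by
    rw [hB]
    gcongr
    rw [← lintegral_const_mul' _ _ (ENNReal.rpow_ne_top_of_nonneg (by positivity) (by simp)),
      ← lintegral_sub_left_eq_self (fun y : E n => 2 ^ (a * s') * (1 + ‖y‖ₑ) ^ (-(a * s'))) x]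
    refine (setLIntegral_mono' measurableSet_ball.compl fun y hy => ?_).trans
      (setLIntegral_le_lintegral _ _)
    refine (enorm_rpow_neg_le (by positivity) _).trans (le_of_eq ?_)
    rw [indicator_of_notMem, zero_add]
    rw [mem_ball_zero_iff, ← dist_eq_norm, dist_comm]
    exact hy
  calc _ ≤ (∫⁻ y, Θ y ^ r) ^ (1 / r) * A + (∫⁻ y, Θ y ^ s) ^ (1 / s) * B :=
        add_le_add hnear (hfar.trans (mul_le_mul' le_rfl h4))
    _ ≤ (∫⁻ y, Θ y ^ r) ^ (1 / r) * (A + B) + (∫⁻ y, Θ y ^ s) ^ (1 / s) * (A + B) := by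
        gcongr
        · exact le_self_add
        · exact le_add_self
    _ = _ := by ring

/-- The composition of two Riesz kernels of order one is bounded by the kernel of order two, by
scaling to a unit vector. -/
lemma exists_riesz_comp_le (hn : 3 ≤ n) : ∃ C : ℝ≥0∞, C < ⊤ ∧ ∀ x y : E n, x ≠ y →
    ∫⁻ z, ‖x - z‖ₑ ^ (-((n : ℝ) - 1)) * ‖y - z‖ₑ ^ (-((n : ℝ) - 1)) ≤
      C * ‖x - y‖ₑ ^ (-((n : ℝ) - 2)) := by
  have hn3 : (3 : ℝ) ≤ n := by exact_mod_cast hn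
  set a : ℝ := (n : ℝ) - 1 with ha
  have ha0 : 0 ≤ a := by linarith
  obtain ⟨C, hC, hb⟩ := lintegral_riesz_weight_le (n := n) (by omega) ha0 (by linarith) ha0
    (by linarith : (n : ℝ) < a + a)
  have h3t : (3 : ℝ≥0∞) ^ a < ⊤ := ENNReal.rpow_lt_top_of_nonneg ha0 (by simp)
  refine ⟨3 ^ a * C + 3 ^ a * C, by
    simp only [ENNReal.add_lt_top, and_self]; exact ENNReal.mul_lt_top h3t hC, ?_⟩
  -- The larger of `‖e - z‖` and `‖z‖` is at least `1 / 2`, hence comparable to `1 + ‖·‖`.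
  have hlow : ∀ w w' : E n, ‖w‖ ≤ ‖w'‖ → 1 ≤ ‖w‖ + ‖w'‖ →
      ‖w'‖ₑ ^ (-a) ≤ 3 ^ a * (1 + ‖w'‖ₑ) ^ (-a) := by
    intro w w' h1 h2
    have h3 : 1 + ‖w'‖ₑ ≤ 3 * ‖w'‖ₑ := by
      rw [enorm_eq_ofReal_norm, ← ENNReal.ofReal_one, ← ENNReal.ofReal_add zero_le_one
        (norm_nonneg _), show (3 : ℝ≥0∞) = ENNReal.ofReal 3 by simp,
        ← ENNReal.ofReal_mul (by norm_num)]
      exact ENNReal.ofReal_le_ofReal (by linarith)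
    calc ‖w'‖ₑ ^ (-a) = 3 ^ a * (3 * ‖w'‖ₑ) ^ (-a) := by
          rw [ENNReal.mul_rpow_of_ne_top (by simp) (by simp), ← mul_assoc,
            ← ENNReal.rpow_add _ _ (by simp) (by simp)]
          simp
      _ ≤ _ := mul_le_mul' le_rfl (rpow_neg_le_rpow_neg ha0 h3)
  have hunit : ∀ e : E n, ‖e‖ = 1 →
      ∫⁻ z, ‖e - z‖ₑ ^ (-a) * ‖z‖ₑ ^ (-a) ≤ 3 ^ a * C + 3 ^ a * C := by
    intro e he
    have hp : ∀ z, ‖e - z‖ₑ ^ (-a) * ‖z‖ₑ ^ (-a) ≤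
        3 ^ a * (‖e - z‖ₑ ^ (-a) * (1 + ‖z‖ₑ) ^ (-a)) +
        3 ^ a * (‖e - (e - z)‖ₑ ^ (-a) * (1 + ‖e - z‖ₑ) ^ (-a)) := by
      intro z
      have h1 : 1 ≤ ‖e - z‖ + ‖z‖ := by
        rw [← he]; simpa using norm_add_le (e - z) z
      rcases le_total ‖e - z‖ ‖z‖ with h | h
      · refine le_trans ?_ le_self_add
        rw [mul_left_comm]
        exact mul_le_mul' le_rfl (hlow _ _ h h1)
      · refine le_trans ?_ le_add_self
        rw [sub_sub_cancel, mul_left_comm, mul_comm]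
        exact mul_le_mul' le_rfl (hlow _ _ h (by linarith))
    have hm : Measurable fun z : E n => ‖e - z‖ₑ ^ (-a) * (1 + ‖z‖ₑ) ^ (-a) := by fun_prop
    calc _ ≤ _ := lintegral_mono hp
      _ = 3 ^ a * (∫⁻ z, ‖e - z‖ₑ ^ (-a) * (1 + ‖z‖ₑ) ^ (-a)) +
          3 ^ a * ∫⁻ z, ‖e - (e - z)‖ₑ ^ (-a) * (1 + ‖e - z‖ₑ) ^ (-a) := by
          rw [lintegral_add_left (hm.const_mul _), lintegral_const_mul' _ _ h3t.ne,
            lintegral_const_mul' _ _ h3t.ne]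
      _ ≤ _ := by
          rw [lintegral_sub_left_eq_self (fun z => ‖e - z‖ₑ ^ (-a) * (1 + ‖z‖ₑ) ^ (-a)) e]
          gcongr
          · exact hb e
          · exact hb e
  intro x y hxy
  have hR : 0 < ‖x - y‖ := norm_pos_iff.2 (sub_ne_zero.2 hxy)
  set R := ‖x - y‖ with hRd
  set e := R⁻¹ • (x - y) with he
  have he1 : ‖e‖ = 1 := by
    rw [he, norm_smul, norm_inv, Real.norm_eq_abs, abs_of_pos hR, inv_mul_cancel₀ hR.ne']
  have hxe : x - y = R • e := by rw [he, smul_smul, mul_inv_cancel₀ hR.ne', one_smul]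
  have e0 : ∫⁻ z, ‖x - z‖ₑ ^ (-a) * ‖y - z‖ₑ ^ (-a) =
      ∫⁻ z, ‖(x - y) - z‖ₑ ^ (-a) * ‖z‖ₑ ^ (-a) := by
    rw [← lintegral_add_left_eq_self _ y]
    refine lintegral_congr fun z => ?_
    rw [sub_add_eq_sub_sub, sub_add_cancel_left, enorm_neg]
  have e1 := Measure.map_addHaar_smul (volume : Measure (E n)) hR.ne'
  have hsm : Measurable fun z : E n => R • z := by fun_prop
  have e2 : ∫⁻ z, ‖(x - y) - z‖ₑ ^ (-a) * ‖z‖ₑ ^ (-a) = ENNReal.ofReal (R ^ n) *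
      ∫⁻ z, ‖(x - y) - R • z‖ₑ ^ (-a) * ‖R • z‖ₑ ^ (-a) := by
    have hm : Measurable fun z : E n => ‖(x - y) - z‖ₑ ^ (-a) * ‖z‖ₑ ^ (-a) := by fun_prop
    rw [← lintegral_map (f := fun z : E n => ‖(x - y) - z‖ₑ ^ (-a) * ‖z‖ₑ ^ (-a)) hm hsm, e1,
      lintegral_smul_measure, smul_eq_mul, ← mul_assoc, ← ENNReal.ofReal_mul (by positivity)]
    simp only [finrank_euclideanSpace, Fintype.card_fin]
    rw [abs_of_pos (by positivity), mul_inv_cancel₀ (by positivity), ENNReal.ofReal_one, one_mul]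
  have hRe : ‖x - y‖ₑ = ENNReal.ofReal R := (ofReal_norm _).symm
  have e3 : ∀ z : E n, ‖R • z‖ₑ ^ (-a) = ENNReal.ofReal R ^ (-a) * ‖z‖ₑ ^ (-a) := by
    intro z
    rw [enorm_smul, Real.enorm_eq_ofReal hR.le, ENNReal.mul_rpow_of_ne_top (by simp) (by simp)]
  have e4 : ∀ z : E n, ‖(x - y) - R • z‖ₑ ^ (-a) * ‖R • z‖ₑ ^ (-a) =
      (ENNReal.ofReal R ^ (-a) * ENNReal.ofReal R ^ (-a)) * (‖e - z‖ₑ ^ (-a) * ‖z‖ₑ ^ (-a)) := by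
    intro z
    rw [hxe, ← smul_sub, e3, e3]; ring
  have hR0 : ENNReal.ofReal R ≠ 0 := by simpa using hR
  rw [e0, e2]
  simp only [e4]
  rw [lintegral_const_mul' _ _ (ENNReal.mul_ne_top
    (ENNReal.rpow_ne_top_of_ne_zero hR0 (by simp)) (ENNReal.rpow_ne_top_of_ne_zero hR0 (by simp))),
    ← mul_assoc, mul_comm, hRe]
  refine mul_le_mul' (hunit e he1) (le_of_eq ?_)
  rw [ENNReal.ofReal_pow hR.le, ← ENNReal.rpow_natCast, ← ENNReal.rpow_add _ _ hR0 (by simp),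
    ← ENNReal.rpow_add _ _ hR0 (by simp)]
  congr 1
  rw [ha]; ring

end Kernel

section Schur
variable {α : Type*} [MeasurableSpace α] {μ : Measure α} [SFinite μ] {k K : α → α → ℝ≥0∞}
  {w U G φ : α → ℝ≥0∞} {c C N : ℝ≥0∞}

lemma lintegral_mul_lintegral_kernel (mk : Measurable (Function.uncurry k)) (mφ : Measurable φ)
    (hG : Measurable G) :
    ∫⁻ x, φ x * ∫⁻ z, k x z * G z ∂μ ∂μ = ∫⁻ z, (∫⁻ x, φ x * k x z ∂μ) * G z ∂μ := by
  calc _ = ∫⁻ x, ∫⁻ z, φ x * (k x z * G z) ∂μ ∂μ :=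
        lintegral_congr fun x => (lintegral_const_mul _ (mk.of_uncurry_left.mul hG)).symm
    _ = ∫⁻ z, ∫⁻ x, φ x * (k x z * G z) ∂μ ∂μ := by
        refine lintegral_lintegral_swap (Measurable.aemeasurable ?_)
        exact (mφ.comp measurable_fst).mul (mk.mul (hG.comp measurable_snd))
    _ = _ := by
        refine lintegral_congr fun z => ?_
        refine Eq.trans (lintegral_congr fun x => (mul_assoc _ _ _).symm)
          (lintegral_mul_const _ (mφ.mul mk.of_uncurry_right))

/-- Schur's test for a symmetric kernel. -/
lemma lintegral_lintegral_le_of_symm (mK : Measurable (Function.uncurry K))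
    (hKs : ∀ x y, K x y = K y x) (hw : Measurable w) (hU : Measurable U)
    (hN : ∀ x, ∫⁻ y, w y * K x y ∂μ ≤ N) :
    ∫⁻ x, w x * U x * ∫⁻ y, w y * U y * K x y ∂μ ∂μ ≤ 2 * N * ∫⁻ x, w x * U x ^ 2 ∂μ := by
  have m1 : Measurable fun p : α × α => w p.1 * U p.1 ^ 2 * (w p.2 * K p.1 p.2) :=
    ((hw.mul (hU.pow_const 2)).comp measurable_fst).mul ((hw.comp measurable_snd).mul mK)
  have h4 : ∀ a b : ℝ≥0∞, a * b ≤ a ^ 2 + b ^ 2 := by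
    intro a b
    rcases le_total a b with h | h
    · refine le_trans ?_ le_add_self
      rw [sq]; gcongr
    · refine le_trans ?_ le_self_add
      rw [sq]; gcongr
  have h5 : ∫⁻ x, ∫⁻ y, w x * U x ^ 2 * (w y * K x y) ∂μ ∂μ ≤ N * ∫⁻ x, w x * U x ^ 2 ∂μ := by
    calc _ = ∫⁻ x, w x * U x ^ 2 * ∫⁻ y, w y * K x y ∂μ ∂μ :=
          lintegral_congr fun x => lintegral_const_mul _ (hw.mul mK.of_uncurry_left)
      _ ≤ ∫⁻ x, w x * U x ^ 2 * N ∂μ := lintegral_mono fun x => mul_le_mul' le_rfl (hN x)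
      _ = _ := 
          (lintegral_mul_const _ (hw.mul (hU.pow_const 2))).trans (mul_comm _ _)
  calc ∫⁻ x, w x * U x * ∫⁻ y, w y * U y * K x y ∂μ ∂μ
      = ∫⁻ x, ∫⁻ y, w x * U x * (w y * U y * K x y) ∂μ ∂μ :=
        lintegral_congr fun x =>
          (lintegral_const_mul _ ((hw.mul hU).mul mK.of_uncurry_left)).symm
    _ ≤ ∫⁻ x, ∫⁻ y, (w x * U x ^ 2 * (w y * K x y) + w y * U y ^ 2 * (w x * K y x)) ∂μ ∂μ := by
        refine lintegral_mono fun x => lintegral_mono fun y => ?_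
        rw [hKs y x]
        calc w x * U x * (w y * U y * K x y) = w x * w y * K x y * (U x * U y) := by ring
          _ ≤ w x * w y * K x y * (U x ^ 2 + U y ^ 2) := mul_le_mul' le_rfl (h4 _ _)
          _ = _ := by ring
    _ = ∫⁻ x, ∫⁻ y, w x * U x ^ 2 * (w y * K x y) ∂μ ∂μ +
          ∫⁻ x, ∫⁻ y, w y * U y ^ 2 * (w x * K y x) ∂μ ∂μ := by
        rw [← lintegral_add_left m1.lintegral_prod_right']
        exact lintegral_congr fun x => lintegral_add_left (m1.comp measurable_prodMk_left) _
    _ = ∫⁻ x, ∫⁻ y, w x * U x ^ 2 * (w y * K x y) ∂μ ∂μ +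
          ∫⁻ x, ∫⁻ y, w x * U x ^ 2 * (w y * K x y) ∂μ ∂μ := by
        congr 1
        exact lintegral_lintegral_swap (m1.comp measurable_swap).aemeasurable
    _ ≤ N * ∫⁻ x, w x * U x ^ 2 ∂μ + N * ∫⁻ x, w x * U x ^ 2 ∂μ := add_le_add h5 h5
    _ = _ := by ring

/-- The `T Tᵗ` argument: a weighted `L²` estimate for functions dominated by an integral operator
whose composition with its transpose has a kernel satisfying Schur's condition. -/
lemma weighted_sq_le_of_kernel_comp (mk : Measurable (Function.uncurry k))
    (mK : Measurable (Function.uncurry K)) (hKs : ∀ x y, K x y = K y x) (hC : C ≠ ⊤)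
    (hJ : ∀ x, ∀ᵐ y ∂μ, ∫⁻ z, k y z * k x z ∂μ ≤ C * K x y)
    (hw : Measurable w) (hU : Measurable U) (hG : Measurable G)
    (hUG : ∀ x, U x ≤ c * ∫⁻ z, k x z * G z ∂μ) (hN : ∀ x, ∫⁻ y, w y * K x y ∂μ ≤ N)
    (hfin : ∫⁻ x, w x * U x ^ 2 ∂μ ≠ ⊤) :
    ∫⁻ x, w x * U x ^ 2 ∂μ ≤ c ^ 2 * (2 * C * N) * ∫⁻ x, G x ^ (2 : ℝ) ∂μ := by
  have mφ : Measurable fun x => w x * U x := hw.mul hU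
  obtain ⟨H, hH⟩ : ∃ H : α → ℝ≥0∞, ∀ z, H z = ∫⁻ x, w x * U x * k x z ∂μ := ⟨_, fun _ => rfl⟩
  obtain ⟨Y, hY⟩ : ∃ Y, Y = ∫⁻ x, w x * U x ^ 2 ∂μ := ⟨_, rfl⟩
  have mH : Measurable H := by
    rw [funext hH]
    exact Measurable.lintegral_prod_left' (f := fun p : α × α => w p.1 * U p.1 * k p.1 p.2)
      ((mφ.comp measurable_fst).mul mk)
  have swap : ∀ g : α → ℝ≥0∞, Measurable g →
      ∫⁻ x, w x * U x * ∫⁻ z, k x z * g z ∂μ ∂μ = ∫⁻ z, H z * g z ∂μ := by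
    intro g hg
    rw [lintegral_mul_lintegral_kernel mk mφ hg]
    exact lintegral_congr fun z => by rw [hH]
  have h1 : Y ≤ c * ∫⁻ z, H z * G z ∂μ := by
    calc Y = ∫⁻ x, w x * U x * U x ∂μ := by
          rw [hY]; exact lintegral_congr fun x => by ring
      _ ≤ ∫⁻ x, c * (w x * U x * ∫⁻ z, k x z * G z ∂μ) ∂μ := by
          refine lintegral_mono fun x => ?_
          rw [mul_left_comm]
          exact mul_le_mul' le_rfl (hUG x)
      _ = _ := by
          rw [lintegral_const_mul, swap G hG]
          exact mφ.mul (Measurable.lintegral_prod_right' (mk.mul (hG.comp measurable_snd)))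
  have h2 : ∫⁻ z, H z * G z ∂μ ≤ (∫⁻ z, H z ^ (2 : ℝ) ∂μ) ^ (1 / 2 : ℝ) *
      (∫⁻ z, G z ^ (2 : ℝ) ∂μ) ^ (1 / 2 : ℝ) :=
    ENNReal.lintegral_mul_le_Lp_mul_Lq _ Real.HolderConjugate.two_two mH.aemeasurable
      hG.aemeasurable
  have hHx : ∀ x, ∫⁻ z, k x z * H z ∂μ ≤ C * ∫⁻ y, w y * U y * K x y ∂μ := by
    intro x
    calc ∫⁻ z, k x z * H z ∂μ = ∫⁻ y, w y * U y * ∫⁻ z, k y z * k x z ∂μ ∂μ := by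
          rw [swap (k x) mk.of_uncurry_left]; exact lintegral_congr fun z => mul_comm _ _
      _ ≤ ∫⁻ y, C * (w y * U y * K x y) ∂μ := by
          refine lintegral_mono_ae ?_
          filter_upwards [hJ x] with y hy
          rw [mul_left_comm]
          exact mul_le_mul' le_rfl hy
      _ = _ := lintegral_const_mul' _ _ hC
  have h3 : ∫⁻ z, H z ^ (2 : ℝ) ∂μ ≤ 2 * C * N * Y := by
    calc ∫⁻ z, H z ^ (2 : ℝ) ∂μ = ∫⁻ x, w x * U x * ∫⁻ z, k x z * H z ∂μ ∂μ := by
          rw [swap H mH]; exact lintegral_congr fun z => by rw [ENNReal.rpow_two, sq]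
      _ ≤ ∫⁻ x, C * (w x * U x * ∫⁻ y, w y * U y * K x y ∂μ) ∂μ := by
          refine lintegral_mono fun x => ?_
          rw [mul_left_comm]
          exact mul_le_mul' le_rfl (hHx x)
      _ = C * ∫⁻ x, w x * U x * ∫⁻ y, w y * U y * K x y ∂μ ∂μ := lintegral_const_mul' _ _ hC
      _ ≤ C * (2 * N * Y) := by
          rw [hY]
          exact mul_le_mul' le_rfl (lintegral_lintegral_le_of_symm mK hKs hw hU hN)
      _ = _ := by ring
  obtain ⟨X, hX⟩ : ∃ X, X = ∫⁻ x, G x ^ (2 : ℝ) ∂μ := ⟨_, rfl⟩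
  rw [← hY] at hfin ⊢
  rw [← hX] at h2 ⊢
  have h4 : Y * Y ≤ (c ^ 2 * (2 * C * N) * X) * Y := by
    have h5 : Y ≤ c * ((2 * C * N * Y) ^ (1 / 2 : ℝ) * X ^ (1 / 2 : ℝ)) :=
      h1.trans (mul_le_mul' le_rfl (h2.trans (mul_le_mul' (ENNReal.rpow_le_rpow h3 (by norm_num))
        le_rfl)))
    have hs : ∀ a : ℝ≥0∞, a ^ (1 / 2 : ℝ) * a ^ (1 / 2 : ℝ) = a := fun a => by
      rw [← ENNReal.rpow_add_of_nonneg _ _ (by norm_num) (by norm_num)]; norm_num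
    refine (mul_le_mul' h5 h5).trans (le_of_eq ?_)
    calc _ = c ^ 2 * ((2 * C * N * Y) ^ (1 / 2 : ℝ) * (2 * C * N * Y) ^ (1 / 2 : ℝ)) *
          (X ^ (1 / 2 : ℝ) * X ^ (1 / 2 : ℝ)) := by ring
      _ = _ := by rw [hs, hs]; ring
  rcases eq_or_ne Y 0 with h0 | h0
  · rw [h0]; exact zero_le
  · exact (ENNReal.mul_le_mul_iff_left h0 hfin).1 h4

end Schur

/-- If `U` is dominated by the Riesz potential of order one of `G` and the Newtonian potential of the
weight `w` is bounded by `N`, then `∫ w U² ≲ N ∫ G²`. Schur's test applies because the composition of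
two Riesz kernels of order one is bounded by one of order two. -/
lemma exists_weighted_riesz_le {n : ℕ} (hn : 3 ≤ n) : ∃ C : ℝ≥0∞, C < ⊤ ∧
    ∀ {w U G : E n → ℝ≥0∞} {c N : ℝ≥0∞}, Measurable w → Measurable U → Measurable G →
    (∀ x, U x ≤ c * ∫⁻ z, ‖x - z‖ₑ ^ (-((n : ℝ) - 1)) * G z) →
    (∀ x, ∫⁻ y, w y * ‖x - y‖ₑ ^ (-((n : ℝ) - 2)) ≤ N) →
    ∫⁻ x, w x * U x ^ 2 ≠ ⊤ →
    ∫⁻ x, w x * U x ^ 2 ≤ c ^ 2 * (2 * C * N) * ∫⁻ x, G x ^ (2 : ℝ) := by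
  obtain ⟨C, hC, hJ⟩ := exists_riesz_comp_le hn
  refine ⟨C, hC, fun {w U G c N} hw hU hG hUG hN hfin => ?_⟩
  have : Nontrivial (E n) := by
    have : Nonempty (Fin n) := ⟨⟨0, by omega⟩⟩
    infer_instance
  refine weighted_sq_le_of_kernel_comp (k := fun x z => ‖x - z‖ₑ ^ (-((n : ℝ) - 1)))
    (K := fun x y => ‖x - y‖ₑ ^ (-((n : ℝ) - 2))) ?_ ?_ (fun x y => ?_) hC.ne (fun x => ?_)
    hw hU hG hUG hN hfin
  · exact (measurable_fst.sub measurable_snd).enorm.pow_const _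
  · exact (measurable_fst.sub measurable_snd).enorm.pow_const _
  · rw [← enorm_neg, neg_sub]
  · have hne : ∀ᵐ y : E n, y ≠ x := by simp [ae_iff]
    filter_upwards [hne] with y hy
    exact le_trans (le_of_eq (lintegral_congr fun z => mul_comm _ _)) (hJ x y hy.symm)

/-! ### The a priori bound -/

/-- The estimates for a solution from which the bound on the head pressure is deduced: `U` and `G`
stand for the sizes of the velocity and of its gradient, `Θ` for the positive part of the head
pressure, and `K` for the support of the force. -/
structure AprioriEstimates (n : ℕ) (C : ℝ≥0∞) (K : Set (E n)) (U G Θ : E n → ℝ≥0∞) : Prop where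
  meas_U : Measurable U
  meas_G : Measurable G
  meas_Θ : Measurable Θ
  meas_K : MeasurableSet K
  volume_K : volume K ≤ C
  sobolev : (∫⁻ x, U x ^ (2 * n / (n - 2) : ℝ)) ^ ((n - 2) / n : ℝ) ≤ C * ∫⁻ x, G x ^ (2 : ℝ)
  energy : ∫⁻ x, G x ^ (2 : ℝ) ≤ C * ∫⁻ x in K, U x
  riesz : ∀ x, U x ≤ C * ∫⁻ z, ‖x - z‖ₑ ^ (-((n : ℝ) - 1)) * G z
  head : ∀ q : ℝ, 1 < q → q = 5 / 4 ∨ q = (n - 4) / 2 + 1 / 10 →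
    (∫⁻ x, Θ x ^ ((q + 1) * n / (n - 2) : ℝ)) ^ ((n - 2) / n : ℝ) ≤
      C * ((∫⁻ x in K, U x * Θ x ^ q) + ∫⁻ x in K, Θ x ^ (q - 1))
  weighted : 7 ≤ n → ∀ x, ∫⁻ y, U y ^ (2 : ℝ) * ‖x - y‖ₑ ^ (-((n : ℝ) - 21 / 10)) ≤
    C * ((∫⁻ y, Θ y * ‖x - y‖ₑ ^ (-((n : ℝ) - 21 / 10))) +
      ∫⁻ y in K, ‖x - y‖ₑ ^ (-((n : ℝ) - 31 / 10)))
  fin_U : ∫⁻ x, U x ^ (2 * n / (n - 2) : ℝ) ≠ ⊤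
  fin_U_K : ∫⁻ x in K, U x ^ (19 / 5 : ℝ) ≠ ⊤
  fin_Θ : ∀ r : ℝ, 2 ≤ r → ∫⁻ x, Θ x ^ r ≠ ⊤

/-- Cancellation of the power `q` in the head pressure estimate; `A` has to be finite for this. -/
lemma le_of_rpow_add_one_le {A c d : ℝ≥0∞} {q : ℝ} (hq : 1 < q) (hA : A ≠ ⊤)
    (h : A ^ (q + 1) ≤ c * A ^ q + d * A ^ (q - 1)) : A ≤ 1 + c + d := by
  rcases le_total A 1 with h1 | h1
  · exact h1.trans (by rw [add_assoc]; exact le_self_add)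
  have h0 : A ≠ 0 := (zero_lt_one.trans_le h1).ne'
  have hq0 : A ^ q ≠ 0 := by simp [ENNReal.rpow_eq_zero_iff, h0, hA]
  have hqt : A ^ q ≠ ⊤ := ENNReal.rpow_ne_top_of_nonneg (by linarith) hA
  have h2 : A ^ (q - 1) ≤ A ^ q := ENNReal.rpow_le_rpow_of_exponent_le h1 (by linarith)
  have h3 : A * A ^ q ≤ (c + d) * A ^ q := by
    calc A * A ^ q = A ^ (q + 1) := by
          rw [ENNReal.rpow_add _ _ h0 hA, ENNReal.rpow_one, mul_comm]
      _ ≤ c * A ^ q + d * A ^ q := h.trans (by gcongr)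
      _ = _ := by ring
  refine ((ENNReal.mul_le_mul_iff_left hq0 hqt).1 h3).trans ?_
  rw [add_assoc]; exact le_add_self

namespace AprioriEstimates
variable {n : ℕ} {C : ℝ≥0∞} {K : Set (E n)} {U G Θ : E n → ℝ≥0∞}

lemma rpow_volume_le (H : AprioriEstimates n C K U G Θ) {s : ℝ} (hs : 0 ≤ s) :
    (volume.restrict K) univ ^ s ≤ C ^ s := by
  rw [Measure.restrict_apply_univ]
  exact ENNReal.rpow_le_rpow H.volume_K hs

lemma setLIntegral_U_le (H : AprioriEstimates n C K U G Θ) (hn : 3 ≤ n) :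
    ∫⁻ x in K, U x ≤ (∫⁻ x, U x ^ (2 * n / (n - 2) : ℝ)) ^ ((n - 2) / (2 * n) : ℝ) *
      C ^ (1 - (n - 2) / (2 * n) : ℝ) := by
  have hn3 : (3 : ℝ) ≤ n := by exact_mod_cast hn
  have hp : 0 < (2 * n / (n - 2) : ℝ) := div_pos (by linarith) (by linarith)
  have hle : ((n - 2) / (2 * n) : ℝ) ≤ 1 := by rw [div_le_one (by linarith)]; linarith
  have h := lintegral_rpow_mul_rpow_le (μ := volume.restrict K) H.meas_U.aemeasurable
    (aemeasurable_const (b := (1 : ℝ≥0∞))) hp one_pos zero_le_one le_rfl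
    (by rw [one_div_div]; linarith)
  rw [one_div_div] at h
  simp only [ENNReal.rpow_one, mul_one, zero_div, ENNReal.rpow_zero, sub_zero] at h
  refine h.trans (mul_le_mul' (ENNReal.rpow_le_rpow ?_ ?_) (H.rpow_volume_le (by linarith)))
  · exact lintegral_mono' Measure.restrict_le_self le_rfl
  · exact div_nonneg (by linarith) (by linarith)

/-- The energy estimate bounds the gradient in `L²` and the velocity in the Sobolev exponent. -/
lemma energy_bound (H : AprioriEstimates n C K U G Θ) (hn : 3 ≤ n) :
    (∫⁻ x, U x ^ (2 * n / (n - 2) : ℝ)) ^ ((n - 2) / (2 * n) : ℝ) ≤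
      C * C * C ^ (1 - (n - 2) / (2 * n) : ℝ) := by
  have hn3 : (3 : ℝ) ≤ n := by exact_mod_cast hn
  obtain ⟨X, hX⟩ : ∃ X, X = ∫⁻ x, U x ^ (2 * n / (n - 2) : ℝ) := ⟨_, rfl⟩
  obtain ⟨N, hN⟩ : ∃ N, N = X ^ ((n - 2) / (2 * n) : ℝ) := ⟨_, rfl⟩
  have hXt : X ≠ ⊤ := hX ▸ H.fin_U
  have hNt : N ≠ ⊤ := hN ▸ ENNReal.rpow_ne_top_of_nonneg
    (div_nonneg (by linarith) (by linarith)) hXt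
  have h1 := H.sobolev.trans (mul_le_mul' le_rfl (H.energy.trans
    (mul_le_mul' le_rfl (H.setLIntegral_U_le hn))))
  rw [← hX, ← hN] at h1 ⊢
  have h2 : X ^ ((n - 2) / n : ℝ) = N * N := by
    rw [hN, ← ENNReal.rpow_add_of_nonneg _ _ (div_nonneg (by linarith) (by linarith))
      (div_nonneg (by linarith) (by linarith))]
    congr 1
    field_simp
    ring
  rw [h2] at h1
  rcases eq_or_ne N 0 with h0 | h0
  · rw [h0]; exact zero_le
  · refine (ENNReal.mul_le_mul_iff_left h0 hNt).1 (h1.trans (le_of_eq ?_))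
    ring

/-- The head pressure is controlled in `Lʳ`, `r = (q + 1) n / (n - 2)`, by an integral norm of the
velocity on the support of the force. -/
lemma head_bound (H : AprioriEstimates n C K U G Θ) (hn : 3 ≤ n) {q a r : ℝ} (hq : 1 < q)
    (hqn : q = 5 / 4 ∨ q = (n - 4) / 2 + 1 / 10) (ha : 0 < a) (hr : r = (q + 1) * n / (n - 2))
    (haq : 1 / a + q / r ≤ 1) :
    (∫⁻ x, Θ x ^ r) ^ (1 / r) ≤ 1 + C * (∫⁻ x in K, U x ^ a) ^ (1 / a) *
      C ^ (1 - 1 / a - q / r) + C * C ^ (1 - (q - 1) / r) := by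
  have hn3 : (3 : ℝ) ≤ n := by exact_mod_cast hn
  have hr2 : 2 ≤ r := by
    rw [hr, le_div_iff₀ (by linarith)]
    nlinarith
  have hr0 : 0 < r := by linarith
  obtain ⟨X, hX⟩ : ∃ X, X = ∫⁻ x, Θ x ^ r := ⟨_, rfl⟩
  obtain ⟨A, hA⟩ : ∃ A, A = X ^ (1 / r) := ⟨_, rfl⟩
  have hXt : X ≠ ⊤ := hX ▸ H.fin_Θ r hr2
  have hAt : A ≠ ⊤ := hA ▸ ENNReal.rpow_ne_top_of_nonneg (by positivity) hXt
  have hpow : ∀ s : ℝ, X ^ (s / r) = A ^ s := fun s => by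
    rw [hA, ← ENNReal.rpow_mul]; congr 1; ring
  have h1 := H.head q hq hqn
  rw [← hr, ← hX] at h1
  have h2 : X ^ ((n - 2) / n : ℝ) = A ^ (q + 1) := by
    rw [← hpow, hr]
    congr 1
    have : (n : ℝ) - 2 ≠ 0 := by linarith
    have : q + 1 ≠ 0 := by linarith
    field_simp
  have hKX : ∫⁻ x in K, Θ x ^ r ≤ X := hX ▸ lintegral_mono' Measure.restrict_le_self le_rfl
  have h3 : ∫⁻ x in K, U x * Θ x ^ q ≤
      (∫⁻ x in K, U x ^ a) ^ (1 / a) * A ^ q * C ^ (1 - 1 / a - q / r) := by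
    have h := lintegral_rpow_mul_rpow_le (μ := volume.restrict K) H.meas_U.aemeasurable
      H.meas_Θ.aemeasurable ha hr0 zero_le_one (by linarith : 0 ≤ q) haq
    simp only [ENNReal.rpow_one] at h
    refine h.trans (mul_le_mul' (mul_le_mul' le_rfl ?_) (H.rpow_volume_le (by linarith)))
    rw [← hpow]
    exact ENNReal.rpow_le_rpow hKX (by positivity)
  have h4 : ∫⁻ x in K, Θ x ^ (q - 1) ≤ A ^ (q - 1) * C ^ (1 - (q - 1) / r) := by
    have hle : (q - 1) / r ≤ 1 := by
      have : q / r ≤ 1 := by have : 0 < 1 / a := by positivity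
                             linarith
      refine le_trans ?_ this
      gcongr
      linarith
    have h := lintegral_rpow_mul_rpow_le (μ := volume.restrict K) H.meas_Θ.aemeasurable
      (aemeasurable_const (b := (1 : ℝ≥0∞))) hr0 one_pos (by linarith : 0 ≤ q - 1) le_rfl
      (by linarith)
    simp only [ENNReal.one_rpow, mul_one, zero_div, ENNReal.rpow_zero, sub_zero] at h
    refine h.trans (mul_le_mul' ?_ (H.rpow_volume_le (by linarith)))
    rw [← hpow]
    exact ENNReal.rpow_le_rpow hKX (div_nonneg (by linarith) (by linarith))
  rw [← hX, ← hA]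
  refine le_of_rpow_add_one_le hq hAt ?_
  rw [← h2]
  refine h1.trans ((mul_le_mul' le_rfl (add_le_add h3 h4)).trans (le_of_eq ?_))
  ring

end AprioriEstimates

/-- The bounds that follow from the energy estimate alone. -/
lemma exists_energy_bounds {n : ℕ} (hn : 5 ≤ n) (hn15 : n ≤ 15) {C : ℝ≥0∞} (hC : C < ⊤) :
    ∃ B : ℝ≥0∞, B < ⊤ ∧ ∀ {K : Set (E n)} {U G Θ : E n → ℝ≥0∞}, AprioriEstimates n C K U G Θ →
      ∫⁻ x, G x ^ (2 : ℝ) ≤ B ∧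
      (∫⁻ x, Θ x ^ (9 / 4 * n / (n - 2) : ℝ)) ^ (1 / (9 / 4 * n / (n - 2)) : ℝ) ≤ B := by
  have hn3 : 3 ≤ n := by omega
  have hn5 : (5 : ℝ) ≤ n := by exact_mod_cast hn
  have hn15' : (n : ℝ) ≤ 15 := by exact_mod_cast hn15
  have hCr : ∀ {s : ℝ}, 0 ≤ s → C ^ s < ⊤ := fun hs => ENNReal.rpow_lt_top_of_nonneg hs hC.ne
  obtain ⟨N, hN⟩ : ∃ N, N = C * C * C ^ (1 - (n - 2) / (2 * n) : ℝ) := ⟨_, rfl⟩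
  have hle : ((n - 2) / (2 * n) : ℝ) ≤ 1 := by rw [div_le_one (by linarith)]; linarith
  have hNt : N < ⊤ := hN ▸ ENNReal.mul_lt_top (ENNReal.mul_lt_top hC hC) (hCr (by linarith))
  set r : ℝ := 9 / 4 * n / (n - 2) with hr
  set a : ℝ := 2 * n / (n - 2) with ha
  have hr0 : 0 < r := div_pos (by linarith) (by linarith)
  have ha0 : 0 < a := div_pos (by linarith) (by linarith)
  have ha1 : 1 / a = (n - 2) / (2 * n) := by rw [ha, one_div_div]
  have haq : 1 / a + 5 / 4 / r ≤ 1 := by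
    rw [ha1, hr, div_div_eq_mul_div, div_add_div _ _ (by linarith) (by linarith),
      div_le_one (by nlinarith)]
    nlinarith
  have haq' : (5 / 4 - 1) / r ≤ 1 := by
    have h1 : 0 < 1 / a := by positivity
    have h2 : (5 / 4 - 1) / r ≤ 5 / 4 / r := by gcongr; norm_num
    linarith
  refine ⟨C * (N * C ^ (1 - (n - 2) / (2 * n) : ℝ)) + (1 + C * N * C ^ (1 - 1 / a - 5 / 4 / r) +
    C * C ^ (1 - (5 / 4 - 1) / r)), ?_, fun {K U G Θ} H => ⟨?_, ?_⟩⟩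
  · have e1 := hCr (s := (1 - (n - 2) / (2 * n) : ℝ)) (by linarith)
    have e2 := hCr (s := 1 - 1 / a - 5 / 4 / r) (by linarith)
    have e3 := hCr (s := 1 - (5 / 4 - 1) / r) (by linarith)
    simp only [ENNReal.add_lt_top]
    exact ⟨ENNReal.mul_lt_top hC (ENNReal.mul_lt_top hNt e1), ⟨ENNReal.one_lt_top,
      ENNReal.mul_lt_top (ENNReal.mul_lt_top hC hNt) e2⟩, ENNReal.mul_lt_top hC e3⟩
  · refine le_trans ?_ le_self_add
    refine H.energy.trans (mul_le_mul' le_rfl ((H.setLIntegral_U_le hn3).trans ?_))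
    refine mul_le_mul' ?_ le_rfl
    rw [hN]
    exact H.energy_bound hn3
  · refine le_trans ?_ le_add_self
    refine (H.head_bound hn3 (by norm_num) (Or.inl rfl) ha0 (by rw [hr]; norm_num) haq).trans ?_
    gcongr
    rw [hN]
    refine le_trans ?_ (H.energy_bound hn3)
    rw [ha1]
    refine ENNReal.rpow_le_rpow ?_ (div_nonneg (by linarith) (by linarith))
    exact lintegral_mono' Measure.restrict_le_self le_rfl

/-- In high dimensions the weighted estimate closes a sublinear bootstrap for the norm of the head
pressure in an exponent slightly above `n / 2`. -/
lemma exists_head_bound {n : ℕ} (hn : 7 ≤ n) (hn15 : n ≤ 15) {C : ℝ≥0∞} (hC : C < ⊤) {r : ℝ}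
    (hr : r = ((n - 4) / 2 + 1 / 10 + 1) * n / (n - 2)) :
    ∃ B : ℝ≥0∞, B < ⊤ ∧ ∀ {K : Set (E n)} {U G Θ : E n → ℝ≥0∞}, AprioriEstimates n C K U G Θ →
      (∫⁻ x, Θ x ^ r) ^ (1 / r) ≤ B := by
  have hn0 : 0 < n := by omega
  have hn3 : 3 ≤ n := by omega
  have hn7 : (7 : ℝ) ≤ n := by exact_mod_cast hn
  have hn15' : (n : ℝ) ≤ 15 := by exact_mod_cast hn15
  have hCr : ∀ {s : ℝ}, 0 ≤ s → C ^ s < ⊤ := fun hs => ENNReal.rpow_lt_top_of_nonneg hs hC.ne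
  set q : ℝ := (n - 4) / 2 + 1 / 10 with hq
  have hq1 : 1 < q := by rw [hq]; linarith
  set s : ℝ := 9 / 4 * n / (n - 2) with hs
  obtain ⟨B₁, hB₁, hb₁⟩ := exists_energy_bounds (by omega : 5 ≤ n) hn15 hC
  have hr1 : n / 2 < r := by
    rw [hr, hq, div_lt_div_iff₀ (by norm_num) (by linarith)]
    nlinarith
  have hr0 : 0 < r := by linarith
  have hs1 : 1 < s := by rw [hs, lt_div_iff₀ (by linarith)]; linarith
  -- The kernel `|x| ^ (21 / 10 - n)` is in the dual of `Lʳ` near the origin because `r > n / 2`, and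
  -- in the dual of `Lˢ` at infinity.
  obtain ⟨C₁, hC₁, hc₁⟩ := exists_riesz_le_rpow hn0 (a := n - 21 / 10) (r := r) (s := s)
    (by linarith) (by linarith) hs1
    (by
      rw [mul_div_assoc', div_lt_iff₀ (by linarith)]
      nlinarith)
    (by
      rw [mul_div_assoc', lt_div_iff₀ (by linarith)]
      have h1 : s * (n - 2) = 9 / 4 * n := by rw [hs, div_mul_cancel₀]; linarith
      have h2 : 21 / 10 * s < n := by
        rw [hs, ← mul_div_assoc, div_lt_iff₀ (by linarith)]
        nlinarith
      linarith)
  obtain ⟨C₂, hC₂, hc₂⟩ := exists_setLIntegral_enorm_rpow_le hn0 (a := n - 31 / 10)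
    (by linarith) (by linarith)
  obtain ⟨C₃, hC₃, hc₃⟩ := exists_setLIntegral_enorm_rpow_le hn0 (a := n - 11 / 10)
    (by linarith) (by linarith)
  obtain ⟨C₄, hC₄, hc₄⟩ := exists_weighted_riesz_le (n := n) hn3
  -- The condition that limits the dimension: it holds for `n = 15` and fails for `n = 16`.
  have haq : 1 / (19 / 5) + q / r ≤ 1 := by
    have h1 : q / r = q * (n - 2) / ((q + 1) * n) := by rw [hr]; field_simp
    rw [h1, ← le_sub_iff_add_le', div_le_iff₀ (by nlinarith), hq]
    nlinarith
  -- The constants of the successive estimates.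
  set D₁ := C * (C₁ * (1 + B₁) + (C₂ + C)) with hD₁
  set D₂ := D₁ ^ (9 / 10 : ℝ) * (C₃ + C) ^ (1 / 10 : ℝ) with hD₂
  set D₃ := C ^ 2 * (2 * C₄ * D₂) * B₁ with hD₃
  set D₄ := C * D₃ ^ (5 / 19 : ℝ) * C ^ (1 - 1 / (19 / 5) - q / r) with hD₄
  set D₅ := 2 + C * C ^ (1 - (q - 1) / r) + D₄ with hD₅
  have hle : (q - 1) / r ≤ 1 := by
    rw [div_le_one hr0]
    have : q ≤ r := by
      have : q / r ≤ 1 := by linarith [(by norm_num : (0 : ℝ) < 1 / (19 / 5))]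
      rwa [div_le_one hr0] at this
    linarith
  have hD₁t : D₁ < ⊤ := ENNReal.mul_lt_top hC (ENNReal.add_lt_top.2
    ⟨ENNReal.mul_lt_top hC₁ (ENNReal.add_lt_top.2 ⟨ENNReal.one_lt_top, hB₁⟩),
      ENNReal.add_lt_top.2 ⟨hC₂, hC⟩⟩)
  have hD₂t : D₂ < ⊤ := ENNReal.mul_lt_top (ENNReal.rpow_lt_top_of_nonneg (by norm_num) hD₁t.ne)
    (ENNReal.rpow_lt_top_of_nonneg (by norm_num) (ENNReal.add_lt_top.2 ⟨hC₃, hC⟩).ne)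
  have hD₃t : D₃ < ⊤ := ENNReal.mul_lt_top (ENNReal.mul_lt_top (ENNReal.pow_lt_top hC)
    (ENNReal.mul_lt_top (ENNReal.mul_lt_top (by simp) hC₄) hD₂t)) hB₁
  have hD₄t : D₄ < ⊤ := ENNReal.mul_lt_top (ENNReal.mul_lt_top hC
    (ENNReal.rpow_lt_top_of_nonneg (by norm_num) hD₃t.ne)) (hCr (by linarith))
  have hD₅t : D₅ < ⊤ := ENNReal.add_lt_top.2 ⟨ENNReal.add_lt_top.2
    ⟨by simp, ENNReal.mul_lt_top hC (hCr (by linarith))⟩, hD₄t⟩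
  refine ⟨D₅ * D₅, ENNReal.mul_lt_top hD₅t hD₅t, fun {K U G Θ} H => ?_⟩
  clear_value D₁ D₂ D₃ D₄ D₅
  obtain ⟨A, hA⟩ : ∃ A, A = (∫⁻ x, Θ x ^ r) ^ (1 / r) := ⟨_, rfl⟩
  have hAt : A ≠ ⊤ := hA ▸ ENNReal.rpow_ne_top_of_nonneg (by positivity)
    (H.fin_Θ r (by linarith))
  have one_le : (1 : ℝ≥0∞) ≤ 1 + A := le_self_add
  -- The weighted estimate.
  have s1 : ∀ x, ∫⁻ y, U y ^ (2 : ℝ) * ‖x - y‖ₑ ^ (-((n : ℝ) - 21 / 10)) ≤ D₁ * (1 + A) := by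
    intro x
    calc _ ≤ C * (C₁ * (A + B₁) + (C₂ + C)) := by
          refine (H.weighted hn x).trans (mul_le_mul' le_rfl (add_le_add ?_ ?_))
          · refine (hc₁ Θ H.meas_Θ x).trans (mul_le_mul' le_rfl (add_le_add hA.ge (hb₁ H).2))
          · exact (hc₂ K x H.meas_K).trans (add_le_add le_rfl H.volume_K)
      _ ≤ C * (C₁ * ((1 + B₁) * (1 + A)) + (C₂ + C) * (1 + A)) := by
          gcongr
          · calc A + B₁ ≤ A + B₁ + (1 + B₁ * A) := le_self_add
              _ = _ := by ring
          · exact le_mul_of_one_le_right' one_le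
      _ = _ := by rw [hD₁]; ring
  -- Hölder's inequality with exponents `10 / 9` and `10`, where
  -- `n - 2 = (9 / 10) * (n - 21 / 10) + (1 / 10) * (n - 11 / 10)`.
  have s2 : ∀ x, ∫⁻ y, (K.indicator (fun y => U y ^ (9 / 5 : ℝ)) y) *
      ‖x - y‖ₑ ^ (-((n : ℝ) - 2)) ≤ D₂ * (1 + A) ^ (9 / 10 : ℝ) := by
    intro x
    have mk : ∀ b : ℝ, Measurable fun y : E n => ‖x - y‖ₑ ^ b := fun b =>
      (measurable_const.sub measurable_id).enorm.pow_const b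
    have e1 : ∫⁻ y, (K.indicator (fun y => U y ^ (9 / 5 : ℝ)) y) * ‖x - y‖ₑ ^ (-((n : ℝ) - 2)) =
        ∫⁻ y in K, U y ^ (9 / 5 : ℝ) * ‖x - y‖ₑ ^ (-((n : ℝ) - 2)) := by
      rw [← lintegral_indicator H.meas_K]
      refine lintegral_congr fun y => ?_
      by_cases hy : y ∈ K
      · simp [hy]
      · simp [hy]
    have e2 : ∀ᵐ y ∂volume.restrict K, U y ^ (9 / 5 : ℝ) * ‖x - y‖ₑ ^ (-((n : ℝ) - 2)) =
        (U y ^ (2 : ℝ) * ‖x - y‖ₑ ^ (-((n : ℝ) - 21 / 10))) ^ (9 / 10 : ℝ) *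
          (‖x - y‖ₑ ^ (-((n : ℝ) - 11 / 10))) ^ (1 / 10 : ℝ) := by
      have : Nontrivial (E n) := by
        have : Nonempty (Fin n) := ⟨⟨0, by omega⟩⟩
        infer_instance
      have hne : ∀ᵐ y : E n, y ≠ x := by simp [ae_iff]
      filter_upwards [ae_restrict_of_ae hne] with y hy
      have h0 : ‖x - y‖ₑ ≠ 0 := by simpa [sub_eq_zero] using hy.symm
      rw [ENNReal.mul_rpow_of_nonneg _ _ (by norm_num), ← ENNReal.rpow_mul, ← ENNReal.rpow_mul,
        ← ENNReal.rpow_mul, mul_assoc, ← ENNReal.rpow_add _ _ h0 (by simp)]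
      congr 2
      · norm_num
      · ring
    rw [e1, lintegral_congr_ae e2]
    refine (ENNReal.lintegral_mul_norm_pow_le ((H.meas_U.pow_const _).mul (mk _)).aemeasurable
      (mk _).aemeasurable (by norm_num) (by norm_num) (by norm_num)).trans ?_
    calc _ ≤ (D₁ * (1 + A)) ^ (9 / 10 : ℝ) * (C₃ + C) ^ (1 / 10 : ℝ) := by
          refine mul_le_mul' (ENNReal.rpow_le_rpow ?_ (by norm_num))
            (ENNReal.rpow_le_rpow ?_ (by norm_num))
          · exact (lintegral_mono' Measure.restrict_le_self le_rfl).trans (s1 x)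
          · exact (hc₃ K x H.meas_K).trans (add_le_add le_rfl H.volume_K)
      _ = _ := by rw [ENNReal.mul_rpow_of_nonneg _ _ (by norm_num), hD₂]; ring
  have e3 : ∫⁻ x, (K.indicator (fun y => U y ^ (9 / 5 : ℝ)) x) * U x ^ 2 =
      ∫⁻ x in K, U x ^ (19 / 5 : ℝ) := by
    rw [← lintegral_indicator H.meas_K]
    refine lintegral_congr fun y => ?_
    by_cases hy : y ∈ K
    · simp only [hy, indicator_of_mem]
      rw [← ENNReal.rpow_two, ← ENNReal.rpow_add_of_nonneg _ _ (by norm_num) (by norm_num)]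
      norm_num
    · simp [hy]
  -- Schur's test with the weight `1_K U ^ (9 / 5)`.
  have s3 : ∫⁻ x in K, U x ^ (19 / 5 : ℝ) ≤ D₃ * (1 + A) ^ (9 / 10 : ℝ) := by
    have h := hc₄ ((H.meas_U.pow_const (9 / 5)).indicator H.meas_K) H.meas_U H.meas_G H.riesz s2
      (by rw [e3]; exact H.fin_U_K)
    rw [e3] at h
    refine h.trans ((mul_le_mul' le_rfl (hb₁ H).1).trans (le_of_eq ?_))
    rw [hD₃]; ring
  -- The power of `1 + A` that arises is `9 / 38`; the weaker power `1 / 2` is enough to conclude.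
  have s4 : A ≤ 1 + D₄ * (1 + A) ^ (1 / 2 : ℝ) + C * C ^ (1 - (q - 1) / r) := by
    rw [hA]
    refine (H.head_bound hn3 hq1 (Or.inr hq) (by norm_num) hr haq).trans ?_
    rw [← hA]
    refine add_le_add (add_le_add le_rfl ?_) le_rfl
    calc C * (∫⁻ x in K, U x ^ (19 / 5 : ℝ)) ^ (1 / (19 / 5) : ℝ) * C ^ (1 - 1 / (19 / 5) - q / r)
        ≤ C * (D₃ * (1 + A) ^ (9 / 10 : ℝ)) ^ (5 / 19 : ℝ) * C ^ (1 - 1 / (19 / 5) - q / r) := by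
          rw [one_div_div]
          gcongr
      _ = D₄ * (1 + A) ^ (9 / 38 : ℝ) := by
          rw [ENNReal.mul_rpow_of_nonneg _ _ (by norm_num), ← ENNReal.rpow_mul, hD₄]
          norm_num
          ring
      _ ≤ _ := mul_le_mul' le_rfl (ENNReal.rpow_le_rpow_of_exponent_le one_le (by norm_num))
  have one_le' : (1 : ℝ≥0∞) ≤ (1 + A) ^ (1 / 2 : ℝ) := by
    simpa using ENNReal.rpow_le_rpow one_le (by norm_num : (0 : ℝ) ≤ 1 / 2)
  have hsq : (1 + A) ^ (1 / 2 : ℝ) * (1 + A) ^ (1 / 2 : ℝ) = 1 + A := by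
    rw [← ENNReal.rpow_add_of_nonneg _ _ (by norm_num) (by norm_num)]; norm_num
  have s5 : 1 + A ≤ D₅ * (1 + A) ^ (1 / 2 : ℝ) := by
    calc 1 + A ≤ (2 + C * C ^ (1 - (q - 1) / r)) * 1 + D₄ * (1 + A) ^ (1 / 2 : ℝ) := by
          refine (add_le_add le_rfl s4).trans (le_of_eq ?_)
          ring
      _ ≤ (2 + C * C ^ (1 - (q - 1) / r)) * (1 + A) ^ (1 / 2 : ℝ) +
          D₄ * (1 + A) ^ (1 / 2 : ℝ) := by gcongr
      _ = _ := by rw [hD₅]; ring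
  have s6 : (1 + A) ^ (1 / 2 : ℝ) ≤ D₅ := by
    have ht : (1 + A) ^ (1 / 2 : ℝ) ≠ ⊤ := ENNReal.rpow_ne_top_of_nonneg (by norm_num) (by simp [hAt])
    refine (ENNReal.mul_le_mul_iff_left (zero_lt_one.trans_le one_le').ne' ht).1 ?_
    rwa [hsq]
  rw [← hA]
  calc A ≤ 1 + A := le_add_self
    _ = _ := hsq.symm
    _ ≤ _ := mul_le_mul' s6 s6

/-! ### From the integral equation to the a priori estimates -/

section Prepare
variable {n : ℕ} {f u : E n → E n}

lemma norm_le_of_eLpNorm_top_le {g : E n → ℝ} (hg : Continuous g) {c : ℝ≥0∞}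
    (h : eLpNorm g ⊤ volume ≤ c) (x : E n) : ‖g x‖ₑ ≤ c := by
  by_contra! hx
  have ho : IsOpen {y | c < ‖g y‖ₑ} := isOpen_lt continuous_const hg.enorm
  have h0 : volume {y | c < ‖g y‖ₑ} = 0 := by
    have h1 : ∀ᵐ y, ‖g y‖ₑ ≤ c := by
      rw [eLpNorm_exponent_top] at h
      filter_upwards [enorm_ae_le_eLpNormEssSup g volume] with y hy using hy.trans h
    simpa [ae_iff] using h1
  have h1 := (ho.measure_eq_zero_iff volume).1 h0
  exact (h1.subset (show x ∈ {y | c < ‖g y‖ₑ} from hx) : x ∈ (∅ : Set (E n)))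

lemma enorm_le_of_weighted {F : Type*} [NormedAddCommGroup F] {g : E n → F} (hg : Continuous g)
    {b : ℝ} {c : ℝ≥0∞}
    (h : eLpNorm (fun x => (1 + ‖x‖) ^ b * ‖g x‖) ⊤ volume ≤ c) (x : E n) :
    ‖g x‖ₑ ≤ c * (1 + ‖x‖ₑ) ^ (-b) := by
  have hp : ∀ x : E n, 0 < 1 + ‖x‖ := fun x => by positivity
  have hc : Continuous fun x : E n => (1 + ‖x‖) ^ b * ‖g x‖ :=
    ((continuous_const.add continuous_norm).rpow_const fun x => Or.inl (hp x).ne').mul hg.norm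
  have h1 := norm_le_of_eLpNorm_top_le hc h x
  have h2 : ‖(1 + ‖x‖) ^ b‖ₑ = (1 + ‖x‖ₑ) ^ b := by
    rw [Real.enorm_eq_ofReal (by positivity), ← ENNReal.ofReal_rpow_of_pos (hp x),
      ENNReal.ofReal_add zero_le_one (norm_nonneg _), ofReal_norm, ENNReal.ofReal_one]
  rw [enorm_mul, h2, enorm_norm] at h1
  calc ‖g x‖ₑ = (1 + ‖x‖ₑ) ^ b * ‖g x‖ₑ * (1 + ‖x‖ₑ) ^ (-b) := by
        rw [mul_right_comm, ← ENNReal.rpow_add _ _ (by simp) (by simp)]; simp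
    _ ≤ _ := by gcongr

lemma cd1_bounds (hu : ContDiff ℝ 1 u) {c : ℝ≥0∞} (h : cd1Norm u ≤ c) (x : E n) :
    ‖u x‖ₑ ≤ c * (1 + ‖x‖ₑ) ^ (-((n : ℝ) - 3)) ∧
      ‖fderiv ℝ u x‖ₑ ≤ c * (1 + ‖x‖ₑ) ^ (-((n : ℝ) - 2)) :=
  ⟨enorm_le_of_weighted hu.continuous (le_self_add.trans h) x,
    enorm_le_of_weighted (hu.continuous_fderiv one_ne_zero) (le_add_self.trans h) x⟩

lemma MemCd1.decay (hn : 3 ≤ n) (hu : MemCd1 u) :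
    Decay ((n : ℝ) - 3) u ∧ Decay ((n : ℝ) - 2) (fderiv ℝ u) := by
  have hn3 : (3 : ℝ) ≤ n := by exact_mod_cast hn
  obtain ⟨φ, ⟨hφ, hc, -⟩, hle⟩ := hu.2 1 one_pos
  have hφ1 : ContDiff ℝ 1 φ := hφ.of_le (by simp)
  have hb := cd1_bounds (hu.1.sub hφ1) hle.le
  have h1 : Decay ((n : ℝ) - 3) (u - φ) := ⟨1, by simp, fun x => (hb x).1⟩
  have h2 : Decay ((n : ℝ) - 2) (fderiv ℝ (u - φ)) := ⟨1, by simp, fun x => (hb x).2⟩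
  constructor
  · simpa using h1.add (HasCompactSupport.decay hc hφ.continuous (by linarith : 0 ≤ (n : ℝ) - 3))
  · have h3 := h2.add (HasCompactSupport.decay (hc.fderiv (𝕜 := ℝ))
      (hφ1.continuous_fderiv one_ne_zero) (by linarith : 0 ≤ (n : ℝ) - 2))
    have h4 : ∀ x, fderiv ℝ (u - φ) x + fderiv ℝ φ x = fderiv ℝ u x := fun x => by
      rw [fderiv_sub (hu.1.differentiable one_ne_zero x) (hφ1.differentiable one_ne_zero x),
        sub_add_cancel]
    simpa only [h4] using h3

lemma MemCd1.divergence_eq_zero (hn : 2 ≤ n) (hu : MemCd1 u) (x : E n) : divergence u x = 0 := by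
  have hn2 : (2 : ℝ) ≤ n := by exact_mod_cast hn
  have key : ∀ ε : ℝ, 0 < ε → |divergence u x| ≤ 0 + ε := by
    intro ε hε
    have hn0 : (0 : ℝ) < n := by linarith
    obtain ⟨φ, ⟨hφ, hc, hdiv⟩, hle⟩ := hu.2 (ENNReal.ofReal (ε / n)) (by simp; positivity)
    have hφ1 : ContDiff ℝ 1 φ := hφ.of_le (by simp)
    have hb := (cd1_bounds (hu.1.sub hφ1) hle.le x).2
    have h1 : ‖fderiv ℝ (u - φ) x‖ ≤ ε / n := by
      have h2 : ‖fderiv ℝ (u - φ) x‖ₑ ≤ ENNReal.ofReal (ε / n) :=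
        hb.trans (mul_le_of_le_one_right' (one_add_enorm_rpow_le_one x (by linarith)))
      rw [← ofReal_norm] at h2
      exact (ENNReal.ofReal_le_ofReal_iff (by positivity)).1 h2
    have h2 : divergence u x =
        ∑ i, (fderiv ℝ (u - φ) x (EuclideanSpace.single i 1)) i := by
      rw [fderiv_sub (hu.1.differentiable one_ne_zero x) (hφ1.differentiable one_ne_zero x)]
      simp only [sub_apply, PiLp.sub_apply, Finset.sum_sub_distrib]
      have := hdiv x
      rw [divergence] at this
      rw [this, sub_zero, divergence]
    rw [h2, zero_add]
    calc _ ≤ ∑ i : Fin n, |(fderiv ℝ (u - φ) x (EuclideanSpace.single i 1)) i| :=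
          Finset.abs_sum_le_sum_abs _ _
      _ ≤ ∑ i : Fin n, ε / n := by
          refine Finset.sum_le_sum fun i _ => (abs_apply_le _ i).trans ?_
          refine (ContinuousLinearMap.le_opNorm _ _).trans ?_
          simpa using h1
      _ = ε := by
          simp only [Finset.sum_const, Finset.card_univ, Fintype.card_fin, nsmul_eq_mul]
          field_simp
  exact abs_eq_zero.1 (le_antisymm (le_of_forall_pos_le_add key) (abs_nonneg _))

lemma pd_component (hu : ContDiff ℝ 1 u) (i l : Fin n) (x : E n) :
    pd l (fun x => u x i) x = (fderiv ℝ u x (EuclideanSpace.single l 1)) i := by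
  have h := (EuclideanSpace.proj i : E n →L[ℝ] ℝ).hasFDerivAt.comp x
    (hu.differentiable one_ne_zero x).hasFDerivAt
  have h' : HasFDerivAt (fun x => u x i) _ x := h
  rw [h'.pd_eq]
  simp

lemma contDiff_component (hu : ContDiff ℝ 1 u) (i : Fin n) : ContDiff ℝ 1 fun x => u x i :=
  (EuclideanSpace.proj i : E n →L[ℝ] ℝ).contDiff.comp hu

lemma source_apply (hu : ContDiff ℝ 1 u) (j : Fin n) (y : E n) :
    source f u y j = f y j - ∑ l, u y l * pd l (fun x => u x j) y := by
  rw [source, PiLp.sub_apply]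
  congr 1
  simp only [pd_component hu]
  have h := clm_apply_eq_sum ((EuclideanSpace.proj j : E n →L[ℝ] ℝ).comp (fderiv ℝ u y)) (u y)
  simpa using h

lemma ae_eq_zero_of_notMem_essSupport : ∀ᵐ y, y ∉ essSupport f → f y = 0 := by
  rw [ae_iff]
  refine measure_null_of_locally_null _ fun x hx => ?_
  simp only [mem_ofPred_eq, not_forall, essSupport, not_not] at hx
  obtain ⟨⟨V, hV, h⟩, -⟩ := hx
  refine ⟨_, inter_mem_nhdsWithin _ hV, ?_⟩
  rw [ae_iff] at h
  refine measure_mono_null (fun y hy => ?_) h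
  simp only [mem_ofPred_eq, not_forall] at hy ⊢
  exact ⟨hy.2, hy.1.2⟩

/-- A bounded field has a Borel representative that is bounded everywhere and vanishes outside the
essential support. -/
lemma exists_representative (hf : AEStronglyMeasurable f volume) (hK : IsClosed (essSupport f))
    {M : ℝ} (hM : 0 ≤ M) (hfM : eLpNorm f ⊤ volume ≤ ENNReal.ofReal M) :
    ∃ g : E n → E n, Measurable g ∧ f =ᵐ[volume] g ∧ (∀ x, ‖g x‖ ≤ M) ∧
      ∀ x, x ∉ essSupport f → g x = 0 := by
  classical
  set g₀ := hf.mk f with hg₀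
  have hm : Measurable g₀ := hf.stronglyMeasurable_mk.measurable
  set S : Set (E n) := essSupport f ∩ {x | ‖g₀ x‖ ≤ M} with hS
  have hSm : MeasurableSet S := hK.measurableSet.inter (measurableSet_le hm.norm measurable_const)
  refine ⟨S.indicator g₀, hm.indicator hSm, ?_, fun x => ?_, fun x hx => ?_⟩
  · have h1 : ∀ᵐ y, ‖f y‖ₑ ≤ ENNReal.ofReal M := by
      rw [eLpNorm_exponent_top] at hfM
      filter_upwards [enorm_ae_le_eLpNormEssSup f volume] with y hy using hy.trans hfM
    filter_upwards [h1, hf.ae_eq_mk, ae_eq_zero_of_notMem_essSupport (f := f)] with y h2 h3 h4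
    have h5 : ‖g₀ y‖ ≤ M := by
      rw [← ofReal_norm, h3] at h2
      exact (ENNReal.ofReal_le_ofReal_iff hM).1 h2
    by_cases hy : y ∈ essSupport f
    · rw [indicator_of_mem (show y ∈ S from ⟨hy, h5⟩)]
      exact h3
    · rw [indicator_of_notMem fun h => hy h.1]
      exact h4 hy
  · by_cases hx : x ∈ S
    · rw [indicator_of_mem hx]; exact hx.2
    · rw [indicator_of_notMem hx, norm_zero]; exact hM
  · exact indicator_of_notMem (fun h => hx h.1) _

lemma decay_of_bounded_support {g : E n → E n} {M : ℝ} {K : Set (E n)} (hK : IsCompact K)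
    (hg : ∀ x, ‖g x‖ ≤ M) (hg0 : ∀ x, x ∉ K → g x = 0) {β : ℝ} (hβ : 0 ≤ β) : Decay β g := by
  obtain ⟨R, hR⟩ := hK.isBounded.subset_closedBall 0
  obtain ⟨C, -, h⟩ := exists_cutoff n
  obtain ⟨χ, h1, h2, h3, -⟩ := h ⌈R⌉₊
  have hd : Decay β χ := HasCompactSupport.decay h2 h1.continuous hβ
  refine (hd.const_mul M).of_le fun x => ?_
  have hM : 0 ≤ M := (norm_nonneg _).trans (hg x)
  by_cases hx : x ∈ K
  · have h5 : ‖x‖ ≤ R := by simpa using hR hx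
    rw [h3 x (h5.trans ((Nat.le_ceil R).trans (by linarith))), mul_one, Real.norm_of_nonneg hM]
    exact hg x
  · rw [hg0 x hx, norm_zero]; positivity

end Prepare

/-- A solution with a Borel force bounded by `M` and vanishing outside the compact set `K`, together
with its approximation by smooth flows. -/
structure IsSolution {n : ℕ} (M : ℝ) (K : Set (E n)) (f u : E n → E n) (p : E n → ℝ) : Prop where
  contDiff_u : ContDiff ℝ 1 u
  meas_p : Measurable p
  isCompact : IsCompact K
  force_le : ∀ x, ‖f x‖ ≤ M
  force_eq_zero : ∀ x, x ∉ K → f x = 0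
  decay_u : Decay ((n : ℝ) - 9 / 4) u
  decay_du : Decay ((n : ℝ) - 9 / 4) (fderiv ℝ u)
  decay_p : Decay ((n : ℝ) - 9 / 4) p
  approx : ∃ v P h, FlowApprox ((n : ℝ) - 9 / 4) (fun i x => u x i) p (fun i x => f x i) v P h

lemma decay_of_components {n : ℕ} {β : ℝ} {u : E n → E n} (h : ∀ i, Decay β fun x => u x i) :
    Decay β u := by
  refine (Decay.sum (s := Finset.univ) fun i _ => (h i).norm).of_le fun x => ?_
  refine le_trans ?_ (le_abs_self _)
  have h1 : u x = ∑ i, u x i • EuclideanSpace.single i (1 : ℝ) := (sum_smul_single (u x)).symm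
  calc ‖u x‖ = ‖∑ i, u x i • EuclideanSpace.single i (1 : ℝ)‖ := congrArg _ h1
    _ ≤ ∑ i, ‖u x i • EuclideanSpace.single i (1 : ℝ)‖ := norm_sum_le _ _
    _ = _ := Finset.sum_congr rfl fun i _ => by simp [norm_smul]

/-- A solution of the integral equation with a bounded, compactly supported force fits into the
approximation scheme. -/
lemma exists_isSolution {n : ℕ} (hn : 5 ≤ n) {f u : E n → E n} {M : ℝ} (hM : 0 ≤ M)
    (hf : AEStronglyMeasurable f volume) (hK : IsCompact (essSupport f))
    (hfM : eLpNorm f ⊤ volume ≤ ENNReal.ofReal M) (hu : MemCd1 u)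
    (hs : SolvesIntegralEquation f u) :
    ∃ g, IsSolution M (essSupport f) g u (pressure f u) := by
  have hn5 : (5 : ℝ) ≤ n := by exact_mod_cast hn
  have hn0 : 0 < n := by omega
  obtain ⟨g, hgm, hfg, hgM, hg0⟩ := exists_representative hf hK.isClosed hM hfM
  obtain ⟨hd, hdd⟩ := hu.decay (by omega)
  have hu1 := hu.1
  set F : Fin n → E n → ℝ := fun j y => source g u y j with hF
  have hFe : ∀ j y, F j y = g y j - ∑ l, u y l * pd l (fun x => u x j) y := fun j y =>
    source_apply hu1 j y
  have hud : ∀ i, Decay ((n : ℝ) - 3) fun x => u x i := fun i => hd.of_le fun x => abs_apply_le _ i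
  have hpd : ∀ i l, Decay ((n : ℝ) - 2) (pd l fun x => u x i) := fun i l =>
    hdd.of_le fun x => by
      rw [pd_component hu1]
      refine (abs_apply_le _ i).trans ((ContinuousLinearMap.le_opNorm _ _).trans ?_)
      simp
  have hFd : ∀ j, Decay n (F j) := fun j => by
    rw [funext (hFe j)]
    refine Decay.sub ?_ (Decay.sum fun l _ => ((hud l).mul (hpd j l)).mono (by linarith))
    exact (decay_of_bounded_support hK hgM hg0 n.cast_nonneg).of_le fun x => abs_apply_le _ j
  have hFm : ∀ j, Measurable (F j) := fun j => by
    rw [funext (hFe j)]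
    have h1 : Measurable fun y => g y j :=
      (EuclideanSpace.proj j : E n →L[ℝ] ℝ).continuous.measurable.comp hgm
    refine h1.sub (Continuous.measurable ?_)
    have h2 := fun l => (contDiff_component hu1 l).continuous
    have h3 := fun l => continuous_pd (contDiff_component hu1 j) l
    fun_prop
  have hsrc : ∀ᵐ y, source f u y = source g u y := by
    filter_upwards [hfg] with y hy
    rw [source, source, hy]
  have hui : ∀ i x, u x i = ∫ y, ∑ j, stokesU n i j (x - y) * F j y := fun i x => by
    rw [hs x i]
    refine integral_congr_ae ?_
    filter_upwards [hsrc] with y hy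
    simp only [hy, hF]
  have hp : ∀ x, pressure f u x = ∫ y, ∑ j, stokesP n j (x - y) * F j y := fun x => by
    rw [pressure]
    refine integral_congr_ae ?_
    filter_upwards [hsrc] with y hy
    simp only [hy, hF]
  have kU := fun i j => kernelBound_stokesU (n := n) (by omega) i j
  have kP := fun j => kernelBound_stokesP (n := n) (by omega) j
  have hui' : ∀ i, Decay ((n : ℝ) - 9 / 4) fun x => u x i := fun i => by
    have : (fun x => u x i) = fun x => ∑ j, ∫ y, stokesU n i j (x - y) * F j y := by
      ext x
      rw [hui, integral_sum_kernel_mul (kU i) hn0 (by linarith) (by linarith) hFd hFm]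
    rw [this]
    exact Decay.sum fun j _ => (kU i j).decay_potential hn0 (by linarith) (by linarith)
      (by linarith) (hFd j)
  have hp' : pressure f u = fun x => ∑ j, ∫ y, stokesP n j (x - y) * F j y := by
    ext x
    rw [hp, integral_sum_kernel_mul kP hn0 (by linarith) (by linarith) hFd hFm]
  have hpD : Decay ((n : ℝ) - 9 / 4) (pressure f u) := by
    rw [hp']
    exact Decay.sum fun j _ => (kP j).decay_potential hn0 (by linarith) (by linarith)
      (by linarith) (hFd j)
  have hpm : Measurable (pressure f u) := by
    rw [hp']
    exact Finset.measurable_fun_sum _ fun j _ =>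
      ((kP j).stronglyMeasurable_potential (hFm j)).measurable
  have hdiv : ∀ x, ∑ i, pd i (fun x => u x i) x = 0 := fun x => by
    simp only [pd_component hu1]
    exact hu.divergence_eq_zero (by omega) x
  refine ⟨g, hu1, hpm, hK, hgM, hg0, decay_of_components hui', hdd.mono (by linarith), hpD,
    _, _, _, flowApprox_mollified hn (by linarith) (by linarith) hFd hFm hui hp
      (contDiff_component hu1) hdiv hui' (fun i l => (hpd i l).mono (by linarith)) hpD hpm
      fun i x => ?_⟩
  rw [hFe]; ring

lemma abs_sum_mul_le_norm {n : ℕ} (x y : E n) : |∑ i, x i * y i| ≤ ‖x‖ * ‖y‖ := by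
  have h := abs_real_inner_le_norm x y
  rw [PiLp.inner_apply] at h
  simpa [mul_comm] using h

lemma ofReal_integral_le {α : Type*} [MeasurableSpace α] {μ : Measure α} {g : α → ℝ}
    {h : α → ℝ≥0∞} (hg : ∀ x, ‖g x‖ₑ ≤ h x) : ENNReal.ofReal (∫ x, g x ∂μ) ≤ ∫⁻ x, h x ∂μ :=
  (Real.ofReal_le_enorm _).trans ((enorm_integral_le_lintegral_enorm _).trans (lintegral_mono hg))

lemma Decay.lintegral_rpow_lt_top {n : ℕ} {F : Type*} [NormedAddCommGroup F] {β s : ℝ}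
    {g : E n → F} (hg : Decay β g) (hs : 0 ≤ s) (hβ : n < β * s) :
    ∫⁻ x, ‖g x‖ₑ ^ s < ⊤ := by
  obtain ⟨C, hC, hg⟩ := hg
  calc ∫⁻ x, ‖g x‖ₑ ^ s ≤ ∫⁻ x, C ^ s * (1 + ‖x‖ₑ) ^ (-(β * s)) := by
        refine lintegral_mono fun x => (ENNReal.rpow_le_rpow (hg x) hs).trans (le_of_eq ?_)
        rw [ENNReal.mul_rpow_of_nonneg _ _ hs, ← ENNReal.rpow_mul, neg_mul]
    _ = C ^ s * ∫⁻ x : E n, (1 + ‖x‖ₑ) ^ (-(β * s)) :=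
        lintegral_const_mul' _ _ (ENNReal.rpow_lt_top_of_nonneg hs hC.ne).ne
    _ < ⊤ := ENNReal.mul_lt_top (ENNReal.rpow_lt_top_of_nonneg hs hC.ne)
        (lintegral_one_add_enorm_rpow_lt_top hβ)

namespace IsSolution
variable {n : ℕ} {M : ℝ} {K : Set (E n)} {f u : E n → E n} {p : E n → ℝ}

lemma nonneg (S : IsSolution M K f u p) : 0 ≤ M := (norm_nonneg _).trans (S.force_le 0)

lemma head_eq (u : E n → E n) (p : E n → ℝ) (x : E n) :
    head (fun i x => u x i) p x = ‖u x‖ ^ 2 / 2 + p x := by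
  rw [head, EuclideanSpace.real_norm_sq_eq]

lemma measurable_head (S : IsSolution M K f u p) : Measurable (head (fun i x => u x i) p) := by
  rw [funext (head_eq u p)]
  exact ((S.contDiff_u.continuous.measurable.norm.pow_const 2).div_const 2).add S.meas_p

lemma decay_head (S : IsSolution M K f u p) (hn : 5 ≤ n) :
    Decay ((n : ℝ) - 9 / 4) (head (fun i x => u x i) p) := by
  have hn5 : (5 : ℝ) ≤ n := by exact_mod_cast hn
  rw [funext (head_eq u p)]
  have h1 : Decay ((n : ℝ) - 9 / 4) fun x => 2⁻¹ * (‖u x‖ * ‖u x‖) :=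
    ((S.decay_u.of_le (g' := fun x => ‖u x‖) fun x => by simp).mul
      (S.decay_u.of_le (g' := fun x => ‖u x‖) fun x => by simp)).mono (by linarith) |>.const_mul _
  refine (h1.add S.decay_p).of_le fun x => le_of_eq ?_
  congr 1; ring

lemma enorm_force_mul_le (S : IsSolution M K f u p) (x y : E n) :
    ‖∑ i, y i * f x i‖ₑ ≤ ENNReal.ofReal M * K.indicator (fun _ => ‖y‖ₑ) x := by
  by_cases hx : x ∈ K
  · rw [indicator_of_mem hx, ← ofReal_norm, ← ofReal_norm, ← ENNReal.ofReal_mul S.nonneg]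
    refine ENNReal.ofReal_le_ofReal ((abs_sum_mul_le_norm _ _).trans ?_)
    rw [mul_comm]
    exact mul_le_mul_of_nonneg_right (S.force_le x) (norm_nonneg _)
  · simp [S.force_eq_zero x hx]

lemma enorm_fderiv_sq_le (hu : ContDiff ℝ 1 u) (x : E n) :
    ‖fderiv ℝ u x‖ₑ ^ (2 : ℝ) ≤ ENNReal.ofReal (∑ i, ∑ k, pd k (fun x => u x i) x ^ 2) := by
  have h0 : 0 ≤ ∑ i, ∑ k, pd k (fun x => u x i) x ^ 2 :=
    Finset.sum_nonneg fun i _ => Finset.sum_nonneg fun k _ => sq_nonneg _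
  have h : ‖fderiv ℝ u x‖ ≤ √(∑ i, ∑ k, pd k (fun x => u x i) x ^ 2) := by
    refine ContinuousLinearMap.opNorm_le_bound _ (Real.sqrt_nonneg _) fun y => ?_
    rw [← Real.sqrt_sq (norm_nonneg y), ← Real.sqrt_mul h0, Finset.sum_mul]
    refine Real.le_sqrt_of_sq_le ?_
    rw [EuclideanSpace.real_norm_sq_eq]
    refine Finset.sum_le_sum fun i _ => ?_
    have h1 : (fderiv ℝ u x y) i = ∑ k, y k * pd k (fun x => u x i) x := by
      have h := clm_apply_eq_sum ((EuclideanSpace.proj i : E n →L[ℝ] ℝ).comp (fderiv ℝ u x)) y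
      simp only [pd_component hu]
      simpa using h
    rw [h1, EuclideanSpace.real_norm_sq_eq, mul_comm]
    exact Finset.sum_mul_sq_le_sq_mul_sq _ _ _
  rw [← ofReal_norm, ENNReal.ofReal_rpow_of_nonneg (norm_nonneg _) (by norm_num)]
  refine ENNReal.ofReal_le_ofReal ?_
  rw [Real.rpow_two]
  calc ‖fderiv ℝ u x‖ ^ 2 ≤ √(∑ i, ∑ k, pd k (fun x => u x i) x ^ 2) ^ 2 := by gcongr
    _ = _ := Real.sq_sqrt h0

/-- The energy inequality `∫ |∇u|² ≤ M ∫_K |u|`. -/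
lemma energy (S : IsSolution M K f u p) (hn : 5 ≤ n) :
    ∫⁻ x, ‖fderiv ℝ u x‖ₑ ^ (2 : ℝ) ≤ ENNReal.ofReal M * ∫⁻ x in K, ‖u x‖ₑ := by
  have hn5 : (5 : ℝ) ≤ n := by exact_mod_cast hn
  obtain ⟨v, P, h, A⟩ := S.approx
  have hpd : ∀ i l, Decay ((n : ℝ) - 9 / 4) (pd l fun x => u x i) := fun i l =>
    S.decay_du.of_le fun x => by
      rw [pd_component S.contDiff_u]
      refine (abs_apply_le _ i).trans ((ContinuousLinearMap.le_opNorm _ _).trans ?_)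
      simp
  have hint : Integrable fun x => ∑ i, ∑ k, pd k (fun x => u x i) x ^ 2 := by
    refine Decay.integrable (β := 2 * ((n : ℝ) - 9 / 4)) (Decay.sum fun i _ => Decay.sum fun k _ => ?_)
      (Continuous.aestronglyMeasurable ?_) (by linarith)
    · simpa only [sq, two_mul] using (hpd i k).mul (hpd i k)
    · have := fun i l => continuous_pd (contDiff_component S.contDiff_u i) l
      fun_prop
  calc _ ≤ ∫⁻ x, ENNReal.ofReal (∑ i, ∑ k, pd k (fun x => u x i) x ^ 2) :=
        lintegral_mono fun x => enorm_fderiv_sq_le S.contDiff_u x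
    _ = ENNReal.ofReal (∫ x, ∑ i, u x i * f x i) := by
        rw [← ofReal_integral_eq_lintegral_ofReal hint (Eventually.of_forall fun x =>
          Finset.sum_nonneg fun i _ => Finset.sum_nonneg fun k _ => sq_nonneg _),
          A.energy (by linarith)]
    _ ≤ ∫⁻ x, ENNReal.ofReal M * K.indicator (fun x => ‖u x‖ₑ) x :=
        ofReal_integral_le fun x => by
          refine (S.enorm_force_mul_le x (u x)).trans (le_of_eq ?_)
          by_cases hx : x ∈ K <;> simp [hx]
    _ = _ := by
        rw [lintegral_const_mul' _ _ ENNReal.ofReal_ne_top,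
          lintegral_indicator S.isCompact.measurableSet]

/-- The Sobolev form of the head pressure estimate. The hypothesis `1 < q` stands after the quantifier
on `C`: a constant is chosen for two values of `q`, one of which is less than one when `n = 5`. -/
lemma exists_head (hn : 5 ≤ n) (M q : ℝ) : ∃ C : ℝ≥0∞, C < ⊤ ∧ (1 < q →
    ∀ {K : Set (E n)} {f u : E n → E n} {p : E n → ℝ}, IsSolution M K f u p →
    (∫⁻ x, ENNReal.ofReal (max (head (fun i x => u x i) p x) 0) ^ ((q + 1) * n / (n - 2) : ℝ)) ^
      ((n - 2) / n : ℝ) ≤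
    C * ((∫⁻ x in K, ‖u x‖ₑ * ENNReal.ofReal (max (head (fun i x => u x i) p x) 0) ^ q) +
      ∫⁻ x in K, ENNReal.ofReal (max (head (fun i x => u x i) p x) 0) ^ (q - 1))) := by
  by_cases hq : 1 < q
  swap
  · exact ⟨0, by simp, fun h => absurd h hq⟩
  have hn5 : (5 : ℝ) ≤ n := by exact_mod_cast hn
  obtain ⟨C, hC, h⟩ := exists_head_sobolev_limit (n := n) (by omega) hq
  refine ⟨C * (ENNReal.ofReal M + ENNReal.ofReal (q / 2 * M ^ 2)), ENNReal.mul_lt_top hC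
    (by simp), fun _ {K f u p} S => ?_⟩
  obtain ⟨v, P, hh, A⟩ := S.approx
  refine (h A (by linarith)).trans ?_
  rw [mul_assoc]
  refine mul_le_mul' le_rfl ?_
  set θ := head (fun i x => u x i) p with hθ
  have mθ : Measurable θ := S.measurable_head
  have hpow : ∀ x {s : ℝ}, 0 ≤ s → ‖max (θ x) 0 ^ s‖ₑ = ENNReal.ofReal (max (θ x) 0) ^ s :=
    fun x s hs => by
      rw [Real.enorm_eq_ofReal (Real.rpow_nonneg (le_max_right _ _) _),
        ENNReal.ofReal_rpow_of_nonneg (le_max_right _ _) hs]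
  have hb : ∀ x, ‖(∑ i, u x i * f x i) * max (θ x) 0 ^ q +
      q / 2 * (max (θ x) 0 ^ (q - 1) * ∑ k, f x k ^ 2)‖ₑ ≤ K.indicator (fun x =>
        ENNReal.ofReal M * (‖u x‖ₑ * ENNReal.ofReal (max (θ x) 0) ^ q) +
        ENNReal.ofReal (q / 2 * M ^ 2) * ENNReal.ofReal (max (θ x) 0) ^ (q - 1)) x := by
    intro x
    by_cases hx : x ∈ K
    · rw [indicator_of_mem hx]
      refine (enorm_add_le _ _).trans (add_le_add ?_ ?_)
      · rw [enorm_mul, hpow x (by linarith), ← mul_assoc]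
        refine mul_le_mul' ?_ le_rfl
        simpa [hx] using S.enorm_force_mul_le x (u x)
      · rw [mul_left_comm, enorm_mul, hpow x (by linarith), mul_comm]
        refine mul_le_mul' ?_ le_rfl
        rw [Real.enorm_eq_ofReal (mul_nonneg (by linarith)
          (Finset.sum_nonneg fun i _ => sq_nonneg _)), ← EuclideanSpace.real_norm_sq_eq]
        refine ENNReal.ofReal_le_ofReal ?_
        have := S.force_le x
        have : 0 ≤ q / 2 := by linarith
        gcongr
    · rw [indicator_of_notMem hx, S.force_eq_zero x hx]
      simp
  refine (ofReal_integral_le hb).trans ?_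
  have mU : Measurable fun x => ‖u x‖ₑ := S.contDiff_u.continuous.measurable.enorm
  have mΘ : Measurable fun x => ENNReal.ofReal (max (θ x) 0) :=
    (mθ.max measurable_const).ennreal_ofReal
  rw [lintegral_indicator S.isCompact.measurableSet, lintegral_add_right _
    ((mΘ.pow_const _).const_mul _), lintegral_const_mul' _ _ ENNReal.ofReal_ne_top,
    lintegral_const_mul' _ _ ENNReal.ofReal_ne_top, mul_add]
  refine add_le_add (mul_le_mul' le_self_add le_rfl) (mul_le_mul' le_add_self le_rfl)

/-- The weighted estimate for `u` in its singular form. It is proved with the regularised weights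
`(|y - x₀|² + 1 / (k + 1)) ^ (-m)`, and Fatou's lemma removes the regularisation. -/
lemma weighted (S : IsSolution M K f u p) (hn : 7 ≤ n) (x₀ : E n) :
    ∫⁻ y, ‖u y‖ₑ ^ (2 : ℝ) * ‖x₀ - y‖ₑ ^ (-((n : ℝ) - 21 / 10)) ≤
      ENNReal.ofReal (20 * (n + M)) *
      ((∫⁻ y, ENNReal.ofReal (max (head (fun i x => u x i) p y) 0) *
        ‖x₀ - y‖ₑ ^ (-((n : ℝ) - 21 / 10))) + ∫⁻ y in K, ‖x₀ - y‖ₑ ^ (-((n : ℝ) - 31 / 10))) := by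
  have hn7 : (7 : ℝ) ≤ n := by exact_mod_cast hn
  have hM := S.nonneg
  obtain ⟨v, P, h, A⟩ := S.approx
  set θ := head (fun i x => u x i) p with hθ
  have mθ : Measurable θ := S.measurable_head
  set m : ℝ := ((n : ℝ) - 41 / 10) / 2 + 1 with hm
  have h2m : 2 * m = (n : ℝ) - 21 / 10 := by rw [hm]; ring
  have hm0 : 0 ≤ m := by rw [hm]; linarith
  set W : E n → ℝ≥0∞ := fun y => ‖x₀ - y‖ₑ ^ (-((n : ℝ) - 21 / 10)) with hW
  have mW : Measurable W := by
    simp only [hW]; exact (measurable_const.sub measurable_id).enorm.pow_const _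
  set w : ℕ → E n → ℝ := fun k y => (‖y - x₀‖ ^ 2 + 1 / ((k : ℝ) + 1)) ^ (-m) with hw
  have he : ∀ k : ℕ, (0 : ℝ) < 1 / ((k : ℝ) + 1) := fun k => by positivity
  have hw0 : ∀ k y, 0 ≤ w k y := fun k y => Real.rpow_nonneg (by positivity) _
  have cw : ∀ k, Continuous (w k) := fun k =>
    (by fun_prop : Continuous fun y : E n => ‖y - x₀‖ ^ 2 + 1 / ((k : ℝ) + 1)).rpow_const
      fun y => Or.inl (by positivity)
  have hwW : ∀ k y, ‖w k y‖ₑ ≤ W y := fun k y => by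
    rw [Real.enorm_eq_ofReal (hw0 k y), hw, ← ENNReal.ofReal_rpow_of_pos (by positivity)]
    refine (rpow_neg_le_rpow_neg hm0 (X := ENNReal.ofReal (‖y - x₀‖ ^ 2))
      (ENNReal.ofReal_le_ofReal (by linarith [he k]))).trans (le_of_eq ?_)
    rw [ENNReal.ofReal_pow (norm_nonneg _), ofReal_norm, ← ENNReal.rpow_two, ← ENNReal.rpow_mul,
      ← enorm_neg, neg_sub, mul_neg, h2m]
  have hxW : ∀ y, ‖x₀ - y‖ₑ * W y ≤ ‖x₀ - y‖ₑ ^ (-((n : ℝ) - 31 / 10)) := fun y => by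
    have := rpow_mul_rpow_neg_le ‖x₀ - y‖ₑ (c := 1) (a := (n : ℝ) - 21 / 10) (by linarith) (by simp)
    rw [ENNReal.rpow_one] at this
    refine this.trans (le_of_eq ?_)
    congr 1; ring
  have hd : Decay (2 * ((n : ℝ) - 9 / 4)) fun y => ∑ i, u y i ^ 2 := by
    refine Decay.sum fun i _ => ?_
    have h1 : Decay ((n : ℝ) - 9 / 4) fun y => u y i :=
      S.decay_u.of_le fun y => abs_apply_le (u y) i
    simpa only [sq, two_mul] using h1.mul h1
  have hc : ∀ k, Continuous fun y => (∑ i, u y i ^ 2) * w k y := fun k => by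
    have h1 := fun i => (contDiff_component S.contDiff_u i).continuous
    exact (continuous_finsetSum _ fun i _ => (h1 i).pow 2).mul (cw k)
  obtain ⟨R, hR⟩ : ∃ R, R = (∫⁻ y, ENNReal.ofReal (max (θ y) 0) * W y) +
      ∫⁻ y in K, ‖x₀ - y‖ₑ ^ (-((n : ℝ) - 31 / 10)) := ⟨_, rfl⟩
  have hk : ∀ k, ∫⁻ y, ENNReal.ofReal ((∑ i, u y i ^ 2) * w k y) ≤
      ENNReal.ofReal (20 * (n + M)) * R := by
    intro k
    have h1 := A.weighted_estimate (by linarith) (a := (n : ℝ) - 41 / 10) (by linarith)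
      (by linarith) (by linarith) (he k) x₀
    have h2 : ∫ y, (∑ i, u y i ^ 2) * w k y ≤ 20 * ∫ y, (n * (max (θ y) 0 * w k y) +
        |∑ i, f y i * (y i - x₀ i)| * w k y) := by
      have : ((n : ℝ) - (n - 41 / 10) - 4) / 2 = 1 / 20 := by ring
      rw [this] at h1
      linarith
    have hint : Integrable fun y => (∑ i, u y i ^ 2) * w k y :=
      Decay.integrable (hd.mul (decay_sq_norm_rpow (he k) hm0 x₀)) (hc k).aestronglyMeasurable
        (by linarith)
    rw [← ofReal_integral_eq_lintegral_ofReal hint (Eventually.of_forall fun y =>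
      mul_nonneg (Finset.sum_nonneg fun i _ => sq_nonneg _) (hw0 k y))]
    refine (ENNReal.ofReal_le_ofReal h2).trans ?_
    rw [ENNReal.ofReal_mul (by norm_num), ENNReal.ofReal_mul (by norm_num), mul_assoc]
    refine mul_le_mul' le_rfl ?_
    have hb : ∀ y, ‖n * (max (θ y) 0 * w k y) + |∑ i, f y i * (y i - x₀ i)| * w k y‖ₑ ≤
        ENNReal.ofReal n * (ENNReal.ofReal (max (θ y) 0) * W y) +
        ENNReal.ofReal M * K.indicator (fun y => ‖x₀ - y‖ₑ ^ (-((n : ℝ) - 31 / 10))) y := by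
      intro y
      refine (enorm_add_le _ _).trans (add_le_add ?_ ?_)
      · rw [enorm_mul, enorm_mul, Real.enorm_eq_ofReal (le_max_right _ _),
          Real.enorm_eq_ofReal (Nat.cast_nonneg n)]
        exact mul_le_mul' le_rfl (mul_le_mul' le_rfl (hwW k y))
      · have h3 : ∑ i, f y i * (y i - x₀ i) = ∑ i, (y - x₀) i * f y i :=
          Finset.sum_congr rfl fun i _ => by simp [mul_comm]
        rw [enorm_mul, h3, Real.enorm_abs]
        refine (mul_le_mul' (S.enorm_force_mul_le y (y - x₀)) (hwW k y)).trans ?_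
        rw [mul_assoc]
        refine mul_le_mul' le_rfl ?_
        by_cases hy : y ∈ K
        · rw [indicator_of_mem hy, indicator_of_mem hy, ← enorm_neg, neg_sub]
          exact hxW y
        · simp [hy]
    refine (ofReal_integral_le hb).trans ?_
    have mΘ : Measurable fun x => ENNReal.ofReal (max (θ x) 0) :=
      (mθ.max measurable_const).ennreal_ofReal
    have mn : Measurable fun y => ENNReal.ofReal n * (ENNReal.ofReal (max (θ y) 0) * W y) :=
      (mΘ.mul mW).const_mul _
    rw [lintegral_add_left mn, lintegral_const_mul' _ _ ENNReal.ofReal_ne_top,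
      lintegral_const_mul' _ _ ENNReal.ofReal_ne_top, lintegral_indicator S.isCompact.measurableSet,
      ENNReal.ofReal_add n.cast_nonneg hM, hR, mul_add]
    exact add_le_add (mul_le_mul' le_self_add le_rfl) (mul_le_mul' le_add_self le_rfl)
  have hlim : ∀ᵐ y, ‖u y‖ₑ ^ (2 : ℝ) * W y =
      liminf (fun k => ENNReal.ofReal ((∑ i, u y i ^ 2) * w k y)) atTop := by
    have : Nontrivial (E n) := by
      have : Nonempty (Fin n) := ⟨⟨0, by omega⟩⟩
      infer_instance
    have hne : ∀ᵐ y : E n, y ≠ x₀ := by simp [ae_iff]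
    filter_upwards [hne] with y hy
    have hy0 : y - x₀ ≠ 0 := sub_ne_zero.2 hy
    have h1 := tendsto_sq_add_rpow hy0 (-m)
    simp only [sub_zero] at h1
    have h2 := ENNReal.tendsto_ofReal (h1.const_mul (∑ i, u y i ^ 2))
    rw [h2.liminf_eq, ENNReal.ofReal_mul (Finset.sum_nonneg fun i _ => sq_nonneg _),
      ← EuclideanSpace.real_norm_sq_eq, ENNReal.ofReal_pow (norm_nonneg _), ofReal_norm,
      ENNReal.rpow_two, ← ENNReal.ofReal_rpow_of_pos (norm_pos_iff.2 hy0), ofReal_norm, mul_neg, h2m,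
      show ‖y - x₀‖ₑ = ‖x₀ - y‖ₑ by rw [← enorm_neg, neg_sub]]
  rw [← hR, lintegral_congr_ae hlim]
  refine (lintegral_liminf_le fun k => ?_).trans ?_
  · exact (hc k).measurable.ennreal_ofReal
  · refine liminf_le_of_le (by isBoundedDefault) fun b hb => ?_
    obtain ⟨k, hk'⟩ := hb.exists
    exact hk'.trans (hk k)

end IsSolution

/-- Solutions satisfy the a priori estimates with a constant that depends only on the dimension, on
the bound for the force, and on a bound for the volume of its support. -/
lemma exists_aprioriEstimates {n : ℕ} (hn : 5 ≤ n) (M : ℝ) {V : ℝ≥0∞} (hV : V < ⊤) :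
    ∃ C : ℝ≥0∞, C < ⊤ ∧ ∀ {K : Set (E n)} {f u : E n → E n} {p : E n → ℝ},
      IsSolution M K f u p → volume K ≤ V →
      AprioriEstimates n C K (fun x => ‖u x‖ₑ) (fun x => ‖fderiv ℝ u x‖ₑ)
        (fun x => ENNReal.ofReal (max (head (fun i x => u x i) p x) 0)) := by
  have hn5 : (5 : ℝ) ≤ n := by exact_mod_cast hn
  obtain ⟨C₁, hC₁, h₁⟩ := exists_sobolev (n := n) (E n) (by omega)
  obtain ⟨C₂, hC₂, h₂⟩ := exists_enorm_le_riesz (n := n) (F := E n) (by omega)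
  obtain ⟨C₃, hC₃, h₃⟩ := IsSolution.exists_head hn M (5 / 4)
  obtain ⟨C₄, hC₄, h₄⟩ := IsSolution.exists_head hn M ((n - 4) / 2 + 1 / 10)
  obtain ⟨C, hC⟩ : ∃ C, C = V + C₁ + C₂ + C₃ + C₄ + ENNReal.ofReal M +
    ENNReal.ofReal (20 * (n + M)) := ⟨_, rfl⟩
  refine ⟨C, by simp only [hC, ENNReal.add_lt_top, hV, hC₁, hC₂, hC₃, hC₄, ENNReal.ofReal_lt_top,
    and_self], fun {K f u p} S hK => ?_⟩
  have l0 : V ≤ C := by rw [hC]; simp only [add_assoc]; exact le_self_add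
  have l1 : C₁ ≤ C := by
    rw [hC, show V + C₁ + C₂ + C₃ + C₄ + ENNReal.ofReal M + ENNReal.ofReal (20 * (n + M)) =
      C₁ + (V + C₂ + C₃ + C₄ + ENNReal.ofReal M + ENNReal.ofReal (20 * (n + M))) by ring]
    exact le_self_add
  have l2 : C₂ ≤ C := by
    rw [hC, show V + C₁ + C₂ + C₃ + C₄ + ENNReal.ofReal M + ENNReal.ofReal (20 * (n + M)) =
      C₂ + (V + C₁ + C₃ + C₄ + ENNReal.ofReal M + ENNReal.ofReal (20 * (n + M))) by ring]
    exact le_self_add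
  have l3 : C₃ ≤ C := by
    rw [hC, show V + C₁ + C₂ + C₃ + C₄ + ENNReal.ofReal M + ENNReal.ofReal (20 * (n + M)) =
      C₃ + (V + C₁ + C₂ + C₄ + ENNReal.ofReal M + ENNReal.ofReal (20 * (n + M))) by ring]
    exact le_self_add
  have l4 : C₄ ≤ C := by
    rw [hC, show V + C₁ + C₂ + C₃ + C₄ + ENNReal.ofReal M + ENNReal.ofReal (20 * (n + M)) =
      C₄ + (V + C₁ + C₂ + C₃ + ENNReal.ofReal M + ENNReal.ofReal (20 * (n + M))) by ring]
    exact le_self_add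
  have l5 : ENNReal.ofReal M ≤ C := by
    rw [hC, add_assoc, add_comm, add_assoc]; exact le_self_add
  have l6 : ENNReal.ofReal (20 * (n + M)) ≤ C := by rw [hC]; exact le_add_self
  have hu := S.contDiff_u
  have mU : Measurable fun x => ‖u x‖ₑ := hu.continuous.measurable.enorm
  have hfinU : ∀ s : ℝ, 2 ≤ s → ∫⁻ x, ‖u x‖ₑ ^ s < ⊤ := fun s hs =>
    S.decay_u.lintegral_rpow_lt_top (by linarith) (by nlinarith)
  refine ⟨mU, (hu.continuous_fderiv one_ne_zero).measurable.enorm,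
    (S.measurable_head.max measurable_const).ennreal_ofReal, S.isCompact.measurableSet, hK.trans l0,
    ?_, ?_, ?_, ?_, ?_, ?_, ?_, ?_⟩
  · refine (h₁ u hu ?_).trans (mul_le_mul' l1 le_rfl)
    refine ⟨hu.continuous.aestronglyMeasurable, ?_⟩
    rw [eLpNorm_lt_top_iff_lintegral_rpow_enorm_lt_top (by simp) (by simp)]
    simpa using hfinU 2 le_rfl
  · exact (S.energy hn).trans (mul_le_mul' l5 le_rfl)
  · intro x
    exact (h₂ u hu (S.decay_u.tendsto_zero (by linarith)) x).trans (mul_le_mul' l2 le_rfl)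
  · rintro q hq (rfl | rfl)
    · exact (h₃ hq S).trans (mul_le_mul' l3 le_rfl)
    · exact (h₄ hq S).trans (mul_le_mul' l4 le_rfl)
  · intro hn7 x
    exact (S.weighted hn7 x).trans (mul_le_mul' l6 le_rfl)
  · refine (hfinU _ ?_).ne
    rw [le_div_iff₀ (by linarith)]; linarith
  · exact ((lintegral_mono' Measure.restrict_le_self le_rfl).trans_lt (hfinU _ (by norm_num))).ne
  · intro r hr
    refine (lt_of_le_of_lt (lintegral_mono fun x => ?_)
      ((S.decay_head hn).lintegral_rpow_lt_top (s := r) (by linarith) (by nlinarith))).ne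
    refine ENNReal.rpow_le_rpow ?_ (by linarith)
    rw [← ofReal_norm]
    exact ENNReal.ofReal_le_ofReal (max_le (le_abs_self _) (abs_nonneg _))

end StationaryNS

end

theorem mainTheorem3 (n : ℕ) (hn5 : 5 ≤ n) (hn15 : n ≤ 15) :
    ∃ r : ℝ, (n : ℝ) / 2 < r ∧
      ∀ D M : ℝ, ∃ C : ℝ, 0 < C ∧
        ∀ f u : StationaryNS.E n → StationaryNS.E n,
          MemLp f ∞ volume →
          IsCompact (StationaryNS.essSupport f) →
          Metric.diam (StationaryNS.essSupport f) ≤ D →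
          eLpNorm f ∞ volume ≤ ENNReal.ofReal M →
          StationaryNS.MemCd1 u →
          StationaryNS.SolvesIntegralEquation f u →
          MemLp (fun x => max (StationaryNS.headPressure f u x) 0) (ENNReal.ofReal r) volume ∧
            eLpNorm (fun x => max (StationaryNS.headPressure f u x) 0)
              (ENNReal.ofReal r) volume ≤ ENNReal.ofReal C := by
  have hn : (5 : ℝ) ≤ n := by exact_mod_cast hn5
  -- The exponent comes from the energy estimate for `n ≤ 6` and from the bootstrap for `n ≥ 7`.
  obtain ⟨r, hr, hbound⟩ : ∃ r : ℝ, (n : ℝ) / 2 < r ∧ ∀ C : ℝ≥0∞, C < ⊤ → ∃ B : ℝ≥0∞, B < ⊤ ∧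
      ∀ {K : Set (StationaryNS.E n)} {U G Θ : StationaryNS.E n → ℝ≥0∞},
        StationaryNS.AprioriEstimates n C K U G Θ → (∫⁻ x, Θ x ^ r) ^ (1 / r) ≤ B := by
    rcases le_or_gt n 6 with h6 | h6
    · have h6' : (n : ℝ) ≤ 6 := by exact_mod_cast h6
      refine ⟨9 / 4 * n / (n - 2), ?_, fun C hC => ?_⟩
      · rw [div_lt_div_iff₀ (by norm_num) (by linarith)]
        nlinarith
      · obtain ⟨B, hB, h⟩ := StationaryNS.exists_energy_bounds hn5 hn15 hC
        exact ⟨B, hB, fun H => (h H).2⟩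
    · refine ⟨((n - 4) / 2 + 1 / 10 + 1) * n / (n - 2), ?_, fun C hC => ?_⟩
      · rw [div_lt_div_iff₀ (by norm_num) (by linarith)]
        nlinarith
      · exact StationaryNS.exists_head_bound h6 hn15 hC rfl
  refine ⟨r, hr, fun D M => ?_⟩
  have hr0 : 0 < r := by linarith
  have hV : volume (Metric.closedBall (0 : StationaryNS.E n) D) < ⊤ := measure_closedBall_lt_top
  obtain ⟨C, hC, hest⟩ := StationaryNS.exists_aprioriEstimates hn5 (max M 0) hV
  obtain ⟨B, hB, hb⟩ := hbound C hC
  refine ⟨B.toReal + 1, by positivity, fun f u hf hK hD hM hu hs => ?_⟩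
  obtain ⟨g, S⟩ := StationaryNS.exists_isSolution hn5 (le_max_right M 0) hf.1 hK
    (hM.trans (ENNReal.ofReal_le_ofReal (le_max_left M 0))) hu hs
  have hvol : volume (StationaryNS.essSupport f) ≤
      volume (Metric.closedBall (0 : StationaryNS.E n) D) := by
    rcases (StationaryNS.essSupport f).eq_empty_or_nonempty with h0 | ⟨x, hx⟩
    · simp [h0]
    · refine (measure_mono fun y hy => ?_).trans (Measure.addHaar_closedBall_center volume x D).le
      exact (Metric.dist_le_diam_of_mem hK.isBounded hy hx).trans hD
  have hθ : StationaryNS.headPressure f u =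
      StationaryNS.head (fun i x => u x i) (StationaryNS.pressure f u) := by
    ext x
    rw [StationaryNS.IsSolution.head_eq, StationaryNS.headPressure]
  have hle : eLpNorm (fun x => max (StationaryNS.headPressure f u x) 0) (ENNReal.ofReal r) volume ≤
      ENNReal.ofReal (B.toReal + 1) := by
    rw [eLpNorm_eq_lintegral_rpow_enorm_toReal (by simpa using hr0) (by simp),
      ENNReal.toReal_ofReal hr0.le, hθ]
    simp only [Real.enorm_eq_ofReal (le_max_right _ _)]
    refine (hb (hest S hvol)).trans ?_
    rw [← ENNReal.ofReal_toReal hB.ne, ENNReal.toReal_ofReal ENNReal.toReal_nonneg]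
    exact ENNReal.ofReal_le_ofReal (by linarith)
  refine ⟨⟨?_, hle.trans_lt ENNReal.ofReal_lt_top⟩, hle⟩
  rw [hθ]
  exact (S.measurable_head.max measurable_const).aestronglyMeasurable
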